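/- **Generalized Clapeyron Theorem.** Let $n\ge 1$, $m\ge 0$, and let $\Omega\subset\mathbb R^n$ be a bounded open set with Lipschitz boundary and outward unit normal $\mathbf n$ on $\partial\Omega$. For an energy density $W=W(x,y,F)$, $W:\mathbb R^n\times\mathbb R^m\times\mathbb R^{m\times n}\to\mathbb R$, put $E[y]=\int_\Omega W(x,y(x),\nabla y(x))\,dx$ and define the Piola tensor $P=W_F(x,y,F)$ and the Eshelby tensor $P^*=W(x,y,F)\,I_n-F^TP$. Let $\Sigma\subset\overline\Omega$ be a surface of jump discontinuity of $\nabla y$, by which we mean the following: $\Sigma\cap\Omega$ is relatively closed in $\Omega$ and is an embedded $C^1$ hypersurface (not necessarily connected); $\Sigma$ has finite $(n-1)$-dimensional area and $\Sigma\cap\partial\Omega$ has zero $(n-1)$-dimensional area (in particular $\Sigma\subset\Omega$ is allowed); and $\nabla y$ has one-sided limits $F_\pm(x)$ at every $x\in\Sigma\cap\Omega$. At each such $x$ a unit normal $\mathbf n$ to $\Sigma$ is chosen, pointing from the $-$ side to the $+$ side. With $[\![\,\cdot\,]\!]$ denoting the value on the $+$ side minus the value on the $-$ side, let $$p^*_\Sigma=[\![W]\!]-\langle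 P_+,[\![F]\!]\rangle ,\qquad \langle A,B\rangle=\sum_{i,\alpha}A_{i\alpha}B_{i\alpha},\quad P_+=W_F(x,y(x),F_+(x)).$$ Assume that $y:\overline\Omega\to\mathbb R^m$ is Lipschitz on $\Omega$, that $y\in C^2(\overline\Omega\setminus\Sigma)$, that $W$ is of class $C^1$ on an open set containing the closure of $\{(x,y(x),\nabla y(x)):x\in\Omega\setminus\Sigma\}$, and that $W$ is scale-free: $W(\lambda x,\lambda y,F)=W(x,y,F)$ for all $\lambda>0$ and all $(x,y,F)$. Assume that $y$ is an extremal, i.e. $W_y-\nabla\cdot P=0$ in the sense of distributions in $\Omega$: $\int_\Omega\{W_y\cdot\varphi+\langle P,\nabla\varphi\rangle\}\,dx=0$ for all $\varphi\in C_0^\infty(\Omega;\mathbb R^m)$. Then the integrals below converge absolutely and $$nE[y]=\int_{\partial\Omega}\{P\mathbf n\cdot y+P^*\mathbf n\cdot x\}\,dS-\int_\Sigma p^*_\Sigma\,\mathbf n\cdot x\,dS .$$ Moreover, $y$ is stationary, i.e. in addition $W_x-\nabla\cdot P^*=0$ in the sense of distributions in $\Omega$ ($\int_\Omega\{W_x\cdot\psi+\langle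 P^*,\nabla\psi\rangle\}\,dx=0$ for all $\psi\in C_0^\infty(\Omega;\mathbb R^n)$), if and only if $p^*_\Sigma=0$ at every point of $\Sigma\cap\Omega$; and in that case $$E[y]=\frac1n\int_{\partial\Omega}\{P\mathbf n\cdot y+P^*\mathbf n\cdot x\}\,dS .$$ -/

import Mathlib

open MeasureTheory Filter Topology Set
open scoped ContDiff

namespace Clapeyron

/-- Euclidean `n`-space. -/
abbrev Euc (n : ℕ) : Type := EuclideanSpace ℝ (Fin n)

/-- `m × n` matrices, as linear maps from `ℝⁿ` to `ℝᵐ`. -/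
abbrev Mat (m n : ℕ) : Type := Euc n →L[ℝ] Euc m

noncomputable section

/-! ### Tensors -/

/-- The matrix unit `E_{iα}`, i.e. `u ↦ u_α e_i`. -/
def matUnit {m n : ℕ} (i : Fin m) (α : Fin n) : Mat m n :=
  (innerSL ℝ (EuclideanSpace.single α (1 : ℝ) : Euc n)).smulRight
    (EuclideanSpace.single i (1 : ℝ) : Euc m)

/-- The Frobenius inner product `⟨A, B⟩ = ∑_{i,α} A_{iα} B_{iα}`, summed by columns. -/
def frob {m n : ℕ} (A B : Mat m n) : ℝ :=
  ∑ α : Fin n, inner ℝ (A (EuclideanSpace.single α (1 : ℝ))) (B (EuclideanSpace.single α (1 : ℝ)))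

/-- The Piola tensor `P = W_F(x, y, F)`, the matrix with entries `∂W/∂F_{iα}`. -/
def piola {m n : ℕ} (W : Euc n → Euc m → Mat m n → ℝ) (x : Euc n) (v : Euc m) (F : Mat m n) :
    Mat m n :=
  ∑ i : Fin m, ∑ α : Fin n, fderiv ℝ (W x v) F (matUnit i α) • matUnit i α

/-- The Eshelby tensor `P* = W Iₙ - Fᵀ P`. -/
def eshelby {m n : ℕ} (W : Euc n → Euc m → Mat m n → ℝ) (x : Euc n) (v : Euc m) (F : Mat m n) :
    Mat n n :=
  W x v F • ContinuousLinearMap.id ℝ (Euc n) -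
    (ContinuousLinearMap.adjoint F).comp (piola W x v F)

/-- `W` is scale-free: `W(λx, λy, F) = W(x, y, F)` for all `λ > 0`. -/
def ScaleFree {m n : ℕ} (W : Euc n → Euc m → Mat m n → ℝ) : Prop :=
  ∀ c : ℝ, 0 < c → ∀ (x : Euc n) (v : Euc m) (F : Mat m n), W (c • x) (c • v) F = W x v F

/-! ### The functional, its extremals and its stationary configurations -/

/-- The energy `E[y] = ∫_Ω W(x, y(x), ∇y(x)) dx`. -/
def energy {m n : ℕ} (W : Euc n → Euc m → Mat m n → ℝ) (Ω : Set (Euc n)) (y : Euc n → Euc m) : ℝ :=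
  ∫ x in Ω, W x (y x) (fderiv ℝ y x)

/-- `φ` is a smooth map with compact support contained in `Ω`. -/
def IsTestMap {n k : ℕ} (Ω : Set (Euc n)) (φ : Euc n → Euc k) : Prop :=
  ContDiff ℝ ∞ φ ∧ HasCompactSupport φ ∧ tsupport φ ⊆ Ω

/-- The Euler-Lagrange equation `W_y - ∇·P = 0` in the sense of distributions on `Ω`. -/
def IsExtremal {m n : ℕ} (W : Euc n → Euc m → Mat m n → ℝ) (Ω : Set (Euc n))
    (y : Euc n → Euc m) : Prop :=
  ∀ φ : Euc n → Euc m, IsTestMap Ω φ →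
    ∫ x in Ω, (fderiv ℝ (fun v => W x v (fderiv ℝ y x)) (y x) (φ x)
      + frob (piola W x (y x) (fderiv ℝ y x)) (fderiv ℝ φ x)) = 0

/-- `y` is an extremal and also satisfies `W_x - ∇·P* = 0` in the sense of distributions. -/
def IsStationaryConfig {m n : ℕ} (W : Euc n → Euc m → Mat m n → ℝ) (Ω : Set (Euc n))
    (y : Euc n → Euc m) : Prop :=
  IsExtremal W Ω y ∧
    ∀ ψ : Euc n → Euc n, IsTestMap Ω ψ →
      ∫ x in Ω, (fderiv ℝ (fun z => W z (y x) (fderiv ℝ y x)) x (ψ x)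
        + frob (eshelby W x (y x) (fderiv ℝ y x)) (fderiv ℝ ψ x)) = 0

/-! ### Hypersurfaces and boundaries -/

/-- The height of `z` above the graph of `g`, the vertical direction being the unit vector `e`
and `g` being evaluated at the orthogonal projection of `z` onto the hyperplane `e^⊥`. -/
def heightAbove {n : ℕ} (e : Euc n) (g : Euc n → ℝ) (z : Euc n) : ℝ :=
  inner ℝ e z - g (z - (inner ℝ e z) • e)

/-- Near each of its boundary points, `Ω` is the region below the graph of a Lipschitz function,
in suitable orthonormal coordinates. -/
def HasLipschitzBoundary {n : ℕ} (Ω : Set (Euc n)) : Prop :=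
  ∀ x ∈ frontier Ω, ∃ (e : Euc n) (g : Euc n → ℝ) (K : NNReal), ‖e‖ = 1 ∧ LipschitzWith K g ∧
    ∀ᶠ z in 𝓝 x, (z ∈ Ω ↔ heightAbove e g z < 0)

/-- `ν` is the outward unit normal to `Ω` at `x`: near `x`, every open cone around `-ν` of
opening smaller than a half-space lies in `Ω`, and every such cone around `ν` avoids `Ω`. -/
def IsOutwardUnitNormal {n : ℕ} (Ω : Set (Euc n)) (x ν : Euc n) : Prop :=
  ‖ν‖ = 1 ∧ ∀ ε : ℝ, 0 < ε → ∀ᶠ z in 𝓝 x,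
    (inner ℝ ν (z - x) < -(ε * ‖z - x‖) → z ∈ Ω) ∧
    (ε * ‖z - x‖ < inner ℝ ν (z - x) → z ∉ Ω)

/-- There is at most one outward unit normal at a point. -/
theorem IsOutwardUnitNormal.unique {n : ℕ} {Ω : Set (Euc n)} {x ν μ : Euc n}
    (hν : IsOutwardUnitNormal Ω x ν) (hμ : IsOutwardUnitNormal Ω x μ) : ν = μ := by
  by_contra hne
  set w : Euc n := μ - ν with hw
  have hw0 : 0 < ‖w‖ := norm_pos_iff.2 (sub_ne_zero.2 (Ne.symm hne))
  have h1 : ‖w‖ ^ 2 = 2 - 2 * inner ℝ ν μ := by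
    rw [hw, norm_sub_sq_real, hμ.1, hν.1, real_inner_comm]; ring
  have h2 : inner ℝ ν w = -(‖w‖ ^ 2 / 2) := by
    rw [hw, inner_sub_right, real_inner_self_eq_norm_sq, hν.1, ← hw, h1]; ring
  have h3 : inner ℝ μ w = ‖w‖ ^ 2 / 2 := by
    rw [hw, inner_sub_right, real_inner_self_eq_norm_sq, hμ.1, ← hw, h1, real_inner_comm]; ring
  have hcont : Tendsto (fun t : ℝ => x + t • w) (𝓝[>] 0) (𝓝 x) := by
    have : Tendsto (fun t : ℝ => x + t • w) (𝓝 0) (𝓝 (x + (0 : ℝ) • w)) :=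
      (Continuous.tendsto (by fun_prop) 0)
    simpa using this.mono_left nhdsWithin_le_nhds
  obtain ⟨t, ⟨ha, hb⟩, ht⟩ := ((hcont.eventually
    ((hν.2 (‖w‖ / 4) (by positivity)).and (hμ.2 (‖w‖ / 4) (by positivity)))).and
    self_mem_nhdsWithin).exists
  have ht : 0 < t := ht
  have hlt : ‖w‖ / 4 * (t * ‖w‖) < t * (‖w‖ ^ 2 / 2) := by
    have : 0 < t * ‖w‖ ^ 2 := by positivity
    nlinarith
  simp only [add_sub_cancel_left, inner_smul_right, norm_smul, Real.norm_eq_abs, abs_of_pos ht,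
    h2, h3] at ha hb
  exact hb.2 hlt (ha.1 (by linarith))

open Classical in
/-- The outward unit normal to `Ω` at `x` (and `0` where there is none). -/
def outwardNormal {n : ℕ} (Ω : Set (Euc n)) (x : Euc n) : Euc n :=
  if h : ∃ ν, IsOutwardUnitNormal Ω x ν then h.choose else 0

/-- Near `x`, the set `S` is a `C¹` hypersurface (a graph in suitable orthonormal coordinates)
with unit normal `ν` at `x`, and `∇y` has at `x` the one-sided limits `Fp`, from the side of `S`
into which `ν` points, and `Fm`, from the other side. -/
def HasGradientJump {m n : ℕ} (S : Set (Euc n)) (y : Euc n → Euc m) (x ν : Euc n)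
    (Fp Fm : Mat m n) : Prop :=
  ∃ (e : Euc n) (g : Euc n → ℝ), ‖e‖ = 1 ∧ ContDiff ℝ 1 g ∧
    (∀ᶠ z in 𝓝 x, (z ∈ S ↔ heightAbove e g z = 0)) ∧
    ν = ‖gradient (heightAbove e g) x‖⁻¹ • gradient (heightAbove e g) x ∧
    Tendsto (fderiv ℝ y) (𝓝[{z | 0 < heightAbove e g z}] x) (𝓝 Fp) ∧
    Tendsto (fderiv ℝ y) (𝓝[{z | heightAbove e g z < 0}] x) (𝓝 Fm)

/-- The scalar `p* = ⟦W⟧ - ⟨P₊, ⟦F⟧⟩` at a point `x` with `y(x) = v` and one-sided gradients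
`Fp`, `Fm`; here `⟦·⟧` is the value on the `+` side minus the value on the `-` side. -/
def pStar {m n : ℕ} (W : Euc n → Euc m → Mat m n → ℝ) (x : Euc n) (v : Euc m)
    (Fp Fm : Mat m n) : ℝ :=
  (W x v Fp - W x v Fm) - frob (piola W x v Fp) (Fp - Fm)

/-- The density `P n · y + P* n · x` of the work of physical and configurational tractions, at a
point `x` with normal `ν`, value `v = y(x)` and gradient `F = ∇y(x)`. -/
def tractionWork {m n : ℕ} (W : Euc n → Euc m → Mat m n → ℝ) (x ν : Euc n) (v : Euc m)
    (F : Mat m n) : ℝ :=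
  inner ℝ (piola W x v F ν) v + inner ℝ (eshelby W x v F ν) x

end

end Clapeyron

open Clapeyron

namespace Clapeyron

noncomputable section

/-! The theorem is Noether's theorem for the scaling symmetry, with the surface accounted for. The
variation δx = ψ(x), δy = c y has a flux, ℓ ↦ W ℓ(ψ) + ⟨P, (c y - Fψ) ⊗ ℓ⟩ (`noetherFlux`), and a
rate of change of the energy density (`noetherSource`). For an extremal, the divergence of the flux
off the surface is the source (`JumpSetting.noetherFlux_weak`). For ψ(x) = x and c = 1, Euler's
identity for a scale-free W reduces the source to nW, while the flux through a unit normal n is P n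
· y + P* n · x. For a test field ψ and c = 0, the source is W_x · ψ + ⟨P*, ∇ψ⟩.

On the surface, the Euler-Lagrange equation makes the traction Pν continuous
(`JumpSetting.traction_continuous`), and continuity of y gives Hadamard's condition ⟦F⟧ = a ⊗ ν
(`JumpSetting.gradient_jump_tangent`). Together they reduce the jump of the normal Noether flux to
p* ν · ψ (`JumpSetting.normalJump_noetherFlux`). Integrating the source over Ω then leaves the
boundary flux minus the integral of p* ν · ψ. The first choice of (ψ, c) is the energy identity. The
second says that the weak configurational balance is minus the work of p*, so by the fundamental
lemma on the surface it holds exactly when p* = 0.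

The analytic difficulty is low regularity. W is only C¹, so P has no classical divergence and
Noether's theorem must be weak: the Euler-Lagrange equation is tested with η (c y - ∇y ψ), which is
only C¹. Hence `weak_equation_of_lipschitz` extends weak equations from smooth to Lipschitz test
maps by mollification. The same extension admits Lipschitz cut-offs that vanish near a Lipschitz
graph, and shrinking their transition layer yields a Gauss-Green formula for bounded fields that
have a weak divergence and boundary limits along the axis (`Frame.gauss_green_below`). The area
formula for Lipschitz graphs converts its boundary term into a Hausdorff integral.

The surface may accumulate at the boundary, so Ω is not cut along it globally. Gauss-Green is
applied on both sides of small pieces of the surface to find the weak divergence of the flux inside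
Ω, which is a bulk density minus the normal jump on the surface (`JumpSetting.weak_divergence_eq`).
That measure is then fed into Gauss-Green in charts of the boundary
(`BoundedJumpSetting.gauss_green`), and a partition of unity glues the charts. -/

/-! ### Orthonormal frames with a distinguished axis -/

/-- An orthonormal splitting of `ℝ^{k+1}` into a hyperplane `ℝ^k` and an axis `ℝ`. -/
abbrev Frame (k : ℕ) : Type := WithLp 2 (Euc k × ℝ) ≃ₗᵢ[ℝ] Euc (k + 1)

namespace Frame

variable {k : ℕ} (Φ : Frame k)

/-- The point with horizontal coordinate `x` and vertical coordinate `t`. -/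
def pt (x : Euc k) (t : ℝ) : Euc (k + 1) := Φ (WithLp.toLp 2 (x, t))

/-- The horizontal coordinate. -/
def base : Euc (k + 1) →L[ℝ] Euc k :=
  (ContinuousLinearMap.fst ℝ (Euc k) ℝ).comp
    ((WithLp.prodContinuousLinearEquiv 2 ℝ (Euc k) ℝ).toContinuousLinearMap.comp
      Φ.symm.toContinuousLinearEquiv.toContinuousLinearMap)

/-- The vertical coordinate. -/
def height : Euc (k + 1) →L[ℝ] ℝ :=
  (ContinuousLinearMap.snd ℝ (Euc k) ℝ).comp
    ((WithLp.prodContinuousLinearEquiv 2 ℝ (Euc k) ℝ).toContinuousLinearMap.comp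
      Φ.symm.toContinuousLinearEquiv.toContinuousLinearMap)

/-- The vertical unit vector. -/
def axis : Euc (k + 1) := Φ.pt 0 1

@[simp] theorem base_pt (x : Euc k) (t : ℝ) : Φ.base (Φ.pt x t) = x := by
  simp [base, pt]

@[simp] theorem height_pt (x : Euc k) (t : ℝ) : Φ.height (Φ.pt x t) = t := by
  simp [height, pt]

@[simp] theorem pt_base_height (z : Euc (k + 1)) : Φ.pt (Φ.base z) (Φ.height z) = z := by
  have : WithLp.toLp 2 (Φ.base z, Φ.height z) = Φ.symm z := by
    simp only [base, height]; rfl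
  rw [pt, this, LinearIsometryEquiv.apply_symm_apply]

theorem pt_add (x y : Euc k) (s t : ℝ) : Φ.pt (x + y) (s + t) = Φ.pt x s + Φ.pt y t := by
  rw [pt, pt, pt, ← map_add]; rfl

theorem pt_smul (c : ℝ) (x : Euc k) (t : ℝ) : Φ.pt (c • x) (c * t) = c • Φ.pt x t := by
  rw [pt, pt, ← map_smul]; rfl

theorem pt_add_smul_axis (x : Euc k) (s t : ℝ) : Φ.pt x s + t • Φ.axis = Φ.pt x (s + t) := by
  rw [axis, ← pt_smul, ← pt_add]; simp

theorem norm_pt_sq (x : Euc k) (t : ℝ) : ‖Φ.pt x t‖ ^ 2 = ‖x‖ ^ 2 + t ^ 2 := by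
  rw [pt, LinearIsometryEquiv.norm_map, WithLp.prod_norm_sq_eq_of_L2]
  simp

theorem inner_pt (x y : Euc k) (s t : ℝ) :
    inner ℝ (Φ.pt x s) (Φ.pt y t) = inner ℝ x y + s * t := by
  rw [pt, pt, LinearIsometryEquiv.inner_map_map, WithLp.prod_inner_apply]
  simp [mul_comm]

theorem norm_axis : ‖Φ.axis‖ = 1 := by
  have := Φ.norm_pt_sq 0 1
  rw [axis]
  have h0 : 0 ≤ ‖Φ.pt 0 1‖ := norm_nonneg _
  nlinarith [norm_zero (E := Euc k)]

theorem inner_axis (z : Euc (k + 1)) : inner ℝ Φ.axis z = Φ.height z := by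
  conv_lhs => rw [← Φ.pt_base_height z, axis, inner_pt]
  simp

theorem sub_inner_smul_axis (z : Euc (k + 1)) :
    z - (inner ℝ Φ.axis z : ℝ) • Φ.axis = Φ.pt (Φ.base z) 0 := by
  rw [inner_axis, sub_eq_iff_eq_add, pt_add_smul_axis, zero_add, pt_base_height]

theorem continuous_pt : Continuous fun p : Euc k × ℝ => Φ.pt p.1 p.2 :=
  Φ.continuous.comp (WithLp.prod_continuous_toLp 2 _ _)

theorem measurePreserving_pt :
    MeasurePreserving (fun p : Euc k × ℝ => Φ.pt p.1 p.2) volume volume :=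
  (LinearIsometryEquiv.measurePreserving Φ).comp (WithLp.volume_preserving_toLp (Euc k) ℝ)

/-- Each unit vector is the axis of a frame. -/
theorem exists_axis_eq {e : Euc (k + 1)} (he : ‖e‖ = 1) : ∃ Φ : Frame k, Φ.axis = e := by
  have hfin : Module.finrank ℝ (WithLp 2 (Euc k × ℝ)) = Module.finrank ℝ (Euc (k + 1)) := by
    rw [(WithLp.linearEquiv 2 ℝ (Euc k × ℝ)).finrank_eq]; simp
  let Ψ : Frame k := (stdOrthonormalBasis ℝ _).equiv (stdOrthonormalBasis ℝ _) (finCongr hfin)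
  refine ⟨Ψ.trans (Submodule.reflection (ℝ ∙ (Ψ.axis - e))ᗮ), ?_⟩
  have := Submodule.reflection_sub (Ψ.norm_axis.trans he.symm)
  exact this

end Frame

end

end Clapeyron

namespace Clapeyron

noncomputable section

/-! ### The area formula for Lipschitz graphs -/

/-- Comparison of Euclidean Hausdorff measures of two images of the same set. -/
theorem euclideanHausdorffMeasure_image_le_of_dist_le {α X Y : Type*}
    [MetricSpace X] [MeasurableSpace X] [BorelSpace X]
    [MetricSpace Y] [MeasurableSpace Y] [BorelSpace Y] (d : ℕ)
    {f : α → X} {h : α → Y} {s : Set α} {C : NNReal}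
    (hfh : ∀ u ∈ s, ∀ v ∈ s, dist (f u) (f v) ≤ C * dist (h u) (h v)) :
    (μHE[d] : Measure X) (f '' s) ≤ (C : ENNReal) ^ d * (μHE[d] : Measure Y) (h '' s) := by
  classical
  rcases s.eq_empty_or_nonempty with rfl | ⟨a, ha⟩
  · simp
  have : Nonempty α := ⟨a⟩
  -- The map `h` need not be injective on `s`, but the hypothesis forces `f` to be constant on its
  -- fibres. So `f` factors through `h` by a `C`-Lipschitz map.
  set p : Y → X := fun w => f (Function.invFunOn h s w) with hp
  have hL : LipschitzOnWith C p (h '' s) := by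
    refine LipschitzOnWith.of_dist_le_mul fun w hw w' hw' => ?_
    have h1 := Function.invFunOn_mem hw
    have h2 := Function.invFunOn_mem hw'
    have e1 := Function.invFunOn_eq hw
    have e2 := Function.invFunOn_eq hw'
    have := hfh _ h1 _ h2
    rwa [e1, e2] at this
  have hsub : f '' s ⊆ p '' (h '' s) := by
    rintro _ ⟨u, hu, rfl⟩
    refine ⟨h u, mem_image_of_mem _ hu, ?_⟩
    have hw : h u ∈ h '' s := mem_image_of_mem _ hu
    have := hfh _ (Function.invFunOn_mem hw) _ hu
    rw [Function.invFunOn_eq hw, dist_self, mul_zero] at this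
    exact dist_le_zero.1 this
  refine (measure_mono hsub).trans ?_
  rw [Measure.euclideanHausdorffMeasure_def, Measure.euclideanHausdorffMeasure_def,
    Measure.smul_apply, Measure.smul_apply]
  have := hL.hausdorffMeasure_image_le (d := (d : ℝ)) (by positivity)
  rw [ENNReal.rpow_natCast] at this
  rw [ENNReal.smul_def, ENNReal.smul_def, smul_eq_mul, smul_eq_mul, mul_left_comm]
  gcongr

variable {k : ℕ}

/-- The Jacobian factor `√(1 + |L|²)` of the graph of `L`. -/
def graphJac (L : StrongDual ℝ (Euc k)) : ℝ := √(1 + ‖L‖ ^ 2)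

theorem one_le_graphJac (L : StrongDual ℝ (Euc k)) : 1 ≤ graphJac L := by
  rw [graphJac, Real.one_le_sqrt]; nlinarith [sq_nonneg ‖L‖]

theorem graphJac_sq (L : StrongDual ℝ (Euc k)) : graphJac L ^ 2 = 1 + ‖L‖ ^ 2 :=
  Real.sq_sqrt (by positivity)

theorem continuous_graphJac : Continuous (graphJac (k := k)) := by
  unfold graphJac; fun_prop

/-- `√(1+a²) ≤ (1+r)√(1+b²)` when `|a-b| ≤ r`. -/
theorem graphJac_le {L M : StrongDual ℝ (Euc k)} {r : ℝ} (hr : 0 ≤ r) (h : ‖L - M‖ ≤ r) :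
    graphJac L ≤ (1 + r) * graphJac M := by
  have h1 : ‖L‖ ≤ ‖M‖ + r := by
    have := norm_sub_norm_le L M; linarith
  have hM := one_le_graphJac M
  rw [graphJac, Real.sqrt_le_left (by positivity)]
  have h2 : ‖L‖ ^ 2 ≤ (‖M‖ + r) ^ 2 := by gcongr
  have h3 := graphJac_sq M
  rw [mul_pow, h3]
  nlinarith [mul_nonneg hr (sq_nonneg (‖M‖ - 1)), mul_nonneg hr (sq_nonneg ‖M‖),
    mul_nonneg (sq_nonneg r) (sq_nonneg ‖M‖)]

/-- There is a linear endomorphism of `ℝ^k` with the metric and the volume distortion of the graph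
map of `L`. -/
theorem exists_graph_model (L : StrongDual ℝ (Euc k)) :
    ∃ D : Euc k →ₗ[ℝ] Euc k, (∀ w, ‖D w‖ ^ 2 = ‖w‖ ^ 2 + L w ^ 2) ∧ LinearMap.det D = graphJac L := by
  set l : Euc k := (InnerProductSpace.toDual ℝ (Euc k)).symm L with hl
  have hLl : ∀ w, L w = inner ℝ l w := fun w => by
    rw [hl, InnerProductSpace.toDual_symm_apply]
  have hnl : ‖l‖ = ‖L‖ := by rw [hl, LinearIsometryEquiv.norm_map]
  -- The model is `w + κ L(w) l`, which fixes the complement of `l` and multiplies `l` by 1 + κ|l|².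
  -- This factor must be `graphJac L`. For `L = 0` the division gives κ = 0, which is also right.
  set κ : ℝ := (graphJac L - 1) / ‖L‖ ^ 2 with hκ
  have hκl : κ * ‖L‖ ^ 2 = graphJac L - 1 := by
    rcases eq_or_ne ‖L‖ 0 with h0 | h0
    · rw [h0]; simp [graphJac, h0]
    · rw [hκ]; field_simp
  refine ⟨LinearMap.transvection L.toLinearMap (κ • l), fun w => ?_, ?_⟩
  · have : LinearMap.transvection L.toLinearMap (κ • l) w = w + L w • (κ • l) := rfl
    rw [this, norm_add_sq_real, smul_smul, norm_smul, inner_smul_right, real_inner_comm, ← hLl,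
      mul_pow, Real.norm_eq_abs, sq_abs, hnl]
    have h2 := graphJac_sq L
    rcases eq_or_ne ‖L‖ 0 with h0 | h0
    · have : L = 0 := norm_eq_zero.1 h0
      simp [this]
    · have h3 : (2 * κ + κ ^ 2 * ‖L‖ ^ 2) * ‖L‖ ^ 2 = 1 * ‖L‖ ^ 2 := by
        have : (κ * ‖L‖ ^ 2) * (2 + κ * ‖L‖ ^ 2) = ‖L‖ ^ 2 := by rw [hκl]; linarith
        linarith
      have h4 := mul_right_cancel₀ (pow_ne_zero 2 h0) h3
      linear_combination (L w) ^ 2 * h4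
  · rw [LinearMap.transvection.det]
    have : L.toLinearMap (κ • l) = κ * ‖L‖ ^ 2 := by
      change L (κ • l) = _
      rw [map_smul, hLl, real_inner_self_eq_norm_sq, hnl, smul_eq_mul]
    rw [this, hκl]; ring

namespace Frame
variable (Φ : Frame k)

/-- The parametrization of the graph of `G`. -/
def graph (G : Euc k → ℝ) (x : Euc k) : Euc (k + 1) := Φ.pt x (G x)

theorem dist_graph_sq (G : Euc k → ℝ) (u v : Euc k) :
    dist (Φ.graph G u) (Φ.graph G v) ^ 2 = ‖u - v‖ ^ 2 + (G u - G v) ^ 2 := by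
  have : Φ.graph G u - Φ.graph G v = Φ.pt (u - v) (G u - G v) := by
    rw [sub_eq_iff_eq_add, graph, graph, ← pt_add]; simp
  rw [dist_eq_norm, this, norm_pt_sq]

/-- A piece on which `G` is nearly linear: two-sided comparison with the linear model. -/
theorem measure_graph_image_bounds {G : Euc k → ℝ} {L : StrongDual ℝ (Euc k)} {r : NNReal}
    {s : Set (Euc k)} (hG : ApproximatesLinearOn G L s r) :
    μHE[k] (Φ.graph G '' s) ≤ ((1 + r : NNReal) : ENNReal) ^ k *
        (ENNReal.ofReal (graphJac L) * volume s) ∧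
    ENNReal.ofReal (graphJac L) * volume s ≤ ((1 + r : NNReal) : ENNReal) ^ k *
        μHE[k] (Φ.graph G '' s) := by
  obtain ⟨D, hD, hdet⟩ := exists_graph_model L
  have hvol : (μHE[k] : Measure (Euc k)) (D '' s) = ENNReal.ofReal (graphJac L) * volume s := by
    rw [EuclideanSpace.euclideanHausdorffMeasure_eq_volume, Measure.addHaar_image_linearMap, hdet,
      abs_of_nonneg (zero_le_one.trans (one_le_graphJac L))]
  have key : ∀ u ∈ s, ∀ v ∈ s,
      |dist (Φ.graph G u) (Φ.graph G v) - dist (D u) (D v)| ≤ r * dist (D u) (D v) ∧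
      |dist (Φ.graph G u) (Φ.graph G v) - dist (D u) (D v)| ≤
        r * dist (Φ.graph G u) (Φ.graph G v) := by
    intro u hu v hv
    have h1 := Φ.dist_graph_sq G u v
    have h2 : dist (D u) (D v) ^ 2 = ‖u - v‖ ^ 2 + (L (u - v)) ^ 2 := by
      rw [dist_eq_norm, ← map_sub, hD]
    have h3 : |G u - G v - L (u - v)| ≤ r * ‖u - v‖ := by
      have := hG u hu v hv; rwa [Real.norm_eq_abs] at this
    set a := dist (Φ.graph G u) (Φ.graph G v)
    set b := dist (D u) (D v)
    have ha : 0 ≤ a := dist_nonneg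
    have hb : 0 ≤ b := dist_nonneg
    have hua : ‖u - v‖ ≤ a := abs_le_of_sq_le_sq' (by nlinarith [sq_nonneg (G u - G v)]) ha |>.2
    have hub : ‖u - v‖ ≤ b := abs_le_of_sq_le_sq' (by nlinarith [sq_nonneg (L (u - v))]) hb |>.2
    -- Reverse triangle inequality for the plane vectors (c, p) and (c, q), of lengths a and b;
    -- `hab` is Cauchy-Schwarz.
    have h4 : |a - b| ≤ |G u - G v - L (u - v)| := by
      set p := G u - G v
      set q := L (u - v)
      set c := ‖u - v‖
      have hab : c ^ 2 + p * q ≤ a * b := by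
        refine abs_le_of_sq_le_sq' ?_ (mul_nonneg ha hb) |>.2
        rw [mul_pow, h1, h2]; nlinarith [sq_nonneg (c * (p - q))]
      refine sq_le_sq.1 ?_
      nlinarith
    have hr0 : (0 : ℝ) ≤ r := r.2
    exact ⟨h4.trans (h3.trans (by gcongr)), h4.trans (h3.trans (by gcongr))⟩
  rw [← hvol]
  have hr0 : (0 : ℝ) ≤ r := r.2
  constructor
  · refine euclideanHausdorffMeasure_image_le_of_dist_le k fun u hu v hv => ?_
    have := (abs_le.1 (key u hu v hv).1).2
    have hb : 0 ≤ dist (D u) (D v) := dist_nonneg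
    push_cast
    nlinarith
  · refine euclideanHausdorffMeasure_image_le_of_dist_le k fun u hu v hv => ?_
    have := (abs_le.1 (key u hu v hv).2).1
    have hb : 0 ≤ dist (Φ.graph G u) (Φ.graph G v) := dist_nonneg
    push_cast
    nlinarith

/-- The approximation on each piece controls the measure of its image, and the closeness of the
derivative to `L i` controls the integral of the Jacobian. The derivative is first confined to balls
of radius r/2. The linear map of a nonempty piece is the derivative at some point of the same ball,
hence r-close to all the others. -/
theorem exists_pieces {G : Euc k → ℝ} {r : NNReal} (hr : r ≠ 0) :
    ∃ (t : ℕ × ℕ → Set (Euc k)) (L : ℕ × ℕ → StrongDual ℝ (Euc k)),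
      (∀ i, MeasurableSet (t i)) ∧ {x | DifferentiableAt ℝ G x} ⊆ ⋃ i, t i ∧
      ∀ i, ApproximatesLinearOn G (L i) (t i) r ∧ ∀ x ∈ t i, ‖fderiv ℝ G x - L i‖ ≤ r := by
  set M := TopologicalSpace.denseSeq (StrongDual ℝ (Euc k))
  have hr0 : (0 : ℝ) < r := by positivity
  set E : ℕ → Set (Euc k) := fun i =>
    {x | DifferentiableAt ℝ G x} ∩ {x | ‖fderiv ℝ G x - M i‖ < r / 2} with hE
  have hEm : ∀ i, MeasurableSet (E i) := fun i =>
    (measurableSet_of_differentiableAt ℝ G).inter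
      (measurableSet_lt (((measurable_fderiv ℝ G).sub_const _).norm) measurable_const)
  have hex := fun i => exists_partition_approximatesLinearOn_of_hasFDerivWithinAt G (E i)
    (fderiv ℝ G) (fun x hx => hx.1.hasFDerivAt.hasFDerivWithinAt) (fun _ => r) (fun _ => hr)
  choose t A _ htm htc hta hty using hex
  refine ⟨fun p => E p.1 ∩ t p.1 p.2, fun p => A p.1 p.2, fun p => (hEm _).inter (htm _ _), ?_, ?_⟩
  · intro x hx
    obtain ⟨i, hi⟩ := (TopologicalSpace.denseRange_denseSeq (StrongDual ℝ (Euc k))).exists_dist_lt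
      (fderiv ℝ G x) (half_pos hr0)
    have hxE : x ∈ E i := ⟨hx, by rwa [dist_eq_norm] at hi⟩
    obtain ⟨n, hn⟩ := mem_iUnion.1 (htc i hxE)
    exact mem_iUnion.2 ⟨(i, n), hxE, hn⟩
  · rintro ⟨i, n⟩
    refine ⟨hta i n, fun x hx => ?_⟩
    obtain ⟨y, hy, hAy⟩ := hty i ⟨x, hx.1⟩ n
    have h1 : ‖fderiv ℝ G x - M i‖ < r / 2 := hx.1.2
    have h2 : ‖fderiv ℝ G y - M i‖ < r / 2 := hy.2
    simp only [hAy]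
    calc ‖fderiv ℝ G x - fderiv ℝ G y‖
        = ‖(fderiv ℝ G x - M i) - (fderiv ℝ G y - M i)‖ := by congr 1; abel
      _ ≤ _ := (norm_sub_le _ _).trans (by linarith)

theorem continuous_graph {G : Euc k → ℝ} (hG : Continuous G) : Continuous (Φ.graph G) :=
  Φ.continuous_pt.comp (continuous_id.prodMk hG)

theorem graph_injective (G : Euc k → ℝ) : Function.Injective (Φ.graph G) := fun u v h => by
  have := congrArg Φ.base h
  simpa [graph] using this

theorem measurableEmbedding_graph {G : Euc k → ℝ} (hG : Continuous G) :
    MeasurableEmbedding (Φ.graph G) :=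
  (Φ.continuous_graph hG).measurableEmbedding (Φ.graph_injective G)

/-- Needed for the set where `G` is not differentiable: it is null by Rademacher's theorem, but its
image must also be null. -/
theorem euclideanHausdorffMeasure_graph_null {G : Euc k → ℝ} {K : NNReal} (hG : LipschitzWith K G)
    {s : Set (Euc k)} (hs : volume s = 0) : μHE[k] (Φ.graph G '' s) = 0 := by
  have h := euclideanHausdorffMeasure_image_le_of_dist_le (f := Φ.graph G) (h := id) (s := s)
    (C := 1 + K) k (fun u _ v _ => ?_)
  · rw [image_id, EuclideanSpace.euclideanHausdorffMeasure_eq_volume, hs, mul_zero] at h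
    exact le_antisymm h bot_le
  · have h1 := Φ.dist_graph_sq G u v
    have h2 : |G u - G v| ≤ K * dist u v := by
      have := hG.dist_le_mul u v; rwa [Real.dist_eq] at this
    have hd : (0 : ℝ) ≤ dist u v := dist_nonneg
    rw [← dist_eq_norm] at h1
    refine abs_le_of_sq_le_sq' ?_ (by positivity) |>.2
    rw [h1, id, id]
    have h3 : (G u - G v) ^ 2 ≤ (K * dist u v) ^ 2 := sq_le_sq' (by linarith [neg_abs_le (G u - G v)])
      (by linarith [le_abs_self (G u - G v)])
    push_cast
    have hK : (0 : ℝ) ≤ K := K.2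
    nlinarith [mul_nonneg hK (sq_nonneg (dist u v))]

theorem measurable_graphJac_fderiv (G : Euc k → ℝ) :
    Measurable fun x => ENNReal.ofReal (graphJac (fderiv ℝ G x)) :=
  (continuous_graphJac.measurable.comp (measurable_fderiv ℝ G)).ennreal_ofReal

/-- The surface measure of a Lipschitz graph in terms of its parametrization. -/
theorem euclideanHausdorffMeasure_graph_image {G : Euc k → ℝ} {K : NNReal} (hG : LipschitzWith K G)
    {s : Set (Euc k)} (hs : MeasurableSet s) :
    μHE[k] (Φ.graph G '' s) = ∫⁻ x in s, ENNReal.ofReal (graphJac (fderiv ℝ G x)) := by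
  have hemb := Φ.measurableEmbedding_graph hG.continuous
  set μ₁ : Measure (Euc k) := Measure.comap (Φ.graph G) μHE[k] with hμ₁
  set J : Euc k → ENNReal := fun x => ENNReal.ofReal (graphJac (fderiv ℝ G x)) with hJ
  set μ₂ : Measure (Euc k) := volume.withDensity J with hμ₂
  have h₁ : ∀ A, MeasurableSet A → μ₁ A = μHE[k] (Φ.graph G '' A) := fun A _ =>
    hemb.comap_apply _ _
  have h₂ : ∀ A, MeasurableSet A → μ₂ A = ∫⁻ x in A, J x := fun A hA => withDensity_apply _ hA
  rw [← h₁ s hs, ← h₂ s hs]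
  have hnull : volume {x | DifferentiableAt ℝ G x}ᶜ = 0 := hG.ae_differentiableAt
  -- Of the k + 1 factors 1 + r, k come from comparing Hausdorff measures under a bi-Lipschitz
  -- change and one from replacing the Jacobian by its constant model. Letting r tend to 0 gives
  -- equality.
  have hbound : ∀ r : NNReal, r ≠ 0 →
      μ₁ s ≤ ((1 + r : NNReal) : ENNReal) ^ (k + 1) * μ₂ s ∧
      μ₂ s ≤ ((1 + r : NNReal) : ENNReal) ^ (k + 1) * μ₁ s := by
    intro r hr
    obtain ⟨t, L, htm, htc, ht⟩ := exists_pieces (G := G) hr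
    obtain ⟨e⟩ : Nonempty (ℕ ≃ ℕ × ℕ) := ⟨Nat.pairEquiv.symm⟩
    set T : ℕ → Set (Euc k) := fun i => s ∩ disjointed (fun i => t (e i)) i with hT
    have hTm : ∀ i, MeasurableSet (T i) := fun i =>
      hs.inter (MeasurableSet.disjointed (fun i => htm (e i)) i)
    have hTd : Pairwise (Function.onFun Disjoint T) := fun i j hij =>
      ((disjoint_disjointed (fun i => t (e i))) hij).mono inter_subset_right inter_subset_right
    have hTu : ⋃ i, T i = s ∩ ⋃ i, t i := by
      rw [hT, ← inter_iUnion, iUnion_disjointed, e.surjective.iUnion_comp t]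
    have hTt : ∀ i, T i ⊆ t (e i) := fun i => inter_subset_right.trans (disjointed_subset _ _)
    have hsub : s \ ⋃ i, T i ⊆ {x | DifferentiableAt ℝ G x}ᶜ := fun x hx hx' =>
      hx.2 (by rw [hTu]; exact ⟨hx.1, htc hx'⟩)
    have hUm : MeasurableSet (⋃ i, T i) := MeasurableSet.iUnion hTm
    have hUs : ⋃ i, T i ⊆ s := by rw [hTu]; exact inter_subset_left
    have hn0 : volume (s \ ⋃ i, T i) = 0 := measure_mono_null hsub hnull
    have hsum : ∀ μ : Measure (Euc k), μ (s \ ⋃ i, T i) = 0 → μ s = ∑' i, μ (T i) := fun μ hμ => by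
      rw [← measure_iUnion hTd hTm, ← measure_sdiff_add_inter s hUm, hμ, zero_add,
        inter_eq_self_of_subset_right hUs]
    have e₁ := hsum μ₁ (by
      rw [h₁ _ (hs.diff hUm)]; exact Φ.euclideanHausdorffMeasure_graph_null hG hn0)
    have e₂ := hsum μ₂ (withDensity_absolutelyContinuous _ _ hn0)
    have hJle : ∀ i, ∀ x ∈ T i, J x ≤ (1 + r : NNReal) * ENNReal.ofReal (graphJac (L (e i))) ∧
        ENNReal.ofReal (graphJac (L (e i))) ≤ (1 + r : NNReal) * J x := by
      intro i x hx
      have hx' := (ht (e i)).2 x (hTt i hx)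
      have hc : ((1 + r : NNReal) : ENNReal) = ENNReal.ofReal (1 + r) := by
        rw [← ENNReal.ofReal_coe_nnreal]; simp
      rw [hc, hJ, ← ENNReal.ofReal_mul (by positivity), ← ENNReal.ofReal_mul (by positivity)]
      exact ⟨ENNReal.ofReal_le_ofReal (graphJac_le r.2 hx'),
        ENNReal.ofReal_le_ofReal (graphJac_le r.2 (by rwa [norm_sub_rev]))⟩
    have hpiece : ∀ i, μ₁ (T i) ≤ ((1 + r : NNReal) : ENNReal) ^ (k + 1) * μ₂ (T i) ∧
        μ₂ (T i) ≤ ((1 + r : NNReal) : ENNReal) ^ (k + 1) * μ₁ (T i) := by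
      intro i
      obtain ⟨b₁, b₂⟩ := Φ.measure_graph_image_bounds ((ht (e i)).1.mono_set (hTt i))
      rw [h₁ _ (hTm i), h₂ _ (hTm i)]
      have c₁ : ∫⁻ x in T i, J x ≤ (1 + r : NNReal) *
          (ENNReal.ofReal (graphJac (L (e i))) * volume (T i)) := by
        rw [← mul_assoc, ← setLIntegral_const]
        exact setLIntegral_mono measurable_const fun x hx => (hJle i x hx).1
      have c₂ : ENNReal.ofReal (graphJac (L (e i))) * volume (T i) ≤
          (1 + r : NNReal) * ∫⁻ x in T i, J x := by
        rw [← lintegral_const_mul _ (measurable_graphJac_fderiv G), ← setLIntegral_const]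
        exact setLIntegral_mono ((measurable_graphJac_fderiv G).const_mul _)
          fun x hx => (hJle i x hx).2
      constructor
      · refine b₁.trans ?_
        rw [pow_succ, mul_assoc]; gcongr
      · refine c₁.trans ?_
        rw [pow_succ', mul_assoc]; gcongr
    rw [e₁, e₂, ← ENNReal.tsum_mul_left, ← ENNReal.tsum_mul_left]
    exact ⟨ENNReal.tsum_le_tsum fun i => (hpiece i).1, ENNReal.tsum_le_tsum fun i => (hpiece i).2⟩
  have hlim : ∀ c : ENNReal, Tendsto (fun r : NNReal => ((1 + r : NNReal) : ENNReal) ^ (k + 1) * c)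
      (𝓝[≠] 0) (𝓝 c) := by
    intro c
    have h0 : Tendsto (fun r : NNReal => ((1 + r : NNReal) : ENNReal) ^ (k + 1)) (𝓝[≠] 0)
        (𝓝 1) := by
      have : Continuous fun r : NNReal => ((1 + r : NNReal) : ENNReal) ^ (k + 1) := by fun_prop
      have := this.tendsto 0
      simp only [add_zero, ENNReal.coe_one, one_pow] at this
      exact this.mono_left nhdsWithin_le_nhds
    simpa using ENNReal.Tendsto.mul_const h0 (b := c) (Or.inl one_ne_zero)
  refine le_antisymm ?_ ?_
  · exact ge_of_tendsto (hlim _) (eventually_mem_nhdsWithin.mono fun r hr => (hbound r hr).1)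
  · exact ge_of_tendsto (hlim _) (eventually_mem_nhdsWithin.mono fun r hr => (hbound r hr).2)

/-- **Area formula** for Lipschitz graphs. -/
theorem map_graph_withDensity {G : Euc k → ℝ} {K : NNReal} (hG : LipschitzWith K G) :
    Measure.map (Φ.graph G)
      (volume.withDensity fun x => ENNReal.ofReal (graphJac (fderiv ℝ G x))) =
    μHE[k].restrict (range (Φ.graph G)) := by
  have hemb := Φ.measurableEmbedding_graph hG.continuous
  ext A hA
  rw [Measure.map_apply hemb.measurable hA, withDensity_apply _ (hemb.measurable hA),
    ← Φ.euclideanHausdorffMeasure_graph_image hG (hemb.measurable hA), Measure.restrict_apply hA,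
    image_preimage_eq_inter_range]

end Frame

end

end Clapeyron

namespace Clapeyron

noncomputable section

/-! ### From smooth to Lipschitz test maps -/

section Mollify

variable {n : ℕ} {F : Type*} [NormedAddCommGroup F] [NormedSpace ℝ F] [FiniteDimensional ℝ F]

open scoped Convolution

theorem norm_normed_convolution_le {X : Type*} [NormedAddCommGroup X] [NormedSpace ℝ X]
    (ρ : ContDiffBump (0 : Euc n)) {g : Euc n → X} {C : ℝ} (hg : ∀ x, ‖g x‖ ≤ C) (x : Euc n) :
    ‖(ρ.normed volume ⋆[ContinuousLinearMap.lsmul ℝ ℝ, volume] g) x‖ ≤ C := by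
  rw [convolution_def]
  calc ‖∫ t, (ContinuousLinearMap.lsmul ℝ ℝ) (ρ.normed volume t) (g (x - t))‖
      ≤ ∫ t, ρ.normed volume t * C := by
        refine norm_integral_le_of_norm_le (ρ.integrable_normed.mul_const C) (ae_of_all _ fun t => ?_)
        rw [ContinuousLinearMap.lsmul_apply, norm_smul, Real.norm_eq_abs,
          abs_of_nonneg (ρ.nonneg_normed t)]
        exact mul_le_mul_of_nonneg_left (hg _) (ρ.nonneg_normed t)
    _ = C := by rw [integral_mul_const, ρ.integral_normed, one_mul]

/-- Differentiation under the integral sign falls on the merely Lipschitz factor: by Rademacher's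
theorem the integrand is differentiable for almost every `t`, and its Lipschitz constant is
dominated by `K` times the mollifier. -/
theorem fderiv_normed_convolution (ρ : ContDiffBump (0 : Euc n)) {φ : Euc n → F} {K : NNReal}
    (hφ : LipschitzWith K φ) (x : Euc n) :
    fderiv ℝ (ρ.normed volume ⋆[ContinuousLinearMap.lsmul ℝ ℝ, volume] φ) x =
      (ρ.normed volume ⋆[ContinuousLinearMap.lsmul ℝ ℝ, volume] fderiv ℝ φ) x := by
  have hcont := hφ.continuous
  have hρc : Continuous (ρ.normed volume : Euc n → ℝ) := ρ.continuous_normed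
  have key := hasFDerivAt_integral_of_dominated_loc_of_lip (μ := volume) (𝕜 := ℝ)
    (F := fun x t => ρ.normed volume t • φ (x - t)) (x₀ := x) (s := univ)
    (F' := fun t => ρ.normed volume t • fderiv ℝ φ (x - t))
    (bound := fun t => ρ.normed volume t * K) univ_mem
    (Eventually.of_forall fun y => (Continuous.aestronglyMeasurable (by fun_prop)))
    (Continuous.integrable_of_hasCompactSupport (by fun_prop)
      (ρ.hasCompactSupport_normed.smul_right))
    ((hρc.aestronglyMeasurable).smul
      (((measurable_fderiv ℝ φ).comp (measurable_const.sub measurable_id)).aestronglyMeasurable))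
    (ae_of_all _ fun t => ?_) (ρ.integrable_normed.mul_const _) ?_
  · exact key.2.fderiv
  · refine LipschitzOnWith.of_dist_le_mul fun y _ z _ => ?_
    rw [dist_smul₀, Real.norm_eq_abs, Real.coe_nnabs, abs_mul, mul_assoc, NNReal.abs_eq]
    refine mul_le_mul_of_nonneg_left ?_ (abs_nonneg _)
    simpa using hφ.dist_le_mul (y - t) (z - t)
  · have h := hφ.ae_differentiableAt (μ := (volume : Measure (Euc n)))
    have h' : ∀ᵐ t : Euc n, DifferentiableAt ℝ φ (x - t) :=
      (Measure.measurePreserving_sub_left volume x).quasiMeasurePreserving.ae h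
    filter_upwards [h'] with t ht
    have : HasFDerivAt (fun y => φ (y - t)) (fderiv ℝ φ (x - t)) x := by
      exact ht.hasFDerivAt.comp x ((hasFDerivAt_id x).sub_const t)
    exact this.const_smul (ρ.normed volume t)

theorem tsupport_normed_convolution_subset {X : Type*} [NormedAddCommGroup X] [NormedSpace ℝ X]
    (ρ : ContDiffBump (0 : Euc n)) (φ : Euc n → X) :
    tsupport (ρ.normed volume ⋆[ContinuousLinearMap.lsmul ℝ ℝ, volume] φ) ⊆
      Metric.cthickening ρ.rOut (tsupport φ) := by
  refine (closure_mono ?_).trans (Metric.closure_thickening_subset_cthickening _ _)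
  intro x hx
  obtain ⟨a, ha, b, hb, rfl⟩ := support_convolution_subset _ hx
  rw [ρ.support_normed_eq] at ha
  refine Metric.mem_thickening_iff.2 ⟨b, subset_tsupport _ hb, ?_⟩
  simpa [dist_eq_norm] using ha

/-- A measurable field of functionals on `E →L F`, bounded on `O` by the constant `C`. -/
structure IsBoundedField (O : Set (Euc n)) (C : ℝ) (V : Euc n → (Euc n →L[ℝ] F) →L[ℝ] ℝ) : Prop where
  aestronglyMeasurable : ∀ M : Euc n → (Euc n →L[ℝ] F), Measurable M →
    AEStronglyMeasurable (fun x => V x (M x)) (volume.restrict O)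
  bound : ∀ x ∈ O, ∀ B, |V x B| ≤ C * ‖B‖

/-- Smooth approximation of compactly supported Lipschitz maps. -/
theorem exists_smooth_approximation {O : Set (Euc n)} (hO : IsOpen O)
    {φ : Euc n → F} {K : NNReal} (hφ : LipschitzWith K φ) (hφc : HasCompactSupport φ)
    (hφO : tsupport φ ⊆ O) :
    ∃ (φs : ℕ → Euc n → F) (c : ℝ), (∀ j, ContDiff ℝ ∞ (φs j)) ∧ (∀ j, HasCompactSupport (φs j)) ∧
      (∀ j, tsupport (φs j) ⊆ O) ∧ (∀ j x, ‖φs j x‖ ≤ c) ∧ (∀ j x, ‖fderiv ℝ (φs j) x‖ ≤ K) ∧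
      (∀ x, Tendsto (fun j => φs j x) atTop (𝓝 (φ x))) ∧
      ∀ᵐ x, Tendsto (fun j => fderiv ℝ (φs j) x) atTop (𝓝 (fderiv ℝ φ x)) := by
  obtain ⟨δ, hδ, hδO⟩ := hφc.exists_cthickening_subset_open hO hφO
  obtain ⟨c, hc⟩ := hφc.exists_bound_of_continuous hφ.continuous
  -- The ratio of the two radii stays equal to 2, as the almost everywhere convergence of mollified
  -- derivatives (Lebesgue differentiation) requires bumps of bounded eccentricity. The bound by `δ`
  -- keeps the supports in `O`.
  obtain ⟨ρ, hρ, hρ2, hρδ⟩ : ∃ ρ : ℕ → ContDiffBump (0 : Euc n),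
      Tendsto (fun j => (ρ j).rOut) atTop (𝓝 0) ∧ (∀ j, (ρ j).rOut ≤ 2 * (ρ j).rIn) ∧
      ∀ j, (ρ j).rOut ≤ δ := by
    refine ⟨fun j => ⟨δ / 2 / (j + 1), δ / (j + 1), by positivity, by gcongr; linarith⟩, ?_,
      fun j => ?_, fun j => ?_⟩
    · exact tendsto_const_div_atTop_nhds_zero_nat δ |>.comp (tendsto_add_atTop_nat 1) |>.congr
        fun j => by simp
    · change δ / (j + 1) ≤ 2 * (δ / 2 / (j + 1))
      apply le_of_eq; ring
    · change δ / (j + 1) ≤ δ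
      exact div_le_self hδ.le (by linarith [(j.cast_nonneg : (0 : ℝ) ≤ j)])
  have hfd : ∀ j x, fderiv ℝ ((ρ j).normed volume ⋆[ContinuousLinearMap.lsmul ℝ ℝ, volume] φ) x =
      ((ρ j).normed volume ⋆[ContinuousLinearMap.lsmul ℝ ℝ, volume] fderiv ℝ φ) x :=
    fun j x => fderiv_normed_convolution (ρ j) hφ x
  have hbd : ∀ x, ‖fderiv ℝ φ x‖ ≤ K := fun x => norm_fderiv_le_of_lipschitz ℝ hφ
  have hloc : LocallyIntegrable (fderiv ℝ φ) (volume : Measure (Euc n)) := by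
    have : LocallyIntegrable (fun _ : Euc n => (K : ℝ)) volume :=
      continuous_const.locallyIntegrable
    refine this.mono (measurable_fderiv ℝ φ).aestronglyMeasurable (ae_of_all _ fun x => ?_)
    exact (hbd x).trans (le_abs_self _)
  refine ⟨fun j => ((ρ j).normed volume ⋆[ContinuousLinearMap.lsmul ℝ ℝ, volume] φ), c,
    fun j => ?_, fun j => ?_, fun j => ?_, fun j x => norm_normed_convolution_le _ hc x,
    fun j x => ?_, fun x => ?_, ?_⟩
  · exact HasCompactSupport.contDiff_convolution_left (n := (⊤ : ℕ∞))
      (ContinuousLinearMap.lsmul ℝ ℝ) (ρ j).hasCompactSupport_normed (ρ j).contDiff_normed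
      hφ.continuous.locallyIntegrable
  · exact (ρ j).hasCompactSupport_normed.convolution _ hφc
  · exact ((tsupport_normed_convolution_subset (ρ j) φ).trans
      (Metric.cthickening_mono (hρδ j) _)).trans hδO
  · rw [hfd]; exact norm_normed_convolution_le _ hbd x
  · exact ContDiffBump.convolution_tendsto_right_of_continuous hρ hφ.continuous x
  · have := ContDiffBump.ae_convolution_tendsto_right_of_locallyIntegrable (μ := volume) (K := 2)
      hρ (Eventually.of_forall hρ2) hloc
    filter_upwards [this] with x hx
    simpa only [hfd] using hx

/-- A weak equation for smooth compactly supported maps holds for Lipschitz ones. -/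
theorem weak_equation_of_lipschitz {O : Set (Euc n)} (hO : IsOpen O) (hOfin : volume O < ⊤)
    {μ : Measure (Euc n)} {V : Euc n → (Euc n →L[ℝ] F) →L[ℝ] ℝ} {A : Euc n → F →L[ℝ] ℝ}
    {C : ℝ} (hV : IsBoundedField O C V) (hA : IntegrableOn A O μ)
    (h : ∀ φ : Euc n → F, ContDiff ℝ ∞ φ → HasCompactSupport φ → tsupport φ ⊆ O →
      ∫ x in O, V x (fderiv ℝ φ x) = ∫ x in O, A x (φ x) ∂μ)
    {φ : Euc n → F} {K : NNReal} (hφ : LipschitzWith K φ) (hφc : HasCompactSupport φ)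
    (hφO : tsupport φ ⊆ O) :
    ∫ x in O, V x (fderiv ℝ φ x) = ∫ x in O, A x (φ x) ∂μ := by
  obtain ⟨φs, c, hsm, hcs, hsupp, hc, hfd, hφs, hae⟩ := exists_smooth_approximation hO hφ hφc hφO
  have l1 : Tendsto (fun j => ∫ x in O, V x (fderiv ℝ (φs j) x)) atTop
      (𝓝 (∫ x in O, V x (fderiv ℝ φ x))) := by
    have : Fact (volume O < ⊤) := ⟨hOfin⟩
    refine tendsto_integral_of_dominated_convergence (fun _ => |C| * K) (fun j => ?_)
      (integrable_const _) (fun j => ae_restrict_of_forall_mem hO.measurableSet fun x hx => ?_) ?_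
    · exact hV.aestronglyMeasurable _ (measurable_fderiv ℝ (φs j))
    · exact (hV.bound x hx _).trans (mul_le_mul (le_abs_self C) (hfd j x) (norm_nonneg _)
        (abs_nonneg _))
    · filter_upwards [ae_restrict_of_ae hae] with x hx
      exact ((V x).continuous.tendsto _).comp hx
  -- The measure `μ` may charge Lebesgue-null sets, so the convergence of the values at every point
  -- is used here. Only the derivatives converge almost everywhere.
  have l2 : Tendsto (fun j => ∫ x in O, A x (φs j x) ∂μ) atTop
      (𝓝 (∫ x in O, A x (φ x) ∂μ)) := by
    refine tendsto_integral_of_dominated_convergence (fun x => ‖A x‖ * c) (fun j => ?_)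
      (hA.norm.mul_const _) (fun j => ae_of_all _ fun x => ?_) (ae_of_all _ fun x => ?_)
    · exact (isBoundedBilinearMap_apply (𝕜 := ℝ) (E := F) (F := ℝ)).continuous.comp_aestronglyMeasurable
        (hA.aestronglyMeasurable.prodMk ((hsm j).continuous.aestronglyMeasurable))
    · exact (A x).le_opNorm_of_le (hc j x)
    · exact ((A x).continuous.tendsto _).comp (hφs x)
  exact tendsto_nhds_unique l1 (l2.congr fun j => (h _ (hsm j) (hcs j) (hsupp j)).symm)

end Mollify

end

end Clapeyron

namespace Clapeyron

noncomputable section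

/-! ### The divergence theorem below a Lipschitz graph -/

/-- Averages over `(-2δ, -δ)` converge to the left limit at `0`. -/
theorem tendsto_average_left {f : ℝ → ℝ} (hf : Integrable f) {Z : Set ℝ} (hZ : volume Z = 0) {l : ℝ}
    (h : Tendsto f (𝓝[{s | s < 0 ∧ s ∉ Z}] 0) (𝓝 l)) {δ : ℕ → ℝ} (hδ0 : ∀ j, 0 < δ j)
    (hδ : Tendsto δ atTop (𝓝 0)) :
    Tendsto (fun j => (δ j)⁻¹ * ∫ s in Ioo (-2 * δ j) (-δ j), f s) atTop (𝓝 l) := by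
  rw [Metric.tendsto_atTop]
  intro ε hε
  have h1 := (Metric.tendsto_nhds.1 h) (ε / 2) (half_pos hε)
  rw [eventually_nhdsWithin_iff, Metric.eventually_nhds_iff] at h1
  obtain ⟨r, hr, hr'⟩ := h1
  obtain ⟨J, hJ⟩ := Metric.tendsto_atTop.1 hδ (r / 2) (half_pos hr)
  refine ⟨J, fun j hj => ?_⟩
  have hj' : δ j < r / 2 := by
    have := hJ j hj
    rw [Real.dist_eq, sub_zero, abs_of_pos (hδ0 j)] at this
    exact this
  have hd := hδ0 j
  have hvol : volume (Ioo (-2 * δ j) (-δ j)) = ENNReal.ofReal (δ j) := by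
    rw [Real.volume_Ioo]; congr 1; ring
  have hreal : (volume : Measure ℝ).real (Ioo (-2 * δ j) (-δ j)) = δ j := by
    rw [measureReal_def, hvol, ENNReal.toReal_ofReal hd.le]
  have hbd : ‖∫ s in Ioo (-2 * δ j) (-δ j), (f s - l)‖ ≤ ε / 2 * δ j := by
    have hle := norm_setIntegral_le_of_norm_le_const_ae' (f := fun s => f s - l) (C := ε / 2)
      (μ := volume) (s := Ioo (-2 * δ j) (-δ j)) (by rw [hvol]; exact ENNReal.ofReal_lt_top) ?_
    · rwa [hreal] at hle
    have hZ' : ∀ᵐ s, s ∉ Z := measure_eq_zero_iff_ae_notMem.1 hZ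
    filter_upwards [hZ'] with s hs hmem
    have := hr' (y := s) (by rw [Real.dist_eq, sub_zero, abs_lt]; constructor <;> linarith [hmem.1, hmem.2])
      ⟨by linarith [hmem.2], hs⟩
    rw [Real.dist_eq] at this
    exact this.le
  have hsplit : ∫ s in Ioo (-2 * δ j) (-δ j), (f s - l) =
      (∫ s in Ioo (-2 * δ j) (-δ j), f s) - δ j * l := by
    rw [integral_sub hf.integrableOn (integrableOn_const (by rw [hvol]; exact ENNReal.ofReal_ne_top)),
      setIntegral_const, hreal, smul_eq_mul]
  rw [hsplit] at hbd
  rw [Real.dist_eq]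
  have e : (δ j)⁻¹ * (∫ s in Ioo (-2 * δ j) (-δ j), f s) - l =
      (δ j)⁻¹ * ((∫ s in Ioo (-2 * δ j) (-δ j), f s) - δ j * l) := by
    field_simp
  rw [e, abs_mul, abs_of_pos (inv_pos.2 hd)]
  rw [Real.norm_eq_abs] at hbd
  calc _ ≤ (δ j)⁻¹ * (ε / 2 * δ j) := mul_le_mul_of_nonneg_left hbd (inv_pos.2 hd).le
    _ = ε / 2 := by field_simp
    _ < ε := half_lt_self hε

/-- The piecewise linear function that is `0` on `[-δ, ∞)` and `1` on `(-∞, -2δ]`. -/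
def ramp (δ s : ℝ) : ℝ := max 0 (min 1 (-(s / δ) - 1))

theorem ramp_nonneg (δ s : ℝ) : 0 ≤ ramp δ s := le_max_left _ _

theorem ramp_le_one (δ s : ℝ) : ramp δ s ≤ 1 := max_le zero_le_one (min_le_left _ _)

theorem ramp_eq_zero {δ s : ℝ} (hδ : 0 < δ) (h : -δ ≤ s) : ramp δ s = 0 := by
  have : -1 ≤ s / δ := by rw [le_div_iff₀ hδ]; linarith
  exact max_eq_left ((min_le_right _ _).trans (by linarith))

theorem ramp_eq_one {δ s : ℝ} (hδ : 0 < δ) (h : s ≤ -2 * δ) : ramp δ s = 1 := by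
  have : s / δ ≤ -2 := by rw [div_le_iff₀ hδ]; linarith
  rw [ramp, min_eq_left (by linarith), max_eq_right zero_le_one]

theorem ramp_eq_linear {δ s : ℝ} (hδ : 0 < δ) (h1 : -2 * δ ≤ s) (h2 : s ≤ -δ) :
    ramp δ s = -(s / δ) - 1 := by
  have a : -2 ≤ s / δ := by rw [le_div_iff₀ hδ]; linarith
  have b : s / δ ≤ -1 := by rw [div_le_iff₀ hδ]; linarith
  rw [ramp, min_eq_right (by linarith), max_eq_right (by linarith)]

theorem lipschitzWith_ramp {δ : ℝ} (hδ : 0 < δ) : LipschitzWith ⟨δ⁻¹, (inv_pos.2 hδ).le⟩ (ramp δ) := by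
  have h0 : LipschitzWith ⟨δ⁻¹, (inv_pos.2 hδ).le⟩ fun s : ℝ => -(s / δ) - 1 :=
    LipschitzWith.of_dist_le_mul fun a b => by
      rw [Real.dist_eq, Real.dist_eq]
      have : -(a / δ) - 1 - (-(b / δ) - 1) = -(δ⁻¹ * (a - b)) := by field_simp; ring
      rw [this, abs_neg, abs_mul, abs_of_pos (inv_pos.2 hδ)]; rfl
  exact (h0.const_min 1).const_max 0

/-- The derivative of the ramp, off its two corners. -/
theorem hasDerivAt_ramp {δ s : ℝ} (hδ : 0 < δ) (h1 : s ≠ -2 * δ) (h2 : s ≠ -δ) :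
    HasDerivAt (ramp δ) ((Ioo (-2 * δ) (-δ)).indicator (fun _ => -δ⁻¹) s) s := by
  rcases lt_or_gt_of_ne h1 with h | h
  · rw [indicator_of_notMem (fun hs => absurd hs.1 (by linarith))]
    refine (hasDerivAt_const s (1 : ℝ)).congr_of_eventuallyEq ?_
    filter_upwards [Iio_mem_nhds h] with t ht using ramp_eq_one hδ (le_of_lt ht)
  · rcases lt_or_gt_of_ne h2 with h' | h'
    · rw [indicator_of_mem (show s ∈ Ioo (-2 * δ) (-δ) from ⟨h, h'⟩)]
      have : HasDerivAt (fun t : ℝ => -(t / δ) - 1) (-δ⁻¹) s := by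
        have := (((hasDerivAt_id s).div_const δ).neg).sub_const 1
        simpa [one_div] using this
      refine this.congr_of_eventuallyEq ?_
      filter_upwards [Ioo_mem_nhds h h'] with t ht using ramp_eq_linear hδ ht.1.le ht.2.le
    · rw [indicator_of_notMem (fun hs => absurd hs.2 (by linarith))]
      refine (hasDerivAt_const s (0 : ℝ)).congr_of_eventuallyEq ?_
      filter_upwards [Ioi_mem_nhds h'] with t ht using ramp_eq_zero hδ (le_of_lt ht)

theorem LipschitzWith.mul_bounded {X : Type*} [PseudoMetricSpace X] {a b : X → ℝ} {Ka Kb : NNReal}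
    (ha : LipschitzWith Ka a) (hb : LipschitzWith Kb b) {A B : NNReal} (hA : ∀ x, |a x| ≤ A)
    (hB : ∀ x, |b x| ≤ B) : LipschitzWith (A * Kb + B * Ka) fun x => a x * b x :=
  LipschitzWith.of_dist_le_mul fun x y => by
    have h1 := ha.dist_le_mul x y
    have h2 := hb.dist_le_mul x y
    rw [Real.dist_eq] at h1 h2 ⊢
    have e : a x * b x - a y * b y = a x * (b x - b y) + b y * (a x - a y) := by ring
    rw [e]
    refine (abs_add_le _ _).trans ?_
    rw [abs_mul, abs_mul]
    push_cast
    calc |a x| * |b x - b y| + |b y| * |a x - a y|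
        ≤ A * (Kb * dist x y) + B * (Ka * dist x y) := by
          gcongr
          · exact hA x
          · exact hB y
      _ = _ := by ring

namespace Frame

variable {k : ℕ} (Φ : Frame k) (G : Euc k → ℝ)

/-- The height above the graph of `G`. -/
def above (z : Euc (k + 1)) : ℝ := Φ.height z - G (Φ.base z)

/-- The differential of the height above the graph, over the base point `x`. -/
def conormal (x : Euc k) : StrongDual ℝ (Euc (k + 1)) := Φ.height - (fderiv ℝ G x).comp Φ.base

/-- Coordinates in which the graph of `G` is flat. -/
def flat (p : Euc k × ℝ) : Euc (k + 1) := Φ.pt p.1 (G p.1 + p.2)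

@[simp] theorem above_flat (p : Euc k × ℝ) : Φ.above G (Φ.flat G p) = p.2 := by
  simp [above, flat]

@[simp] theorem base_flat (p : Euc k × ℝ) : Φ.base (Φ.flat G p) = p.1 := by
  simp [flat]

theorem flat_zero (x : Euc k) : Φ.flat G (x, 0) = Φ.graph G x := by
  simp [flat, graph]

theorem flat_eq (x : Euc k) (s : ℝ) : Φ.flat G (x, s) = Φ.graph G x + s • Φ.axis := by
  rw [graph, pt_add_smul_axis, flat]

@[simp] theorem above_graph (x : Euc k) : Φ.above G (Φ.graph G x) = 0 := by
  rw [← flat_zero, above_flat]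

@[simp] theorem base_graph (x : Euc k) : Φ.base (Φ.graph G x) = x := by
  rw [← flat_zero, base_flat]

@[simp] theorem flat_base_above (z : Euc (k + 1)) : Φ.flat G (Φ.base z, Φ.above G z) = z := by
  simp [flat, above]

theorem graph_base {z : Euc (k + 1)} (hz : Φ.above G z = 0) : Φ.graph G (Φ.base z) = z := by
  rw [← flat_zero, ← hz, flat_base_above]

variable {G}

theorem continuous_flat (hG : Continuous G) : Continuous (Φ.flat G) :=
  Φ.continuous_pt.comp (by fun_prop : Continuous fun p : Euc k × ℝ => (p.1, G p.1 + p.2))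

theorem continuous_above (hG : Continuous G) : Continuous (Φ.above G) := by
  unfold above; fun_prop

/-- Flattening translates each vertical line, so it preserves volume although `G` is only
continuous. -/
theorem measurePreserving_flat (hG : Continuous G) : MeasurePreserving (Φ.flat G) volume volume := by
  have h : MeasurePreserving (fun p : Euc k × ℝ => (id p.1, G p.1 + p.2)) (volume.prod volume)
      (volume.prod volume) :=
    MeasurePreserving.skew_product (g := fun x s => G x + s)
      (MeasurePreserving.id (volume : Measure (Euc k))) (by fun_prop)
      (ae_of_all _ fun x => (measurePreserving_add_left (volume : Measure ℝ) (G x)).map_eq)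
  exact Φ.measurePreserving_pt.comp h

theorem measurableEmbedding_flat (hG : Continuous G) : MeasurableEmbedding (Φ.flat G) :=
  (Φ.continuous_flat hG).measurableEmbedding fun p q h => by
    have h1 := congrArg Φ.base h
    have h2 := congrArg (Φ.above G) h
    simp only [base_flat, above_flat] at h1 h2
    exact Prod.ext h1 h2

theorem lipschitzWith_above {K : NNReal} (hG : LipschitzWith K G) :
    ∃ K', LipschitzWith K' (Φ.above G) :=
  ⟨_, Φ.height.lipschitz.sub (hG.comp Φ.base.lipschitz)⟩

theorem hasFDerivAt_above {z : Euc (k + 1)} (h : DifferentiableAt ℝ G (Φ.base z)) :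
    HasFDerivAt (Φ.above G) (Φ.conormal G (Φ.base z)) z :=
  Φ.height.hasFDerivAt.sub (h.hasFDerivAt.comp z Φ.base.hasFDerivAt)

theorem measurable_conormal (G : Euc k → ℝ) : Measurable (Φ.conormal G) := by
  have : Continuous fun L : StrongDual ℝ (Euc k) => Φ.height - L.comp Φ.base := by fun_prop
  exact this.measurable.comp (measurable_fderiv ℝ G)

theorem norm_conormal_le {K : NNReal} (hG : LipschitzWith K G) (x : Euc k) :
    ‖Φ.conormal G x‖ ≤ ‖Φ.height‖ + K * ‖Φ.base‖ := by
  refine (norm_sub_le _ _).trans ?_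
  gcongr
  refine (ContinuousLinearMap.opNorm_comp_le _ _).trans ?_
  gcongr
  exact norm_fderiv_le_of_lipschitz ℝ hG

end Frame

end

end Clapeyron

namespace Clapeyron

noncomputable section

/-! ### Gauss-Green below a Lipschitz graph by shrinking cut-offs. -/

namespace Frame

variable {k : ℕ} (Φ : Frame k) {G : Euc k → ℝ}

theorem ae_flat_iff (hG : Continuous G) {P : Euc (k + 1) → Prop} :
    (∀ᵐ z, P z) ↔ ∀ᵐ p : Euc k × ℝ, P (Φ.flat G p) := by
  rw [← (Φ.measurePreserving_flat hG).map_eq, (Φ.measurableEmbedding_flat hG).ae_map_iff]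

theorem ae_base {P : Euc k → Prop} (h : ∀ᵐ x, P x) : ∀ᵐ z, P (Φ.base z) := by
  rw [Φ.ae_flat_iff (G := fun _ => 0) continuous_const]
  simp only [base_flat]
  exact Measure.quasiMeasurePreserving_fst.ae h

theorem ae_above_ne (hG : Continuous G) (a : ℝ) : ∀ᵐ z, Φ.above G z ≠ a := by
  rw [Φ.ae_flat_iff hG]
  simp only [above_flat]
  exact Measure.quasiMeasurePreserving_snd.ae (Measure.ae_ne volume a)

/-- The region strictly below the graph of `G`, inside `B`. -/
def below (G : Euc k → ℝ) (B : Set (Euc (k + 1))) : Set (Euc (k + 1)) := {z | Φ.above G z < 0} ∩ B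

theorem isOpen_below (hG : Continuous G) {B : Set (Euc (k + 1))} (hB : IsOpen B) :
    IsOpen (Φ.below G B) :=
  (isOpen_lt (Φ.continuous_above hG) continuous_const).inter hB

theorem flat_mem_below {B : Set (Euc (k + 1))} (hG : Continuous G) (hB : IsOpen B) {x : Euc k}
    (hx : Φ.graph G x ∈ B) : ∀ᶠ s in 𝓝[<] (0 : ℝ), Φ.flat G (x, s) ∈ Φ.below G B := by
  have h1 : Tendsto (fun s : ℝ => Φ.flat G (x, s)) (𝓝 0) (𝓝 (Φ.graph G x)) := by
    rw [← flat_zero]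
    exact ((Φ.continuous_flat hG).comp (by fun_prop : Continuous fun s : ℝ => (x, s))).tendsto 0
  filter_upwards [(h1.mono_left nhdsWithin_le_nhds).eventually (hB.mem_nhds hx),
    self_mem_nhdsWithin] with s hs hs0
  exact ⟨by simpa using hs0, hs⟩

section GaussGreen

variable {K : NNReal} {B : Set (Euc (k + 1))} {V : Euc (k + 1) → StrongDual ℝ (Euc (k + 1)) →L[ℝ] ℝ}
  {C : ℝ} {η : Euc (k + 1) → ℝ}

/-- The product with the ramp makes `η` an admissible test function below the graph. It is no
smoother than `G`, which is why Lipschitz test maps are needed. -/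
theorem lipschitzWith_cutoff (hG : LipschitzWith K G) (hη : ContDiff ℝ ∞ η)
    (hηc : HasCompactSupport η) {δ : ℝ} (hδ : 0 < δ) :
    ∃ K', LipschitzWith K' fun z => ramp δ (Φ.above G z) * η z := by
  obtain ⟨Ka, hKa⟩ := Φ.lipschitzWith_above hG
  obtain ⟨Kη, hKη⟩ := (hη.of_le (by simp : (1 : WithTop ℕ∞) ≤ ∞)).lipschitzWith_of_hasCompactSupport
    hηc one_ne_zero
  obtain ⟨c, hc⟩ := hηc.exists_bound_of_continuous hη.continuous
  refine ⟨_, LipschitzWith.mul_bounded ((lipschitzWith_ramp hδ).comp hKa) hKη (A := 1)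
    (B := c.toNNReal) (fun z => ?_) (fun z => ?_)⟩
  · rw [Function.comp_apply, abs_of_nonneg (ramp_nonneg _ _)]; exact ramp_le_one _ _
  · exact (hc z).trans (Real.le_coe_toNNReal c)

theorem tsupport_cutoff_subset (hG : Continuous G) (hηB : tsupport η ⊆ B) {δ : ℝ} (hδ : 0 < δ) :
    tsupport (fun z => ramp δ (Φ.above G z) * η z) ⊆ Φ.below G B := by
  intro z hz
  refine ⟨?_, hηB (tsupport_mul_subset_right hz)⟩
  have hcl : IsClosed {z | Φ.above G z ≤ -δ} := isClosed_le (Φ.continuous_above hG) continuous_const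
  have : tsupport (fun z => ramp δ (Φ.above G z) * η z) ⊆ {z | Φ.above G z ≤ -δ} := by
    refine closure_minimal (fun w hw => ?_) hcl
    by_contra hlt
    exact hw (by simp only [ramp_eq_zero hδ (not_le.1 hlt).le, zero_mul])
  have h1 : Φ.above G z ≤ -δ := this hz
  exact lt_of_le_of_lt h1 (by linarith)

/-- The first term tends to the bulk contribution of `η`. The second lives in a layer of thickness
`δ` and has size 1/`δ`, so it concentrates to the boundary term. The corners of the ramp lie on two
level sets, which are null. -/
theorem ae_fderiv_cutoff (hG : LipschitzWith K G) (hη : ContDiff ℝ ∞ η) {δ : ℝ} (hδ : 0 < δ) :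
    ∀ᵐ z, fderiv ℝ (fun z => ramp δ (Φ.above G z) * η z) z =
      ramp δ (Φ.above G z) • fderiv ℝ η z +
        (η z * (Ioo (-2 * δ) (-δ)).indicator (fun _ => -δ⁻¹) (Φ.above G z)) •
          Φ.conormal G (Φ.base z) := by
  filter_upwards [Φ.ae_base (hG.ae_differentiableAt (μ := (volume : Measure (Euc k)))),
    Φ.ae_above_ne hG.continuous (-2 * δ), Φ.ae_above_ne hG.continuous (-δ)] with z h1 h2 h3
  have hr := (hasDerivAt_ramp hδ h2 h3).comp_hasFDerivAt z (Φ.hasFDerivAt_above h1)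
  have hd := (hη.differentiable (by simp) z).hasFDerivAt
  have := (hr.mul hd).fderiv
  rw [smul_smul] at this
  exact this

theorem measurable_conormal_base (G : Euc k → ℝ) : Measurable fun z => Φ.conormal G (Φ.base z) :=
  (Φ.measurable_conormal G).comp Φ.base.continuous.measurable

/-- The density whose concentration at the graph produces the boundary term. -/
def layerDensity (G : Euc k → ℝ) (B : Set (Euc (k + 1)))
    (V : Euc (k + 1) → StrongDual ℝ (Euc (k + 1)) →L[ℝ] ℝ) (η : Euc (k + 1) → ℝ) :
    Euc (k + 1) → ℝ :=
  (Φ.below G B).indicator fun z => η z * V z (Φ.conormal G (Φ.base z))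

theorem exists_layerDensity_bound (hG : LipschitzWith K G) (hη : ContDiff ℝ ∞ η)
    (hηc : HasCompactSupport η) (hV : IsBoundedField (Φ.below G B) C V) :
    ∃ M, 0 ≤ M ∧ ∀ z, |Φ.layerDensity G B V η z| ≤ M := by
  obtain ⟨c, hc⟩ := hηc.exists_bound_of_continuous hη.continuous
  refine ⟨|c| * (|C| * (‖Φ.height‖ + K * ‖Φ.base‖)), by positivity, fun z => ?_⟩
  rw [layerDensity]
  by_cases hz : z ∈ Φ.below G B
  · rw [indicator_of_mem hz, abs_mul]
    refine mul_le_mul ((hc z).trans (le_abs_self c)) ((hV.bound z hz _).trans ?_) (abs_nonneg _)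
      (abs_nonneg _)
    exact mul_le_mul (le_abs_self C) (Φ.norm_conormal_le hG _) (norm_nonneg _) (abs_nonneg _)
  · rw [indicator_of_notMem hz, abs_zero]; positivity

theorem integrable_layerDensity (hG : LipschitzWith K G) (hB : IsOpen B)
    (hfin : volume (Φ.below G B) < ⊤) (hη : ContDiff ℝ ∞ η)
    (hηc : HasCompactSupport η) (hV : IsBoundedField (Φ.below G B) C V) :
    Integrable (Φ.layerDensity G B V η) := by
  obtain ⟨M, hM, hMb⟩ := Φ.exists_layerDensity_bound hG hη hηc hV
  have hD := (Φ.isOpen_below hG.continuous hB).measurableSet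
  refine (integrable_indicator_iff hD).2 ⟨?_, ?_⟩
  · exact hη.continuous.aestronglyMeasurable.mul
      (hV.aestronglyMeasurable _ (Φ.measurable_conormal_base G))
  · have : Fact (volume (Φ.below G B) < ⊤) := ⟨hfin⟩
    refine HasFiniteIntegral.of_bounded (C := M) (ae_restrict_of_forall_mem hD fun z hz => ?_)
    have := hMb z
    rwa [layerDensity, indicator_of_mem hz] at this

theorem tendsto_layerDensity (hG : Continuous G) (hB : IsOpen B) (hη : Continuous η)
    (hηB : tsupport η ⊆ B) {N : Set (Euc (k + 1))}
    {Vb : StrongDual ℝ (Euc (k + 1)) → ℝ} {x : Euc k}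
    (hlim : Φ.graph G x ∈ B → ∀ ℓ, Tendsto (fun s => V (Φ.flat G (x, s)) ℓ)
      (𝓝[{s | s < 0 ∧ Φ.flat G (x, s) ∉ N}] 0) (𝓝 (Vb ℓ))) :
    Tendsto (fun s => Φ.layerDensity G B V η (Φ.flat G (x, s)))
      (𝓝[{s | s < 0 ∧ Φ.flat G (x, s) ∉ N}] 0) (𝓝 (η (Φ.graph G x) * Vb (Φ.conormal G x))) := by
  have hle : 𝓝[{s | s < 0 ∧ Φ.flat G (x, s) ∉ N}] (0 : ℝ) ≤ 𝓝[<] 0 :=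
    nhdsWithin_mono _ fun s hs => hs.1
  have hfl : Tendsto (fun s : ℝ => Φ.flat G (x, s)) (𝓝 0) (𝓝 (Φ.graph G x)) := by
    rw [← flat_zero]
    exact ((Φ.continuous_flat hG).comp (by fun_prop : Continuous fun s : ℝ => (x, s))).tendsto 0
  have hfl' := hfl.mono_left (hle.trans nhdsWithin_le_nhds)
  -- Outside the support of `η` the graph point may lie outside `B`, where no limit of `V` is
  -- assumed. There the density vanishes near the point.
  by_cases hx : Φ.graph G x ∈ tsupport η
  · have hxB := hηB hx
    have h1 := (((hη.tendsto _).comp hfl').mul (hlim hxB (Φ.conormal G x)))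
    refine h1.congr' ?_
    filter_upwards [hle (Φ.flat_mem_below hG hB hxB)] with s hs
    rw [layerDensity, indicator_of_mem hs, base_flat]; rfl
  · have h0 : η (Φ.graph G x) = 0 := image_eq_zero_of_notMem_tsupport hx
    rw [h0, zero_mul]
    refine tendsto_const_nhds.congr' ?_
    have : ∀ᶠ z in 𝓝 (Φ.graph G x), z ∉ tsupport η := (isClosed_tsupport η).isOpen_compl.mem_nhds hx
    filter_upwards [hfl'.eventually this] with s hs
    rw [layerDensity]
    by_cases hm : Φ.flat G (x, s) ∈ Φ.below G B
    · rw [indicator_of_mem hm, image_eq_zero_of_notMem_tsupport hs, zero_mul]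
    · rw [indicator_of_notMem hm]

/-- The layer integrals converge to the boundary integral. -/
theorem tendsto_layer_integral (hG : LipschitzWith K G) (hB : IsOpen B)
    (hfin : volume (Φ.below G B) < ⊤) (hη : ContDiff ℝ ∞ η)
    (hηc : HasCompactSupport η) (hηB : tsupport η ⊆ B) (hV : IsBoundedField (Φ.below G B) C V)
    {N : Set (Euc (k + 1))} (hN : volume N = 0) {Vb : Euc k → StrongDual ℝ (Euc (k + 1)) → ℝ}
    (hlim : ∀ᵐ x, Φ.graph G x ∈ B → ∀ ℓ, Tendsto (fun s => V (Φ.flat G (x, s)) ℓ)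
      (𝓝[{s | s < 0 ∧ Φ.flat G (x, s) ∉ N}] 0) (𝓝 (Vb x ℓ)))
    {δ : ℕ → ℝ} (hδ0 : ∀ j, 0 < δ j) (hδ : Tendsto δ atTop (𝓝 0)) :
    Integrable (fun x => η (Φ.graph G x) * Vb x (Φ.conormal G x)) ∧
    Tendsto (fun j => ∫ z in Φ.below G B,
        (η z * (Ioo (-2 * δ j) (-δ j)).indicator (fun _ => -(δ j)⁻¹) (Φ.above G z)) *
          V z (Φ.conormal G (Φ.base z))) atTop
      (𝓝 (-∫ x, η (Φ.graph G x) * Vb x (Φ.conormal G x))) := by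
  set W := Φ.layerDensity G B V η with hW
  set c : ℕ → ℝ → ℝ := fun j => (Ioo (-2 * δ j) (-δ j)).indicator (fun _ => -(δ j)⁻¹) with hc
  have hcm : ∀ j, Measurable (c j) := fun j => measurable_const.indicator measurableSet_Ioo
  have hcb : ∀ j s, ‖c j s‖ ≤ (δ j)⁻¹ := fun j s => by
    refine (norm_indicator_le_norm_self _ _).trans ?_
    rw [norm_neg, Real.norm_eq_abs, abs_of_pos (inv_pos.2 (hδ0 j))]
  have hWi : Integrable W := Φ.integrable_layerDensity hG hB hfin hη hηc hV
  have hmp := Φ.measurePreserving_flat hG.continuous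
  have hemb := Φ.measurableEmbedding_flat hG.continuous
  have hWf : Integrable (fun p : Euc k × ℝ => W (Φ.flat G p)) (volume.prod volume) :=
    (hmp.integrable_comp_emb hemb).2 hWi
  have hcW : ∀ j, Integrable (fun p : Euc k × ℝ => c j p.2 * W (Φ.flat G p))
      (volume.prod volume) := fun j =>
    hWf.bdd_mul ((hcm j).comp measurable_snd).aestronglyMeasurable (ae_of_all _ fun p => hcb j p.2)
  have hD := (Φ.isOpen_below hG.continuous hB).measurableSet
  have hI : ∀ j, ∫ z in Φ.below G B, (η z * c j (Φ.above G z)) * V z (Φ.conormal G (Φ.base z)) =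
      ∫ x, ∫ s, c j s * W (Φ.flat G (x, s)) := by
    intro j
    rw [← integral_prod _ (hcW j), ← integral_indicator hD]
    have e := hmp.integral_comp hemb fun z => c j (Φ.above G z) * W z
    simp only [above_flat] at e
    rw [show (volume.prod volume : Measure (Euc k × ℝ)) = volume from rfl, e]
    refine integral_congr_ae (ae_of_all _ fun z => ?_)
    by_cases hz : z ∈ Φ.below G B
    · simp only [hW, layerDensity, indicator_of_mem hz]; ring
    · simp only [hW, layerDensity, indicator_of_notMem hz, mul_zero]
  have hin : ∀ j x, ∫ s, c j s * W (Φ.flat G (x, s)) =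
      -((δ j)⁻¹ * ∫ s in Ioo (-2 * δ j) (-δ j), W (Φ.flat G (x, s))) := by
    intro j x
    rw [← integral_const_mul, ← integral_neg, ← integral_indicator measurableSet_Ioo]
    refine integral_congr_ae (ae_of_all _ fun s => ?_)
    by_cases hs : s ∈ Ioo (-2 * δ j) (-δ j)
    · simp only [hc, indicator_of_mem hs]; ring
    · simp only [hc, indicator_of_notMem hs, zero_mul]
  obtain ⟨M, hM, hMb⟩ := Φ.exists_layerDensity_bound hG hη hηc hV
  rw [← integral_neg]
  -- The inner integral is over a layer of length `δ j` with weight 1/`δ j`, so it is bounded by `M`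
  -- uniformly in `j`, and it vanishes off the projection of the support. This gives the dominating
  -- function.
  set Q : Set (Euc k) := Φ.base '' tsupport η with hQ
  have hQc : IsCompact Q := hηc.image Φ.base.continuous
  have hbound : ∀ j x, ‖∫ s, c j s * W (Φ.flat G (x, s))‖ ≤ Q.indicator (fun _ => M) x := by
    intro j x
    by_cases hx : x ∈ Q
    · rw [indicator_of_mem hx, hin, norm_neg, norm_mul, Real.norm_eq_abs,
        abs_of_pos (inv_pos.2 (hδ0 j))]
      have hvol : volume (Ioo (-2 * δ j) (-δ j)) = ENNReal.ofReal (δ j) := by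
        rw [Real.volume_Ioo]; congr 1; ring
      have hle := norm_setIntegral_le_of_norm_le_const (f := fun s => W (Φ.flat G (x, s))) (C := M)
        (μ := volume) (s := Ioo (-2 * δ j) (-δ j)) (by rw [hvol]; exact ENNReal.ofReal_lt_top)
        (fun s _ => hMb _)
      rw [measureReal_def, hvol, ENNReal.toReal_ofReal (hδ0 j).le] at hle
      calc _ ≤ (δ j)⁻¹ * (M * δ j) := mul_le_mul_of_nonneg_left hle (inv_pos.2 (hδ0 j)).le
        _ = M := by have := (hδ0 j).ne'; field_simp
    · rw [indicator_of_notMem hx]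
      have : ∀ s, W (Φ.flat G (x, s)) = 0 := fun s => by
        have hn : Φ.flat G (x, s) ∉ tsupport η := fun h => hx ⟨_, h, by simp⟩
        rw [hW, layerDensity]
        by_cases hm : Φ.flat G (x, s) ∈ Φ.below G B
        · rw [indicator_of_mem hm, image_eq_zero_of_notMem_tsupport hn, zero_mul]
        · rw [indicator_of_notMem hm]
      simp [this]
  have hQi : Integrable (Q.indicator fun _ => M) :=
    (integrable_indicator_iff hQc.measurableSet).2 (integrableOn_const hQc.measure_lt_top.ne)
  have hlim' : ∀ᵐ x, Tendsto (fun j => ∫ s, c j s * W (Φ.flat G (x, s))) atTop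
      (𝓝 (-(η (Φ.graph G x) * Vb x (Φ.conormal G x)))) := by
    -- By Fubini in flat coordinates, almost every vertical line meets `N` in a null set, which the
    -- averages do not see.
    have hN' : ∀ᵐ x : Euc k, ∀ᵐ s : ℝ, Φ.flat G (x, s) ∉ N :=
      Measure.ae_ae_of_ae_prod ((Φ.ae_flat_iff hG.continuous).1
        (measure_eq_zero_iff_ae_notMem.1 hN))
    filter_upwards [hlim, hN', hWf.prod_right_ae] with x h1 h2 h3
    simp only [hin]
    refine Tendsto.neg ?_
    have h4 := Φ.tendsto_layerDensity hG.continuous hB hη.continuous hηB h1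
    exact tendsto_average_left h3 (Z := {s | Φ.flat G (x, s) ∈ N})
      (measure_eq_zero_iff_ae_notMem.2 h2) h4 hδ0 hδ
  have hmeas := fun j => (hcW j).integral_prod_left.aestronglyMeasurable
  refine ⟨?_, ?_⟩
  · have h1 : Integrable fun x => -(η (Φ.graph G x) * Vb x (Φ.conormal G x)) := by
      refine hQi.mono' (aestronglyMeasurable_of_tendsto_ae atTop hmeas hlim') ?_
      filter_upwards [hlim'] with x hx
      exact le_of_tendsto hx.norm (Eventually.of_forall fun j => hbound j x)
    simpa using h1.neg
  · refine Tendsto.congr (fun j => (hI j).symm) ?_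
    exact tendsto_integral_of_dominated_convergence (Q.indicator fun _ => M) hmeas hQi
      (fun j => ae_of_all _ (hbound j)) hlim'

/-- **Gauss-Green formula** below a Lipschitz graph, for a field with boundary values along the
axis and with a weak divergence which may charge null sets. -/
theorem gauss_green_below (hG : LipschitzWith K G) (hB : IsOpen B)
    (hfin : volume (Φ.below G B) < ⊤) (hV : IsBoundedField (Φ.below G B) C V)
    {μ : Measure (Euc (k + 1))} {f : Euc (k + 1) → ℝ} (hf : IntegrableOn f (Φ.below G B) μ)
    (hweak : ∀ φ : Euc (k + 1) → ℝ, ContDiff ℝ ∞ φ → HasCompactSupport φ →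
      tsupport φ ⊆ Φ.below G B →
      ∫ z in Φ.below G B, V z (fderiv ℝ φ z) = ∫ z in Φ.below G B, f z * φ z ∂μ)
    {N : Set (Euc (k + 1))} (hN : volume N = 0) {Vb : Euc k → StrongDual ℝ (Euc (k + 1)) → ℝ}
    (hlim : ∀ᵐ x, Φ.graph G x ∈ B → ∀ ℓ, Tendsto (fun s => V (Φ.flat G (x, s)) ℓ)
      (𝓝[{s | s < 0 ∧ Φ.flat G (x, s) ∉ N}] 0) (𝓝 (Vb x ℓ)))
    (hη : ContDiff ℝ ∞ η) (hηc : HasCompactSupport η) (hηB : tsupport η ⊆ B) :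
    Integrable (fun x => η (Φ.graph G x) * Vb x (Φ.conormal G x)) ∧
    ∫ z in Φ.below G B, V z (fderiv ℝ η z) =
      (∫ z in Φ.below G B, f z * η z ∂μ) + ∫ x, η (Φ.graph G x) * Vb x (Φ.conormal G x) := by
  have hDo := Φ.isOpen_below hG.continuous hB
  have hD := hDo.measurableSet
  have : Fact (volume (Φ.below G B) < ⊤) := ⟨hfin⟩
  set δ : ℕ → ℝ := fun j => 1 / ((j : ℝ) + 1) with hδ
  have hδ0 : ∀ j, 0 < δ j := fun j => by positivity
  have hδt : Tendsto δ atTop (𝓝 0) := tendsto_one_div_add_atTop_nhds_zero_nat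
  have hηL : ∀ z, ‖fderiv ℝ η z‖ ≤ _ := fun z =>
    norm_fderiv_le_of_lipschitz ℝ ((hη.of_le (by simp : (1 : WithTop ℕ∞) ≤ ∞)).lipschitzWith_of_hasCompactSupport
      hηc one_ne_zero).choose_spec
  set Kη := ((hη.of_le (by simp : (1 : WithTop ℕ∞) ≤ ∞)).lipschitzWith_of_hasCompactSupport
      hηc one_ne_zero).choose
  have hr1 : ∀ z ∈ Φ.below G B, Tendsto (fun j => ramp (δ j) (Φ.above G z)) atTop (𝓝 1) := by
    intro z hz
    have hz' : Φ.above G z < 0 := hz.1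
    refine tendsto_const_nhds.congr' ?_
    have := (hδt.const_mul (-2)).eventually (lt_mem_nhds (by simpa using hz'))
    filter_upwards [this] with j hj
    exact (ramp_eq_one (hδ0 j) hj.le).symm
  have hVη := hV.aestronglyMeasurable _ (measurable_fderiv ℝ η)
  have hVηb : ∀ z ∈ Φ.below G B, ‖V z (fderiv ℝ η z)‖ ≤ |C| * Kη := fun z hz =>
    (hV.bound z hz _).trans (mul_le_mul (le_abs_self C) (hηL z) (norm_nonneg _) (abs_nonneg _))
  have hrm : ∀ j, Continuous fun z => ramp (δ j) (Φ.above G z) := fun j =>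
    (lipschitzWith_ramp (hδ0 j)).continuous.comp (Φ.continuous_above hG.continuous)
  have hrb : ∀ j z, ‖ramp (δ j) (Φ.above G z)‖ ≤ 1 := fun j z => by
    rw [Real.norm_eq_abs, abs_of_nonneg (ramp_nonneg _ _)]; exact ramp_le_one _ _
  have hVint : IntegrableOn (fun z => V z (fderiv ℝ η z)) (Φ.below G B) :=
    ⟨hVη, HasFiniteIntegral.of_bounded (ae_restrict_of_forall_mem hD hVηb)⟩
  have hWint : IntegrableOn (fun z => η z * V z (Φ.conormal G (Φ.base z))) (Φ.below G B) :=
    (integrable_indicator_iff hD).1 (Φ.integrable_layerDensity hG hB hfin hη hηc hV)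
  -- the weak equation, tested with the cut-off
  have key : ∀ j, (∫ z in Φ.below G B, ramp (δ j) (Φ.above G z) * V z (fderiv ℝ η z)) +
      (∫ z in Φ.below G B,
        (η z * (Ioo (-2 * δ j) (-δ j)).indicator (fun _ => -(δ j)⁻¹) (Φ.above G z)) *
          V z (Φ.conormal G (Φ.base z))) =
      ∫ z in Φ.below G B, f z * (ramp (δ j) (Φ.above G z) * η z) ∂μ := by
    intro j
    obtain ⟨K', hK'⟩ := Φ.lipschitzWith_cutoff hG hη hηc (hδ0 j)
    have h1 := weak_equation_of_lipschitz (F := ℝ) (A := fun z => f z • ContinuousLinearMap.id ℝ ℝ)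
      hDo hfin hV (hf.smul_const _) hweak hK' (hηc.mul_left)
      (Φ.tsupport_cutoff_subset hG.continuous hηB (hδ0 j))
    refine Eq.trans ?_ h1
    rw [← integral_add (hVint.bdd_mul (hrm j).aestronglyMeasurable (ae_of_all _ (hrb j)))]
    · refine integral_congr_ae (ae_restrict_of_ae ?_)
      filter_upwards [Φ.ae_fderiv_cutoff hG hη (hδ0 j)] with z hz
      rw [hz, map_add, map_smul, map_smul, smul_eq_mul, smul_eq_mul]
    · have hcm : Measurable fun z =>
          (Ioo (-2 * δ j) (-δ j)).indicator (fun _ => -(δ j)⁻¹) (Φ.above G z) :=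
        (measurable_const.indicator measurableSet_Ioo).comp
          (Φ.continuous_above hG.continuous).measurable
      refine (hWint.bdd_mul (c := (δ j)⁻¹) hcm.aestronglyMeasurable (ae_of_all _ fun z => ?_)).congr
        (ae_of_all _ fun z => by ring)
      refine (norm_indicator_le_norm_self _ _).trans ?_
      rw [norm_neg, Real.norm_eq_abs, abs_of_pos (inv_pos.2 (hδ0 j))]
  have l1 : Tendsto (fun j => ∫ z in Φ.below G B, ramp (δ j) (Φ.above G z) * V z (fderiv ℝ η z))
      atTop (𝓝 (∫ z in Φ.below G B, V z (fderiv ℝ η z))) := by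
    refine tendsto_integral_of_dominated_convergence (fun z => ‖V z (fderiv ℝ η z)‖)
      (fun j => (hrm j).aestronglyMeasurable.mul hVη) hVint.norm
      (fun j => ae_of_all _ fun z => ?_) (ae_restrict_of_forall_mem hD fun z hz => ?_)
    · rw [norm_mul]; exact mul_le_of_le_one_left (norm_nonneg _) (hrb j z)
    · simpa using (hr1 z hz).mul_const (V z (fderiv ℝ η z))
  obtain ⟨hint, l2⟩ := Φ.tendsto_layer_integral hG hB hfin hη hηc hηB hV hN hlim hδ0 hδt
  obtain ⟨c, hc⟩ := hηc.exists_bound_of_continuous hη.continuous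
  have l3 : Tendsto (fun j => ∫ z in Φ.below G B, f z * (ramp (δ j) (Φ.above G z) * η z) ∂μ)
      atTop (𝓝 (∫ z in Φ.below G B, f z * η z ∂μ)) := by
    refine tendsto_integral_of_dominated_convergence (fun z => ‖f z‖ * c)
      (fun j => hf.aestronglyMeasurable.mul
        ((hrm j).mul hη.continuous).aestronglyMeasurable) (hf.norm.mul_const c)
      (fun j => ae_of_all _ fun z => ?_) (ae_restrict_of_forall_mem hD fun z hz => ?_)
    · rw [norm_mul, norm_mul]
      refine mul_le_mul_of_nonneg_left ?_ (norm_nonneg _)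
      exact (mul_le_of_le_one_left (norm_nonneg _) (hrb j z)).trans (hc z)
    · simpa using ((hr1 z hz).mul_const (η z)).const_mul (f z)
  have := tendsto_nhds_unique ((l1.add l2).congr key) l3
  exact ⟨hint, by linarith⟩

end GaussGreen

end Frame

end

end Clapeyron

namespace Clapeyron

noncomputable section

/-! ### Localization -/

open scoped Manifold in
/-- An additive functional on test functions which vanishes locally near the points of a compact
set vanishes on the test functions supported in it. -/
theorem eq_zero_of_locally_eq_zero {n : ℕ} {Q : Set (Euc n)} {L : (Euc n → ℝ) → ℝ}
    (hadd : ∀ φ₁ φ₂ : Euc n → ℝ, ContDiff ℝ ∞ φ₁ → HasCompactSupport φ₁ → ContDiff ℝ ∞ φ₂ →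
      HasCompactSupport φ₂ → tsupport φ₁ ⊆ Q → tsupport φ₂ ⊆ Q →
      L (fun x => φ₁ x + φ₂ x) = L φ₁ + L φ₂)
    (hloc : ∀ x ∈ Q, ∃ U : Set (Euc n), IsOpen U ∧ x ∈ U ∧ ∀ φ : Euc n → ℝ, ContDiff ℝ ∞ φ →
      HasCompactSupport φ → tsupport φ ⊆ U → tsupport φ ⊆ Q → L φ = 0)
    {φ : Euc n → ℝ} (hφ : ContDiff ℝ ∞ φ) (hφc : HasCompactSupport φ) (hφQ : tsupport φ ⊆ Q) :
    L φ = 0 := by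
  classical
  choose! U hUo hxU hU using hloc
  obtain ⟨t, htQ, ht⟩ := hφc.isCompact.elim_nhds_subcover U fun x hx =>
    (hUo x (hφQ hx)).mem_nhds (hxU x (hφQ hx))
  -- A partition of unity subordinate to a finite subcover writes `φ` as a finite sum of test
  -- functions on each of which `L` vanishes.
  obtain ⟨ρ, hρ⟩ := SmoothPartitionOfUnity.exists_isSubordinate 𝓘(ℝ, Euc n)
    (isClosed_tsupport φ) (fun i : t => U i) (fun i => hUo _ (hφQ (htQ i i.2)))
    (by
      intro x hx
      obtain ⟨i, hi, hxi⟩ := mem_iUnion₂.1 (ht hx)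
      exact mem_iUnion.2 ⟨⟨i, hi⟩, hxi⟩)
  have hsm : ∀ i : t, ContDiff ℝ ∞ fun x => ρ i x * φ x := fun i =>
    ((ρ i).contMDiff.contDiff).mul hφ
  have hcs : ∀ i : t, HasCompactSupport fun x => ρ i x * φ x := fun i => hφc.mul_left
  have hsQ : ∀ i : t, tsupport (fun x => ρ i x * φ x) ⊆ Q := fun i =>
    (tsupport_mul_subset_right).trans hφQ
  have hzero : ∀ i : t, L (fun x => ρ i x * φ x) = 0 := fun i =>
    hU i (hφQ (htQ i i.2)) _ (hsm i) (hcs i) ((tsupport_mul_subset_left).trans (hρ i)) (hsQ i)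
  have hL0 : L (fun _ => 0) = 0 := by
    have h0 : tsupport (fun _ : Euc n => (0 : ℝ)) ⊆ Q := by
      rw [tsupport, show (fun _ : Euc n => (0 : ℝ)) = 0 from rfl, Function.support_zero]; simp
    have := hadd (fun _ => 0) (fun _ => 0) contDiff_const HasCompactSupport.zero contDiff_const
      HasCompactSupport.zero h0 h0
    simp only [add_zero] at this
    linarith
  have hsum : ∀ s : Finset t, (L fun x => ∑ i ∈ s, ρ i x * φ x) = 0 ∧
      HasCompactSupport (fun x => ∑ i ∈ s, ρ i x * φ x) ∧
      tsupport (fun x => ∑ i ∈ s, ρ i x * φ x) ⊆ Q := by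
    intro s
    have hsupp : ∀ s : Finset t, Function.support (fun x => ∑ i ∈ s, ρ i x * φ x) ⊆
        Function.support φ := fun s x hx hx0 => hx (by simp [show φ x = 0 from hx0])
    have hcs' : ∀ s : Finset t, HasCompactSupport (fun x => ∑ i ∈ s, ρ i x * φ x) := fun s =>
      hφc.mono (hsupp s)
    have hsQ' : ∀ s : Finset t, tsupport (fun x => ∑ i ∈ s, ρ i x * φ x) ⊆ Q := fun s =>
      (closure_mono (hsupp s)).trans hφQ
    refine ⟨?_, hcs' s, hsQ' s⟩
    induction s using Finset.induction_on with
    | empty => simpa using hL0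
    | insert a s ha ih =>
      simp only [Finset.sum_insert ha]
      rw [hadd _ _ (hsm a) (hcs a) (ContDiff.sum fun i _ => hsm i) (hcs' s) (hsQ a) (hsQ' s),
        hzero, ih, add_zero]
  have hφeq : (fun x => ∑ i ∈ Finset.univ, ρ i x * φ x) = φ := by
    funext x
    by_cases hx : x ∈ tsupport φ
    · rw [← Finset.sum_mul]
      have := ρ.sum_eq_one hx
      rw [finsum_eq_sum_of_fintype] at this
      rw [this, one_mul]
    · simp [image_eq_zero_of_notMem_tsupport hx]
  have := (hsum Finset.univ).1
  rwa [hφeq] at this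

/-- Evaluation of a field of functionals on a measurable field of arguments is measurable if it is
so on constant arguments. -/
theorem aestronglyMeasurable_apply_of_forall {α X : Type*} [MeasurableSpace α]
    [NormedAddCommGroup X] [NormedSpace ℝ X] [FiniteDimensional ℝ X] [MeasurableSpace X]
    [BorelSpace X] {μ : Measure α} {V : α → X →L[ℝ] ℝ}
    (hV : ∀ B, AEStronglyMeasurable (fun x => V x B) μ) {M : α → X} (hM : Measurable M) :
    AEStronglyMeasurable (fun x => V x (M x)) μ := by
  set b := Module.finBasis ℝ X
  have h : ∀ x, V x (M x) = ∑ i, b.coord i (M x) * V x (b i) := fun x => by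
    calc V x (M x) = V x (∑ i, b.repr (M x) i • b i) := by rw [b.sum_repr]
      _ = _ := by simp only [map_sum, map_smul, smul_eq_mul, Module.Basis.coord_apply]
  simp only [h]
  refine Finset.aestronglyMeasurable_fun_sum _ fun i _ => AEStronglyMeasurable.mul ?_ (hV _)
  exact ((LinearMap.continuous_of_finiteDimensional (b.coord i)).measurable.comp
    hM).aestronglyMeasurable

/-- Pointwise bounded families of functionals on a finite-dimensional space are bounded. -/
theorem exists_uniform_bound {α X : Type*} [NormedAddCommGroup X] [NormedSpace ℝ X]
    [FiniteDimensional ℝ X] {s : Set α} {V : α → X →L[ℝ] ℝ}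
    (hV : ∀ B, ∃ C, ∀ x ∈ s, |V x B| ≤ C) : ∃ C, ∀ x ∈ s, ∀ B, |V x B| ≤ C * ‖B‖ := by
  set b := Module.finBasis ℝ X
  choose c hc using hV
  let T : ∀ i, X →L[ℝ] ℝ := fun i => LinearMap.toContinuousLinearMap (b.coord i)
  refine ⟨∑ i, ‖T i‖ * c (b i), fun x hx B => ?_⟩
  have h : V x B = ∑ i, T i B * V x (b i) := by
    calc V x B = V x (∑ i, b.repr B i • b i) := by rw [b.sum_repr]
      _ = _ := by
        simp only [map_sum, map_smul, smul_eq_mul]; rfl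
  rw [h, Finset.sum_mul]
  refine (Finset.abs_sum_le_sum_abs _ _).trans (Finset.sum_le_sum fun i _ => ?_)
  rw [abs_mul, mul_right_comm]
  exact mul_le_mul ((T i).le_opNorm B) (hc _ x hx) (abs_nonneg _) (by positivity)

namespace Frame

variable {k : ℕ} (Φ : Frame k) (G : Euc k → ℝ)

/-- The upward unit normal to the graph of `G` over the base point `x`. -/
def normal (x : Euc k) : Euc (k + 1) :=
  (graphJac (fderiv ℝ G x))⁻¹ • Φ.pt (-(InnerProductSpace.toDual ℝ (Euc k)).symm (fderiv ℝ G x)) 1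

theorem conormal_apply (x : Euc k) (w : Euc (k + 1)) :
    Φ.conormal G x w = Φ.height w - fderiv ℝ G x (Φ.base w) := rfl

/-- The factor is the area density of the graph. It turns the boundary term of Gauss-Green, written
with the conormal in the parameter, into the flux through the unit normal. -/
theorem conormal_eq_inner (x : Euc k) (w : Euc (k + 1)) :
    Φ.conormal G x w = graphJac (fderiv ℝ G x) * inner ℝ (Φ.normal G x) w := by
  have hJ := one_le_graphJac (fderiv ℝ G x)
  rw [normal, real_inner_smul_left, ← mul_assoc, mul_inv_cancel₀ (by linarith), one_mul,
    conormal_apply]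
  conv_rhs => rw [← Φ.pt_base_height w, inner_pt]
  rw [inner_neg_left, InnerProductSpace.toDual_symm_apply]; ring

theorem conormal_eq_smul (x : Euc k) :
    Φ.conormal G x = graphJac (fderiv ℝ G x) • innerSL ℝ (Φ.normal G x) := by
  ext1 w
  rw [conormal_eq_inner]; rfl

theorem norm_normal (x : Euc k) : ‖Φ.normal G x‖ = 1 := by
  have hJ := one_le_graphJac (fderiv ℝ G x)
  rw [normal, norm_smul, norm_inv, Real.norm_eq_abs, abs_of_pos (by linarith)]
  have h := Φ.norm_pt_sq (-(InnerProductSpace.toDual ℝ (Euc k)).symm (fderiv ℝ G x)) 1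
  rw [norm_neg, LinearIsometryEquiv.norm_map] at h
  have h2 := graphJac_sq (fderiv ℝ G x)
  have h3 : ‖Φ.pt (-(InnerProductSpace.toDual ℝ (Euc k)).symm (fderiv ℝ G x)) 1‖ =
      graphJac (fderiv ℝ G x) := by
    rw [← abs_of_nonneg (norm_nonneg _), ← abs_of_pos (show 0 < graphJac (fderiv ℝ G x) by linarith),
      ← sq_eq_sq_iff_abs_eq_abs]
    linarith
  rw [h3, inv_mul_cancel₀ (by linarith)]

@[simp] theorem height_axis : Φ.height Φ.axis = 1 := by simp [axis]

@[simp] theorem base_axis : Φ.base Φ.axis = 0 := by simp [axis]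

@[simp] theorem conormal_axis (x : Euc k) : Φ.conormal G x Φ.axis = 1 := by
  rw [conormal_apply]; simp

variable {G}

theorem continuousAt_normal {x : Euc k} (hG : ContDiffAt ℝ 1 G x) : ContinuousAt (Φ.normal G) x := by
  have h : ContinuousAt (fderiv ℝ G) x := hG.continuousAt_fderiv one_ne_zero
  have h1 : ContinuousAt (fun x => (graphJac (fderiv ℝ G x))⁻¹) x :=
    (continuous_graphJac.continuousAt.comp h).inv₀
      (by have := one_le_graphJac (fderiv ℝ G x); positivity)
  refine h1.smul ?_
  have h2 : Continuous fun l : StrongDual ℝ (Euc k) =>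
      Φ.pt (-(InnerProductSpace.toDual ℝ (Euc k)).symm l) 1 :=
    Φ.continuous_pt.comp (by fun_prop : Continuous fun l : StrongDual ℝ (Euc k) =>
      (-(InnerProductSpace.toDual ℝ (Euc k)).symm l, (1 : ℝ)))
  exact h2.continuousAt.comp h

/-- Surface integrals over a piece of a Lipschitz graph. -/
theorem setIntegral_graph {K : NNReal} (hG : LipschitzWith K G) (f : Euc (k + 1) → ℝ)
    {A : Set (Euc (k + 1))} (hA : MeasurableSet A) :
    ∫ z in range (Φ.graph G) ∩ A, f z ∂μHE[k] =
      ∫ x in Φ.graph G ⁻¹' A, graphJac (fderiv ℝ G x) * f (Φ.graph G x) := by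
  have hemb := Φ.measurableEmbedding_graph hG.continuous
  rw [inter_comm, ← Measure.restrict_restrict hA, ← Φ.map_graph_withDensity hG, hemb.setIntegral_map,
    restrict_withDensity (hemb.measurable hA),
    integral_withDensity_eq_integral_toReal_smul (measurable_graphJac_fderiv G)
      (ae_of_all _ fun x => ENNReal.ofReal_lt_top)]
  refine integral_congr_ae (ae_of_all _ fun x => ?_)
  simp only [smul_eq_mul]
  rw [ENNReal.toReal_ofReal (zero_le_one.trans (one_le_graphJac _))]

theorem range_graph (G : Euc k → ℝ) : range (Φ.graph G) = {z | Φ.above G z = 0} := by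
  ext z
  constructor
  · rintro ⟨x, rfl⟩; exact Φ.above_graph G x
  · intro hz; exact ⟨_, Φ.graph_base G hz⟩

/-- The frame with the opposite axis. -/
def flip : Frame k :=
  (LinearIsometryEquiv.withLpProdCongr 2 (LinearIsometryEquiv.refl ℝ (Euc k))
    (LinearIsometryEquiv.neg ℝ : ℝ ≃ₗᵢ[ℝ] ℝ)).trans Φ

theorem flip_pt (x : Euc k) (t : ℝ) : Φ.flip.pt x t = Φ.pt x (-t) := rfl

theorem flip_base : Φ.flip.base = Φ.base := by
  ext1 z
  rw [← Φ.pt_base_height z, base_pt]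
  conv_lhs => rw [← neg_neg (Φ.height z), ← flip_pt, base_pt]

theorem flip_height : Φ.flip.height = -Φ.height := by
  ext1 z
  rw [← Φ.pt_base_height z]
  conv_lhs => rw [← neg_neg (Φ.height z), ← flip_pt, height_pt]
  simp

/-- With the axis reversed, the region above the graph becomes a region below one, so the one-sided
Gauss-Green formula serves for both sides of the surface. -/
theorem flip_above (z : Euc (k + 1)) : Φ.flip.above (fun x => -G x) z = -Φ.above G z := by
  simp only [above, flip_base, flip_height, neg_apply]; ring

theorem flip_graph (x : Euc k) : Φ.flip.graph (fun x => -G x) x = Φ.graph G x := by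
  rw [graph, flip_pt, neg_neg, graph]

theorem flip_conormal (x : Euc k) : Φ.flip.conormal (fun x => -G x) x = -Φ.conormal G x := by
  ext1 w
  rw [conormal_apply, neg_apply, conormal_apply, flip_base, flip_height,
    fderiv_fun_neg]
  simp only [neg_apply]; ring

theorem heightAbove_eq_above (g : Euc (k + 1) → ℝ) :
    heightAbove Φ.axis g = Φ.above fun x => g (Φ.pt x 0) := by
  funext z
  rw [heightAbove, sub_inner_smul_axis, inner_axis]; rfl

end Frame

end

end Clapeyron

namespace Clapeyron

noncomputable section

/-! ### Local geometry of a surface of gradient discontinuity -/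

namespace Frame

variable {k : ℕ} {Φ Ψ : Frame k} {G H : Euc k → ℝ} {x : Euc (k + 1)}

/-- The sign of the conormal on `w` decides on which side a ray in direction `w` leaves the graph.
-/
theorem tendsto_above_ray (hG : DifferentiableAt ℝ G (Φ.base x)) (hx : Φ.above G x = 0)
    (w : Euc (k + 1)) :
    Tendsto (fun t : ℝ => t⁻¹ * Φ.above G (x + t • w)) (𝓝[>] 0)
      (𝓝 (Φ.conormal G (Φ.base x) w)) := by
  have h1 : HasDerivAt (fun t : ℝ => x + t • w) w 0 := by
    simpa using ((hasDerivAt_id (0 : ℝ)).smul_const w).const_add x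
  have h2 : HasDerivAt (fun t : ℝ => Φ.above G (x + t • w)) (Φ.conormal G (Φ.base x) w) 0 := by
    have h3 := Φ.hasFDerivAt_above hG
    refine HasFDerivAt.comp_hasDerivAt (0 : ℝ) (l := Φ.above G) ?_ h1
    simpa using h3
  have := h2.tendsto_slope_zero_right
  simpa [hx] using this

theorem eventually_above_pos (hG : DifferentiableAt ℝ G (Φ.base x)) (hx : Φ.above G x = 0)
    {w : Euc (k + 1)} (hw : 0 < Φ.conormal G (Φ.base x) w) :
    ∀ᶠ t : ℝ in 𝓝[>] 0, 0 < Φ.above G (x + t • w) := by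
  filter_upwards [(tendsto_above_ray hG hx w).eventually (lt_mem_nhds hw), self_mem_nhdsWithin]
    with t ht (ht0 : 0 < t)
  exact (pos_iff_pos_of_mul_pos ht).1 (inv_pos.2 ht0)

theorem eventually_above_neg (hG : DifferentiableAt ℝ G (Φ.base x)) (hx : Φ.above G x = 0)
    {w : Euc (k + 1)} (hw : Φ.conormal G (Φ.base x) w < 0) :
    ∀ᶠ t : ℝ in 𝓝[>] 0, Φ.above G (x + t • w) < 0 := by
  filter_upwards [(tendsto_above_ray hG hx w).eventually (gt_mem_nhds hw), self_mem_nhdsWithin]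
    with t ht (ht0 : 0 < t)
  exact neg_of_mul_neg_right ht (inv_pos.2 ht0).le

theorem tendsto_ray (x w : Euc (k + 1)) : Tendsto (fun t : ℝ => x + t • w) (𝓝[>] 0) (𝓝 x) := by
  have : Tendsto (fun t : ℝ => x + t • w) (𝓝 0) (𝓝 (x + (0 : ℝ) • w)) :=
    Continuous.tendsto (by fun_prop) 0
  rw [zero_smul, add_zero] at this
  exact this.mono_left nhdsWithin_le_nhds

/-- Two graphs through a point, one contained in the other near the point, have proportional
conormals there. -/
theorem conormal_proportional (hG : DifferentiableAt ℝ G (Φ.base x))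
    (hH : DifferentiableAt ℝ H (Ψ.base x)) (hx : Φ.above G x = 0)
    (hsub : ∀ᶠ z in 𝓝 x, Φ.above G z = 0 → Ψ.above H z = 0) (w : Euc (k + 1)) :
    Ψ.conormal H (Ψ.base x) w =
      Φ.conormal G (Φ.base x) w * Ψ.conormal H (Ψ.base x) Φ.axis := by
  -- A vector in the kernel of the first conormal is the velocity of the curve `c` on the first
  -- graph. The other height vanishes along that curve, so its differential kills the vector. The
  -- claim follows on removing from `w` its component along the axis.
  have hker : ∀ v, Φ.conormal G (Φ.base x) v = 0 → Ψ.conormal H (Ψ.base x) v = 0 := by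
    intro v hv
    set c : ℝ → Euc (k + 1) := fun t => Φ.graph G (Φ.base x + t • Φ.base v) with hc
    have hc0 : c 0 = x := by simp [hc, Φ.graph_base G hx]
    have h1 : HasDerivAt (fun t : ℝ => Φ.base x + t • Φ.base v) (Φ.base v) 0 := by
      simpa using ((hasDerivAt_id (0 : ℝ)).smul_const (Φ.base v)).const_add (Φ.base x)
    have h2 : HasDerivAt (fun t : ℝ => G (Φ.base x + t • Φ.base v))
        (fderiv ℝ G (Φ.base x) (Φ.base v)) 0 := by
      refine HasFDerivAt.comp_hasDerivAt (0 : ℝ) (l := G) ?_ h1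
      simpa using hG.hasFDerivAt
    have hceq : ∀ t, c t = x + (t • Φ.pt (Φ.base v) 0 +
        (G (Φ.base x + t • Φ.base v) - G (Φ.base x)) • Φ.axis) := by
      intro t
      have hxx : x = Φ.pt (Φ.base x) (G (Φ.base x)) := (Φ.graph_base G hx).symm
      rw [hc]
      simp only [graph]
      conv_rhs => rw [hxx]
      rw [← pt_smul, ← add_assoc, ← pt_add, pt_add_smul_axis]
      simp
    have hv' : Φ.pt (Φ.base v) 0 + fderiv ℝ G (Φ.base x) (Φ.base v) • Φ.axis = v := by
      rw [conormal_apply, sub_eq_zero] at hv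
      rw [← hv, pt_add_smul_axis, zero_add, pt_base_height]
    have h3 : HasDerivAt c v 0 := by
      have := ((((hasDerivAt_id (0 : ℝ)).smul_const (Φ.pt (Φ.base v) 0)).add
        ((h2.sub_const (G (Φ.base x))).smul_const Φ.axis)).const_add x)
      rw [one_smul, hv'] at this
      exact this.congr_of_eventuallyEq (Eventually.of_forall hceq)
    have h4 : HasDerivAt (fun t => Ψ.above H (c t)) (Ψ.conormal H (Ψ.base x) v) 0 := by
      refine HasFDerivAt.comp_hasDerivAt (0 : ℝ) (l := Ψ.above H) ?_ h3
      rw [hc0]; exact Ψ.hasFDerivAt_above hH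
    have h5 : (fun t => Ψ.above H (c t)) =ᶠ[𝓝 0] fun _ => 0 := by
      have : Tendsto c (𝓝 0) (𝓝 x) := by rw [← hc0]; exact h3.continuousAt
      filter_upwards [this.eventually hsub] with t ht
      exact ht (Φ.above_graph G _)
    exact h4.unique ((hasDerivAt_const (0 : ℝ) (0 : ℝ)).congr_of_eventuallyEq h5)
  have := hker (w - Φ.conormal G (Φ.base x) w • Φ.axis) (by
    rw [map_sub, map_smul, conormal_axis, smul_eq_mul, mul_one, sub_self])
  rw [map_sub, map_smul, sub_eq_zero, smul_eq_mul] at this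
  exact this

/-- Two local graph representations of a hypersurface have the same normal up to sign. -/
theorem normal_eq_or_neg (hG : DifferentiableAt ℝ G (Φ.base x))
    (hH : DifferentiableAt ℝ H (Ψ.base x)) (hx : Φ.above G x = 0)
    (hsub : ∀ᶠ z in 𝓝 x, Φ.above G z = 0 → Ψ.above H z = 0) :
    (0 < Ψ.conormal H (Ψ.base x) Φ.axis ∧ Ψ.normal H (Ψ.base x) = Φ.normal G (Φ.base x)) ∨
    (Ψ.conormal H (Ψ.base x) Φ.axis < 0 ∧ Ψ.normal H (Ψ.base x) = -Φ.normal G (Φ.base x)) := by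
  have h := conormal_proportional hG hH hx hsub
  set lam := Ψ.conormal H (Ψ.base x) Φ.axis
  set n := Φ.normal G (Φ.base x)
  set n' := Ψ.normal H (Ψ.base x)
  have hJ := one_le_graphJac (fderiv ℝ G (Φ.base x))
  have hJ' := one_le_graphJac (fderiv ℝ H (Ψ.base x))
  set c := (graphJac (fderiv ℝ H (Ψ.base x)))⁻¹ * (graphJac (fderiv ℝ G (Φ.base x)) * lam) with hc
  have hn : n' = c • n := by
    refine ext_inner_right ℝ fun w => ?_
    have := h w
    rw [conormal_eq_inner, conormal_eq_inner] at this
    rw [real_inner_smul_left, hc]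
    field_simp
    linarith
  have hnn : ‖n‖ = 1 := Φ.norm_normal G _
  have hnn' : ‖n'‖ = 1 := Ψ.norm_normal H _
  -- Both normals are unit vectors, so the proportionality factor is ±1, with the sign of `lam`.
  have hc1 : |c| = 1 := by
    rw [hn, norm_smul, hnn, mul_one] at hnn'; exact hnn'
  have hpos : 0 < (graphJac (fderiv ℝ H (Ψ.base x)))⁻¹ * graphJac (fderiv ℝ G (Φ.base x)) := by
    positivity
  rw [← mul_assoc] at hc
  rcases eq_or_eq_neg_of_abs_eq hc1 with h1 | h1
  · left
    refine ⟨?_, by rw [hn, h1, one_smul]⟩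
    by_contra hl
    have := mul_nonpos_of_nonneg_of_nonpos hpos.le (not_lt.1 hl)
    linarith
  · right
    refine ⟨?_, by rw [hn, h1, neg_one_smul]⟩
    by_contra hl
    have := mul_nonneg hpos.le (not_lt.1 hl)
    linarith

end Frame

variable {m k : ℕ} {Ω S : Set (Euc (k + 1))} {y : Euc (k + 1) → Euc m}
  {ν : Euc (k + 1) → Euc (k + 1)} {Fp Fm : Euc (k + 1) → Mat m (k + 1)}

/-- A representation of `S` near `x` as a Lipschitz graph, together with the one-sided limits of
the gradient of `y`. -/
structure IsJumpChart (Φ : Frame k) (G : Euc k → ℝ) (S : Set (Euc (k + 1)))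
    (y : Euc (k + 1) → Euc m) (x ν : Euc (k + 1)) (A B : Mat m (k + 1)) : Prop where
  lipschitz : ∃ K, LipschitzWith K G
  contDiffAt : ContDiffAt ℝ 1 G (Φ.base x)
  mem_iff : ∀ᶠ z in 𝓝 x, (z ∈ S ↔ Φ.above G z = 0)
  normal_eq : ν = Φ.normal G (Φ.base x)
  tendsto_pos : Tendsto (fderiv ℝ y) (𝓝[{z | 0 < Φ.above G z}] x) (𝓝 A)
  tendsto_neg : Tendsto (fderiv ℝ y) (𝓝[{z | Φ.above G z < 0}] x) (𝓝 B)

/-- The area formula and Gauss-Green need a globally Lipschitz graph, whereas a C¹ function is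
Lipschitz only locally. Its restriction to a neighbourhood of the base point is extended; the other
requirements on a chart are local and survive. -/
theorem HasGradientJump.exists_chart {x n : Euc (k + 1)} {A B : Mat m (k + 1)}
    (h : HasGradientJump S y x n A B) : ∃ Φ G, IsJumpChart Φ G S y x n A B := by
  obtain ⟨e, g, he, hg, hS, hn, hA, hB⟩ := h
  obtain ⟨Φ, rfl⟩ := Frame.exists_axis_eq he
  rw [Φ.heightAbove_eq_above] at *
  set G₀ : Euc k → ℝ := fun x => g (Φ.pt x 0) with hG₀
  have hG₀c : ContDiff ℝ 1 G₀ := by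
    refine hg.comp ?_
    have : ∀ v : Euc k, Φ.pt v 0 = Φ (WithLp.toLp 2 (v, 0)) := fun v => rfl
    have h2 : IsBoundedLinearMap ℝ fun v : Euc k => Φ.pt v 0 :=
      { map_add := fun a b => by rw [← Φ.pt_add, add_zero]
        map_smul := fun c a => by rw [← Φ.pt_smul, mul_zero]
        bound := ⟨1, one_pos, fun v => by
          have := Φ.norm_pt_sq v 0
          rw [one_mul]
          refine abs_le_of_sq_le_sq' ?_ (norm_nonneg _) |>.2
          nlinarith⟩ }
    exact h2.contDiff
  obtain ⟨K, t, ht, htL⟩ := (hG₀c.contDiffAt (x := Φ.base x)).exists_lipschitzOnWith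
  obtain ⟨G, hGL, hGe⟩ := htL.extend_real
  have hev : G =ᶠ[𝓝 (Φ.base x)] G₀ := by
    filter_upwards [ht] with v hv using (hGe hv).symm
  have hab : ∀ᶠ z in 𝓝 x, Φ.above G₀ z = Φ.above G z := by
    filter_upwards [(Φ.base.continuous.tendsto x).eventually hev] with z hz
    rw [Frame.above, Frame.above, hz]
  have hcon : Φ.conormal G₀ (Φ.base x) = Φ.conormal G (Φ.base x) := by
    rw [Frame.conormal, Frame.conormal, hev.fderiv_eq]
  refine ⟨Φ, G, ⟨K, hGL⟩, hG₀c.contDiffAt.congr_of_eventuallyEq hev, ?_, ?_, ?_, ?_⟩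
  · filter_upwards [hS, hab] with z h1 h2
    rw [h1, h2]
  · have hgrad : gradient (Φ.above G₀) x =
        graphJac (fderiv ℝ G (Φ.base x)) • Φ.normal G (Φ.base x) := by
      rw [gradient, (Φ.hasFDerivAt_above (hG₀c.differentiable one_ne_zero _)).fderiv, hcon]
      refine ext_inner_right ℝ fun w => ?_
      rw [InnerProductSpace.toDual_symm_apply, Φ.conormal_eq_inner, real_inner_smul_left]
    have hJ := one_le_graphJac (fderiv ℝ G (Φ.base x))
    rw [hn, hgrad, norm_smul, Φ.norm_normal, mul_one, Real.norm_eq_abs, abs_of_pos (by linarith),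
      smul_smul, inv_mul_cancel₀ (by linarith), one_smul]
  · have : 𝓝[{z | 0 < Φ.above G z}] x = 𝓝[{z | 0 < Φ.above G₀ z}] x := by
      rw [nhdsWithin_eq_iff_eventuallyEq]
      filter_upwards [hab] with z hz
      exact propext (by change 0 < _ ↔ 0 < _; rw [hz])
    rwa [this]
  · have : 𝓝[{z | Φ.above G z < 0}] x = 𝓝[{z | Φ.above G₀ z < 0}] x := by
      rw [nhdsWithin_eq_iff_eventuallyEq]
      filter_upwards [hab] with z hz
      exact propext (by change _ < 0 ↔ _ < 0; rw [hz])
    rwa [this]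

namespace IsJumpChart

variable {Φ : Frame k} {G : Euc k → ℝ} {x n : Euc (k + 1)} {A B : Mat m (k + 1)}

theorem differentiableAt (h : IsJumpChart Φ G S y x n A B) : DifferentiableAt ℝ G (Φ.base x) :=
  h.contDiffAt.differentiableAt one_ne_zero

theorem above_eq_zero (h : IsJumpChart Φ G S y x n A B) (hx : x ∈ S) : Φ.above G x = 0 :=
  h.mem_iff.self_of_nhds.1 hx

theorem tendsto_ray_pos (h : IsJumpChart Φ G S y x n A B) (hx : x ∈ S) {w : Euc (k + 1)}
    (hw : 0 < Φ.conormal G (Φ.base x) w) :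
    Tendsto (fun t : ℝ => fderiv ℝ y (x + t • w)) (𝓝[>] 0) (𝓝 A) :=
  h.tendsto_pos.comp (tendsto_nhdsWithin_iff.2 ⟨Frame.tendsto_ray x w,
    Frame.eventually_above_pos h.differentiableAt (h.above_eq_zero hx) hw⟩)

theorem tendsto_ray_neg (h : IsJumpChart Φ G S y x n A B) (hx : x ∈ S) {w : Euc (k + 1)}
    (hw : Φ.conormal G (Φ.base x) w < 0) :
    Tendsto (fun t : ℝ => fderiv ℝ y (x + t • w)) (𝓝[>] 0) (𝓝 B) :=
  h.tendsto_neg.comp (tendsto_nhdsWithin_iff.2 ⟨Frame.tendsto_ray x w,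
    Frame.eventually_above_neg h.differentiableAt (h.above_eq_zero hx) hw⟩)

/-- The one-sided limits at a nearby point of the surface, with a possibly different choice of
normal, seen in a given chart. -/
theorem limits_at {x' n' : Euc (k + 1)} {A' B' : Mat m (k + 1)} {Ψ : Frame k} {H : Euc k → ℝ}
    (hx' : x' ∈ S) (hG : DifferentiableAt ℝ G (Φ.base x'))
    (hS : ∀ᶠ z in 𝓝 x', (z ∈ S ↔ Φ.above G z = 0)) (h' : IsJumpChart Ψ H S y x' n' A' B') :
    ∃ A'' B'', ((n' = Φ.normal G (Φ.base x') ∧ A' = A'' ∧ B' = B'') ∨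
        (n' = -Φ.normal G (Φ.base x') ∧ A' = B'' ∧ B' = A'')) ∧
      Tendsto (fun t : ℝ => fderiv ℝ y (x' + t • Φ.axis)) (𝓝[>] 0) (𝓝 A'') ∧
      Tendsto (fun t : ℝ => fderiv ℝ y (x' + t • (-Φ.axis))) (𝓝[>] 0) (𝓝 B'') := by
  have hx0 : Φ.above G x' = 0 := hS.self_of_nhds.1 hx'
  have hsub : ∀ᶠ z in 𝓝 x', Φ.above G z = 0 → Ψ.above H z = 0 := by
    filter_upwards [hS, h'.mem_iff] with z h1 h2 h3 using h2.1 (h1.2 h3)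
  rcases Frame.normal_eq_or_neg hG h'.differentiableAt hx0 hsub with ⟨hpos, hn⟩ | ⟨hneg, hn⟩
  · refine ⟨A', B', Or.inl ⟨by rw [h'.normal_eq, hn], rfl, rfl⟩, h'.tendsto_ray_pos hx' hpos,
      h'.tendsto_ray_neg hx' ?_⟩
    rw [map_neg]; linarith
  · refine ⟨B', A', Or.inr ⟨by rw [h'.normal_eq, hn], rfl, rfl⟩, h'.tendsto_ray_neg hx' hneg,
      h'.tendsto_ray_pos hx' ?_⟩
    rw [map_neg]; linarith

end IsJumpChart

end

end Clapeyron

namespace Clapeyron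

noncomputable section

/-! ### Configurations with a surface of gradient discontinuity -/

variable {m k : ℕ} {Ω S : Set (Euc (k + 1))} {y : Euc (k + 1) → Euc m}
  {ν : Euc (k + 1) → Euc (k + 1)} {Fp Fm : Euc (k + 1) → Mat m (k + 1)}

/-- The space of triples `(x, y, F)`. -/
abbrev Phase (m n : ℕ) : Type := Euc n × Euc m × Mat m n

/-- The map `x ↦ (x, y(x), ∇y(x))`. -/
def jet {n : ℕ} (y : Euc n → Euc m) (x : Euc n) : Phase m n := (x, y x, fderiv ℝ y x)

/-- A Lipschitz map on a bounded open set which is `C²` off a surface of jump discontinuity of its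
gradient, the closure of the range of its jet lying in the open set `U`. -/
structure JumpSetting (Ω S : Set (Euc (k + 1))) (y : Euc (k + 1) → Euc m)
    (ν : Euc (k + 1) → Euc (k + 1)) (Fp Fm : Euc (k + 1) → Mat m (k + 1))
    (U : Set (Phase m (k + 1))) : Prop where
  isOpen : IsOpen Ω
  bounded : Bornology.IsBounded Ω
  closed : closure S ∩ Ω ⊆ S
  area : μHE[k] S < ⊤
  lipschitz : ∃ K : NNReal, LipschitzOnWith K y Ω
  contDiffOn : ContDiffOn ℝ 2 y (Ω \ S)
  jump : ∀ x ∈ S ∩ Ω, HasGradientJump S y x (ν x) (Fp x) (Fm x)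
  isOpen_range : IsOpen U
  range_subset : closure (jet y '' (Ω \ S)) ⊆ U

namespace JumpSetting

variable {U : Set (Phase m (k + 1))}

theorem isOpen_diff (h : JumpSetting Ω S y ν Fp Fm U) : IsOpen (Ω \ S) := by
  have : Ω \ S = Ω ∩ (closure S)ᶜ := by
    ext x
    exact ⟨fun hx => ⟨hx.1, fun hc => hx.2 (h.closed ⟨hc, hx.1⟩)⟩,
      fun hx => ⟨hx.1, fun hS => hx.2 (subset_closure hS)⟩⟩
  rw [this]
  exact h.isOpen.inter isClosed_closure.isOpen_compl

theorem measurableSet_inter (h : JumpSetting Ω S y ν Fp Fm U) : MeasurableSet (S ∩ Ω) := by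
  have : S ∩ Ω = closure S ∩ Ω :=
    Subset.antisymm (inter_subset_inter_left _ subset_closure) fun x hx => ⟨h.closed hx, hx.2⟩
  rw [this]
  exact isClosed_closure.measurableSet.inter h.isOpen.measurableSet

/-- A set of finite k-dimensional measure is null in dimension k + 1. -/
theorem volume_surface (h : JumpSetting Ω S y ν Fp Fm U) : volume S = 0 := by
  rw [← EuclideanSpace.euclideanHausdorffMeasure_eq_volume]
  rcases Measure.euclideanHausdorffMeasure_zero_or_top (Nat.lt_succ_self k) S with h0 | h0
  · exact h0
  · exact absurd h0 h.area.ne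

theorem volume_lt_top (h : JumpSetting Ω S y ν Fp Fm U) : volume Ω < ⊤ := h.bounded.measure_lt_top

theorem ae_notMem (h : JumpSetting Ω S y ν Fp Fm U) : ∀ᵐ x, x ∉ S :=
  measure_eq_zero_iff_ae_notMem.1 h.volume_surface

theorem contDiffAt (h : JumpSetting Ω S y ν Fp Fm U) {x : Euc (k + 1)} (hx : x ∈ Ω \ S) :
    ContDiffAt ℝ 2 y x :=
  (h.contDiffOn x hx).contDiffAt (h.isOpen_diff.mem_nhds hx)

theorem continuousAt (h : JumpSetting Ω S y ν Fp Fm U) {x : Euc (k + 1)} (hx : x ∈ Ω) :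
    ContinuousAt y x := by
  obtain ⟨K, hK⟩ := h.lipschitz
  exact (hK.continuousOn x hx).continuousAt (h.isOpen.mem_nhds hx)

theorem continuousOn_jet (h : JumpSetting Ω S y ν Fp Fm U) : ContinuousOn (jet y) (Ω \ S) :=
  fun _ hx => ((continuousAt_id).prodMk ((h.continuousAt hx.1).prodMk
    ((h.contDiffAt hx).continuousAt_fderiv two_ne_zero))).continuousWithinAt

theorem jet_mem {x : Euc (k + 1)} (hx : x ∈ Ω \ S) : jet y x ∈ closure (jet y '' (Ω \ S)) :=
  subset_closure (mem_image_of_mem _ hx)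

/-- Since Ω is bounded and `y` is Lipschitz, points, values and gradients all stay bounded. This
compactness makes every continuous function of the jet bounded, hence integrable over Ω. -/
theorem isCompact_range (h : JumpSetting Ω S y ν Fp Fm U) :
    IsCompact (closure (jet y '' (Ω \ S))) := by
  obtain ⟨K, hK⟩ := h.lipschitz
  have h2 : Bornology.IsBounded (y '' Ω) := by
    obtain ⟨C, hC⟩ := Metric.isBounded_iff.1 h.bounded
    refine Metric.isBounded_iff.2 ⟨K * C, ?_⟩
    rintro _ ⟨a, ha, rfl⟩ _ ⟨b, hb, rfl⟩
    exact (hK.dist_le_mul a ha b hb).trans (mul_le_mul_of_nonneg_left (hC ha hb) K.2)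
  refine Bornology.IsBounded.isCompact_closure
    ((h.bounded.prod (h2.prod (Metric.isBounded_closedBall (x := (0 : Mat m (k + 1))) (r := K)))).subset ?_)
  rintro _ ⟨x, hx, rfl⟩
  refine ⟨hx.1, mem_image_of_mem _ hx.1, ?_⟩
  rw [mem_closedBall_zero_iff]
  exact norm_fderiv_le_of_lipschitzOn ℝ (h.isOpen.mem_nhds hx.1) hK

/-- A limit of jets from within `Ω \ S` lies in the closure of the range. -/
theorem mem_range_of_tendsto (_h : JumpSetting Ω S y ν Fp Fm U) {ι : Type*} {l : Filter ι}
    [l.NeBot] {u : ι → Euc (k + 1)} {p : Phase m (k + 1)} (hu : ∀ᶠ i in l, u i ∈ Ω \ S)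
    (hp : Tendsto (fun i => jet y (u i)) l (𝓝 p)) : p ∈ closure (jet y '' (Ω \ S)) :=
  mem_closure_of_tendsto hp (hu.mono fun _ hi => mem_image_of_mem _ hi)

/-- Rays leaving the surface transversally stay in `Ω \ S` for a while. -/
theorem eventually_ray_mem (h : JumpSetting Ω S y ν Fp Fm U) {Φ : Frame k} {G : Euc k → ℝ}
    {x w : Euc (k + 1)} (hx : x ∈ S ∩ Ω) (hG : DifferentiableAt ℝ G (Φ.base x))
    (hS : ∀ᶠ z in 𝓝 x, (z ∈ S ↔ Φ.above G z = 0)) (hw : Φ.conormal G (Φ.base x) w ≠ 0) :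
    ∀ᶠ t : ℝ in 𝓝[>] 0, x + t • w ∈ Ω \ S := by
  have hx0 := hS.self_of_nhds.1 hx.1
  have hne : ∀ᶠ t : ℝ in 𝓝[>] 0, Φ.above G (x + t • w) ≠ 0 := by
    rcases lt_or_gt_of_ne hw with hw | hw
    · exact (Frame.eventually_above_neg hG hx0 hw).mono fun t ht => ht.ne
    · exact (Frame.eventually_above_pos hG hx0 hw).mono fun t ht => ht.ne'
  filter_upwards [hne, (Frame.tendsto_ray x w).eventually hS,
    (Frame.tendsto_ray x w).eventually (h.isOpen.mem_nhds hx.2)] with t h1 h2 h3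
  exact ⟨h3, fun h4 => h1 (h2.1 h4)⟩

theorem tendsto_jet_ray (h : JumpSetting Ω S y ν Fp Fm U) {x w : Euc (k + 1)} (hx : x ∈ Ω)
    {A : Mat m (k + 1)} (hA : Tendsto (fun t : ℝ => fderiv ℝ y (x + t • w)) (𝓝[>] 0) (𝓝 A)) :
    Tendsto (fun t : ℝ => jet y (x + t • w)) (𝓝[>] 0) (𝓝 (x, y x, A)) :=
  (Frame.tendsto_ray x w).prodMk_nhds
    (((h.continuousAt hx).tendsto.comp (Frame.tendsto_ray x w)).prodMk_nhds hA)

/-- Places the one-sided jets in `U`, so that W is differentiable there; they are limits of jets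
along the axis of a chart and its opposite. -/
theorem mem_range_pos_neg (h : JumpSetting Ω S y ν Fp Fm U) {x : Euc (k + 1)} (hx : x ∈ S ∩ Ω) :
    (x, y x, Fp x) ∈ closure (jet y '' (Ω \ S)) ∧ (x, y x, Fm x) ∈ closure (jet y '' (Ω \ S)) := by
  obtain ⟨Φ, G, hc⟩ := (h.jump x hx).exists_chart
  constructor
  · refine h.mem_range_of_tendsto (h.eventually_ray_mem (w := Φ.axis) hx hc.differentiableAt
      hc.mem_iff (by simp)) (h.tendsto_jet_ray hx.2 (hc.tendsto_ray_pos hx.1 (by simp)))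
  · refine h.mem_range_of_tendsto (h.eventually_ray_mem (w := -Φ.axis) hx hc.differentiableAt
      hc.mem_iff (by simp)) (h.tendsto_jet_ray hx.2 (hc.tendsto_ray_neg hx.1 (by simp)))

theorem norm_normal (h : JumpSetting Ω S y ν Fp Fm U) {x : Euc (k + 1)} (hx : x ∈ S ∩ Ω) :
    ‖ν x‖ = 1 := by
  obtain ⟨Φ, G, hc⟩ := (h.jump x hx).exists_chart
  rw [hc.normal_eq, Φ.norm_normal]

/-- **Hadamard's condition**: the jump of the gradient vanishes on tangent vectors. -/
theorem gradient_jump_tangent (h : JumpSetting Ω S y ν Fp Fm U) {x : Euc (k + 1)}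
    (hx : x ∈ S ∩ Ω) {w : Euc (k + 1)} (hw : inner ℝ (ν x) w = 0) : Fp x w = Fm x w := by
  obtain ⟨Φ, G, hc⟩ := (h.jump x hx).exists_chart
  obtain ⟨K, hK⟩ := h.lipschitz
  have hcw : Φ.conormal G (Φ.base x) w = 0 := by
    rw [Φ.conormal_eq_inner, ← hc.normal_eq, hw, mul_zero]
  -- A transversal ray runs in the smooth region near `x`, so the one-sided derivative of `y` along
  -- it at `x` is the limit of the derivatives.
  have hray : ∀ (u : Euc (k + 1)) (A : Mat m (k + 1)), Φ.conormal G (Φ.base x) u ≠ 0 →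
      Tendsto (fun t : ℝ => fderiv ℝ y (x + t • u)) (𝓝[>] 0) (𝓝 A) →
      Tendsto (fun t : ℝ => t⁻¹ • (y (x + t • u) - y x)) (𝓝[>] 0) (𝓝 (A u)) := by
    intro u A hu hA
    have hev := h.eventually_ray_mem hx hc.differentiableAt hc.mem_iff hu
    obtain ⟨r, hr, hrm⟩ := mem_nhdsGT_iff_exists_Ioo_subset.1 hev
    have hline : ∀ t : ℝ, HasDerivAt (fun t : ℝ => x + t • u) u t := fun t => by
      simpa using ((hasDerivAt_id t).smul_const u).const_add x
    have hder : ∀ t ∈ Ioo 0 r, HasDerivAt (fun t : ℝ => y (x + t • u)) (fderiv ℝ y (x + t • u) u) t :=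
      fun t ht => HasFDerivAt.comp_hasDerivAt t
        ((h.contDiffAt (hrm ht)).differentiableAt two_ne_zero).hasFDerivAt (hline t)
    have hlim : HasDerivWithinAt (fun t : ℝ => y (x + t • u)) (A u) (Ici 0) 0 := by
      refine hasDerivWithinAt_Ici_of_tendsto_deriv (s := Ioo 0 r)
        (fun t ht => (hder t ht).differentiableAt.differentiableWithinAt) ?_
        (Ioo_mem_nhdsGT hr) ?_
      · refine ContinuousAt.continuousWithinAt ?_
        refine ContinuousAt.comp (f := fun t : ℝ => x + t • u) ?_ (hline 0).continuousAt
        simpa using h.continuousAt hx.2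
      · have h1 : Tendsto (fun t : ℝ => fderiv ℝ y (x + t • u) u) (𝓝[>] 0) (𝓝 (A u)) :=
          ((ContinuousLinearMap.apply ℝ (Euc m) u).continuous.tendsto A).comp hA
        refine h1.congr' ?_
        filter_upwards [Ioo_mem_nhdsGT hr] with t ht using (hder t ht).deriv.symm
    have h2 := (hlim.mono Ioi_subset_Ici_self)
    rw [hasDerivWithinAt_iff_tendsto_slope' (by simp)] at h2
    refine h2.congr fun t => ?_
    simp [slope_def_module]
  -- A ray in the tangent direction `w` may meet the surface, so it is tilted by ±δ along the axis
  -- to the two sides. The tilted points at time t are at distance 2δt, so the Lipschitz bound on Ω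
  -- separates the two derivatives by at most 2Kδ.
  have hδ : ∀ δ : ℝ, 0 < δ → ‖Fp x (w + δ • Φ.axis) - Fm x (w + (-δ) • Φ.axis)‖ ≤ 2 * K * δ := by
    intro δ hδ
    have c1 : Φ.conormal G (Φ.base x) (w + δ • Φ.axis) = δ := by
      rw [map_add, map_smul, hcw, Φ.conormal_axis]; simp
    have c2 : Φ.conormal G (Φ.base x) (w + (-δ) • Φ.axis) = -δ := by
      rw [map_add, map_smul, hcw, Φ.conormal_axis]; simp
    have t1 := hray _ (Fp x) (by rw [c1]; exact hδ.ne')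
      (hc.tendsto_ray_pos hx.1 (by rw [c1]; exact hδ))
    have t2 := hray _ (Fm x) (by rw [c2]; linarith)
      (hc.tendsto_ray_neg hx.1 (by rw [c2]; linarith))
    refine le_of_tendsto (t1.sub t2).norm ?_
    filter_upwards [(Frame.tendsto_ray x (w + δ • Φ.axis)).eventually (h.isOpen.mem_nhds hx.2),
      (Frame.tendsto_ray x (w + (-δ) • Φ.axis)).eventually (h.isOpen.mem_nhds hx.2),
      self_mem_nhdsWithin] with t h1 h2 (ht : 0 < t)
    rw [← smul_sub, sub_sub_sub_cancel_right, norm_smul, norm_inv, Real.norm_eq_abs, abs_of_pos ht]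
    have h3 := hK.dist_le_mul _ h1 _ h2
    rw [dist_eq_norm, dist_eq_norm] at h3
    have h4 : x + t • (w + δ • Φ.axis) - (x + t • (w + (-δ) • Φ.axis)) = (t * (2 * δ)) • Φ.axis := by
      module
    rw [h4, norm_smul, Φ.norm_axis, mul_one, Real.norm_eq_abs, abs_of_pos (by positivity)] at h3
    calc _ ≤ t⁻¹ * (K * (t * (2 * δ))) := mul_le_mul_of_nonneg_left h3 (inv_pos.2 ht).le
      _ = _ := by field_simp
  have hl1 : Tendsto (fun δ : ℝ => ‖Fp x (w + δ • Φ.axis) - Fm x (w + (-δ) • Φ.axis)‖) (𝓝[>] 0)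
      (𝓝 ‖Fp x w - Fm x w‖) := by
    have : Continuous fun δ : ℝ => ‖Fp x (w + δ • Φ.axis) - Fm x (w + (-δ) • Φ.axis)‖ := by fun_prop
    have := this.tendsto 0
    simp only [neg_zero, zero_smul, add_zero] at this
    exact this.mono_left nhdsWithin_le_nhds
  have hl2 : Tendsto (fun δ : ℝ => 2 * K * δ) (𝓝[>] 0) (𝓝 0) := by
    have : Continuous fun δ : ℝ => 2 * (K : ℝ) * δ := by fun_prop
    have := this.tendsto 0
    rw [mul_zero] at this
    exact this.mono_left nhdsWithin_le_nhds
  have := le_of_tendsto_of_tendsto hl1 hl2 (eventually_mem_nhdsWithin.mono fun δ hδ' => hδ δ hδ')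
  exact sub_eq_zero.1 (norm_le_zero_iff.1 this)

end JumpSetting

end

end Clapeyron

namespace Clapeyron

noncomputable section

/-! ### Fluxes and their jumps -/

variable {m k : ℕ} {Ω S : Set (Euc (k + 1))} {y : Euc (k + 1) → Euc m}
  {ν : Euc (k + 1) → Euc (k + 1)} {Fp Fm : Euc (k + 1) → Mat m (k + 1)}
  {U : Set (Phase m (k + 1))} {J : Phase m (k + 1) → StrongDual ℝ (Euc (k + 1)) →L[ℝ] ℝ}

/-- A flux depending continuously on `(x, y, F) ∈ U`. -/
def IsFlux (U : Set (Phase m (k + 1)))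
    (J : Phase m (k + 1) → StrongDual ℝ (Euc (k + 1)) →L[ℝ] ℝ) : Prop :=
  ∀ ℓ, ContinuousOn (fun p => J p ℓ) U

theorem IsFlux.tendsto (hJ : IsFlux U J) (hU : IsOpen U) {ι : Type*} {l : Filter ι}
    {p : ι → Phase m (k + 1)} {q : Phase m (k + 1)} (hq : q ∈ U) (hp : Tendsto p l (𝓝 q))
    {ℓ : ι → StrongDual ℝ (Euc (k + 1))} {ℓ₀ : StrongDual ℝ (Euc (k + 1))}
    (hℓ : Tendsto ℓ l (𝓝 ℓ₀)) : Tendsto (fun i => J (p i) (ℓ i)) l (𝓝 (J q ℓ₀)) := by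
  set b := Module.finBasis ℝ (StrongDual ℝ (Euc (k + 1)))
  have h : ∀ q' ℓ', J q' ℓ' = ∑ i, b.coord i ℓ' * J q' (b i) := fun q' ℓ' => by
    calc J q' ℓ' = J q' (∑ i, b.repr ℓ' i • b i) := by rw [b.sum_repr]
      _ = _ := by simp only [map_sum, map_smul, smul_eq_mul, Module.Basis.coord_apply]
  rw [h q ℓ₀]
  refine Tendsto.congr (fun i => (h (p i) (ℓ i)).symm) ?_
  refine tendsto_finsetSum _ fun i _ => Tendsto.mul ?_ ?_
  · exact ((LinearMap.continuous_of_finiteDimensional (b.coord i)).tendsto ℓ₀).comp hℓ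
  · exact ((hJ (b i)).continuousAt (hU.mem_nhds hq)).tendsto.comp hp

open Classical in
/-- The flux field of `y`, set to zero on the surface. -/
def fluxField (J : Phase m (k + 1) → StrongDual ℝ (Euc (k + 1)) →L[ℝ] ℝ) (S : Set (Euc (k + 1)))
    (y : Euc (k + 1) → Euc m) (z : Euc (k + 1)) : StrongDual ℝ (Euc (k + 1)) →L[ℝ] ℝ :=
  if z ∈ S then 0 else J (jet y z)

theorem fluxField_of_notMem {z : Euc (k + 1)} (hz : z ∉ S) : fluxField J S y z = J (jet y z) :=
  if_neg hz

/-- The jump of the normal component of a flux. -/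
def normalJump (J : Phase m (k + 1) → StrongDual ℝ (Euc (k + 1)) →L[ℝ] ℝ)
    (y : Euc (k + 1) → Euc m) (ν : Euc (k + 1) → Euc (k + 1)) (Fp Fm : Euc (k + 1) → Mat m (k + 1))
    (z : Euc (k + 1)) : ℝ :=
  J (z, y z, Fp z) (innerSL ℝ (ν z)) - J (z, y z, Fm z) (innerSL ℝ (ν z))

/-- Directional limits inherit the limit of a function on a set containing the directions. -/
theorem tendsto_of_ray_limits {X : Type*} [NormedAddCommGroup X] {n : ℕ} {f : Euc n → X}
    {P T : Set (Euc n)} {x₀ u : Euc n} {a : X} (hf : Tendsto f (𝓝[P] x₀) (𝓝 a))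
    {b : Euc n → X} (hb : ∀ᶠ x in 𝓝[T] x₀, Tendsto (fun t : ℝ => f (x + t • u)) (𝓝[>] 0) (𝓝 (b x)))
    (hP : ∀ᶠ x in 𝓝[T] x₀, ∀ᶠ t : ℝ in 𝓝[>] 0, x + t • u ∈ P) : Tendsto b (𝓝[T] x₀) (𝓝 a) := by
  rw [Metric.tendsto_nhds]
  intro ε hε
  have h1 := (Metric.tendsto_nhds.1 hf) (ε / 2) (half_pos hε)
  rw [eventually_nhdsWithin_iff] at h1
  have h2 : ∀ᶠ x in 𝓝[T] x₀, ∀ᶠ z in 𝓝 x, z ∈ P → dist (f z) a < ε / 2 :=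
    (eventually_eventually_nhds.2 h1).filter_mono nhdsWithin_le_nhds
  have hray : ∀ x : Euc n, Tendsto (fun t : ℝ => x + t • u) (𝓝[>] 0) (𝓝 x) := fun x => by
    have : Tendsto (fun t : ℝ => x + t • u) (𝓝 0) (𝓝 (x + (0 : ℝ) • u)) :=
      Continuous.tendsto (by fun_prop) 0
    rw [zero_smul, add_zero] at this
    exact this.mono_left nhdsWithin_le_nhds
  filter_upwards [hb, hP, h2] with x hx1 hx2 hx3
  refine lt_of_le_of_lt (le_of_tendsto (hx1.dist tendsto_const_nhds) ?_) (half_lt_self hε)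
  filter_upwards [hx2, (hray x).eventually hx3] with t ht1 ht2 using (ht2 ht1).le

namespace JumpSetting

theorem exists_flux_bound (h : JumpSetting Ω S y ν Fp Fm U) (hJ : IsFlux U J) :
    ∃ C, 0 ≤ C ∧ ∀ p ∈ closure (jet y '' (Ω \ S)), ∀ ℓ, |J p ℓ| ≤ C * ‖ℓ‖ := by
  obtain ⟨C, hC⟩ := exists_uniform_bound (s := closure (jet y '' (Ω \ S))) (V := J) fun ℓ => by
    obtain ⟨C, hC⟩ := h.isCompact_range.exists_bound_of_continuousOn ((hJ ℓ).mono h.range_subset)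
    exact ⟨C, hC⟩
  exact ⟨max C 0, le_max_right _ _, fun p hp ℓ => (hC p hp ℓ).trans
    (mul_le_mul_of_nonneg_right (le_max_left _ _) (norm_nonneg _))⟩

theorem exists_isBoundedField (h : JumpSetting Ω S y ν Fp Fm U) (hJ : IsFlux U J) :
    ∃ C, ∀ D ⊆ Ω, IsBoundedField D C (fluxField J S y) := by
  obtain ⟨C, hC0, hC⟩ := h.exists_flux_bound hJ
  refine ⟨C, fun D hD => ⟨fun M hM => aestronglyMeasurable_apply_of_forall (fun ℓ => ?_) hM,
    fun z hz ℓ => ?_⟩⟩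
  · refine AEStronglyMeasurable.mono_set hD ?_
    have h1 : AEStronglyMeasurable (fun z => J (jet y z) ℓ) (volume.restrict (Ω \ S)) :=
      ((hJ ℓ).comp h.continuousOn_jet fun z hz => h.range_subset (jet_mem hz)).aestronglyMeasurable
        h.isOpen_diff.measurableSet
    have h2 : volume.restrict Ω = volume.restrict (Ω \ S) :=
      (Measure.restrict_congr_set (sdiff_null_ae_eq_self h.volume_surface)).symm
    rw [h2]
    refine h1.congr ?_
    filter_upwards [ae_restrict_mem h.isOpen_diff.measurableSet] with z hz
    rw [fluxField_of_notMem hz.2]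
  -- The bound is required at every point. On the surface the derivative of `y` carries no
  -- information, and there the field is zero by definition.
  · by_cases hS : z ∈ S
    · rw [fluxField, if_pos hS]; simpa using mul_nonneg hC0 (norm_nonneg ℓ)
    · rw [fluxField_of_notMem hS]; exact hC _ (jet_mem ⟨hD hz, hS⟩) ℓ

/-- The one-sided limits of the gradient near a point of the surface, with the sides labelled as in
a chart at that point. -/
theorem exists_chart_limits (h : JumpSetting Ω S y ν Fp Fm U) {x₀ : Euc (k + 1)}
    (hx₀ : x₀ ∈ S ∩ Ω) :
    ∃ (Φ : Frame k) (G : Euc k → ℝ) (A B : Euc (k + 1) → Mat m (k + 1)),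
      IsJumpChart Φ G S y x₀ (ν x₀) (Fp x₀) (Fm x₀) ∧
      ∀ᶠ x in 𝓝 x₀, DifferentiableAt ℝ G (Φ.base x) ∧ (∀ᶠ z in 𝓝 x, (z ∈ S ↔ Φ.above G z = 0)) ∧
        x ∈ Ω ∧ (x ∈ S →
          ((ν x = Φ.normal G (Φ.base x) ∧ Fp x = A x ∧ Fm x = B x) ∨
            (ν x = -Φ.normal G (Φ.base x) ∧ Fp x = B x ∧ Fm x = A x)) ∧
          Tendsto (fun t : ℝ => fderiv ℝ y (x + t • Φ.axis)) (𝓝[>] 0) (𝓝 (A x)) ∧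
          Tendsto (fun t : ℝ => fderiv ℝ y (x + t • (-Φ.axis))) (𝓝[>] 0) (𝓝 (B x))) := by
  obtain ⟨Φ, G, hc⟩ := (h.jump x₀ hx₀).exists_chart
  -- Stated as an implication so that the limits can be selected at every point; the default value 0
  -- is taken where none exist.
  have hsk : ∀ x, ∃ A B, (∃ A B : Mat m (k + 1),
      ((ν x = Φ.normal G (Φ.base x) ∧ Fp x = A ∧ Fm x = B) ∨
        (ν x = -Φ.normal G (Φ.base x) ∧ Fp x = B ∧ Fm x = A)) ∧
      Tendsto (fun t : ℝ => fderiv ℝ y (x + t • Φ.axis)) (𝓝[>] 0) (𝓝 A) ∧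
      Tendsto (fun t : ℝ => fderiv ℝ y (x + t • (-Φ.axis))) (𝓝[>] 0) (𝓝 B)) →
      ((ν x = Φ.normal G (Φ.base x) ∧ Fp x = A ∧ Fm x = B) ∨
        (ν x = -Φ.normal G (Φ.base x) ∧ Fp x = B ∧ Fm x = A)) ∧
      Tendsto (fun t : ℝ => fderiv ℝ y (x + t • Φ.axis)) (𝓝[>] 0) (𝓝 A) ∧
      Tendsto (fun t : ℝ => fderiv ℝ y (x + t • (-Φ.axis))) (𝓝[>] 0) (𝓝 B) := by
    intro x
    by_cases hx : ∃ A B : Mat m (k + 1),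
      ((ν x = Φ.normal G (Φ.base x) ∧ Fp x = A ∧ Fm x = B) ∨
        (ν x = -Φ.normal G (Φ.base x) ∧ Fp x = B ∧ Fm x = A)) ∧
      Tendsto (fun t : ℝ => fderiv ℝ y (x + t • Φ.axis)) (𝓝[>] 0) (𝓝 A) ∧
      Tendsto (fun t : ℝ => fderiv ℝ y (x + t • (-Φ.axis))) (𝓝[>] 0) (𝓝 B)
    · obtain ⟨A, B, hAB⟩ := hx
      exact ⟨A, B, fun _ => hAB⟩
    · exact ⟨0, 0, fun h => absurd h hx⟩
  choose A B hAB using hsk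
  refine ⟨Φ, G, A, B, hc, ?_⟩
  have hd : ∀ᶠ x in 𝓝 x₀, DifferentiableAt ℝ G (Φ.base x) := by
    have := hc.contDiffAt.eventually (by simp)
    exact ((Φ.base.continuous.tendsto x₀).eventually this).mono fun x hx =>
      hx.differentiableAt one_ne_zero
  filter_upwards [hd, eventually_eventually_nhds.2 hc.mem_iff, h.isOpen.mem_nhds hx₀.2]
    with x h1 h2 h3
  refine ⟨h1, h2, h3, fun hxS => hAB x ?_⟩
  obtain ⟨Ψ, H, hc'⟩ := (h.jump x ⟨hxS, h3⟩).exists_chart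
  exact IsJumpChart.limits_at hxS h1 h2 hc'

/-- The jump of the normal flux does not depend on the choice of the normal. -/
theorem normalJump_eq {x n : Euc (k + 1)} {A B : Mat m (k + 1)}
    (hx : (ν x = n ∧ Fp x = A ∧ Fm x = B) ∨ (ν x = -n ∧ Fp x = B ∧ Fm x = A)) :
    normalJump J y ν Fp Fm x = J (x, y x, A) (innerSL ℝ n) - J (x, y x, B) (innerSL ℝ n) := by
  rcases hx with ⟨h1, h2, h3⟩ | ⟨h1, h2, h3⟩
  · rw [normalJump, h1, h2, h3]
  · rw [normalJump, h1, h2, h3, map_neg, map_neg, map_neg]; ring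

/-- The normal is prescribed pointwise and may switch sides from point to point, so `ν`, `Fp` and
`Fm` need not be continuous. The limits `A` and `B`, labelled by the sides of a fixed chart, are
continuous at its centre, and the normal jump does not change when the sides are switched. -/
theorem continuousOn_normalJump (h : JumpSetting Ω S y ν Fp Fm U) (hJ : IsFlux U J) :
    ContinuousOn (normalJump J y ν Fp Fm) (S ∩ Ω) := by
  intro x₀ hx₀
  obtain ⟨Φ, G, A, B, hc, hev⟩ := h.exists_chart_limits hx₀
  have hevS : ∀ᶠ x in 𝓝[S ∩ Ω] x₀, _ := hev.filter_mono nhdsWithin_le_nhds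
  have hSm : ∀ᶠ x in 𝓝[S ∩ Ω] x₀, x ∈ S ∩ Ω := self_mem_nhdsWithin
  have hA : Tendsto A (𝓝[S ∩ Ω] x₀) (𝓝 (Fp x₀)) := by
    refine tendsto_of_ray_limits (u := Φ.axis) hc.tendsto_pos ?_ ?_
    · filter_upwards [hevS, hSm] with x h1 h2 using (h1.2.2.2 h2.1).2.1
    · filter_upwards [hevS, hSm] with x h1 h2
      exact Frame.eventually_above_pos h1.1 (h1.2.1.self_of_nhds.1 h2.1) (by simp)
  have hB : Tendsto B (𝓝[S ∩ Ω] x₀) (𝓝 (Fm x₀)) := by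
    refine tendsto_of_ray_limits (u := -Φ.axis) hc.tendsto_neg ?_ ?_
    · filter_upwards [hevS, hSm] with x h1 h2 using (h1.2.2.2 h2.1).2.2
    · filter_upwards [hevS, hSm] with x h1 h2
      exact Frame.eventually_above_neg h1.1 (h1.2.1.self_of_nhds.1 h2.1) (by simp)
  have hn : Tendsto (fun x => innerSL ℝ (Φ.normal G (Φ.base x))) (𝓝[S ∩ Ω] x₀)
      (𝓝 (innerSL ℝ (ν x₀))) := by
    rw [hc.normal_eq]
    refine ((innerSL ℝ).continuous.tendsto _).comp ?_
    exact ((Φ.continuousAt_normal hc.contDiffAt).tendsto.comp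
      (Φ.base.continuous.tendsto x₀)).mono_left nhdsWithin_le_nhds
  have hid : Tendsto (fun x : Euc (k + 1) => x) (𝓝[S ∩ Ω] x₀) (𝓝 x₀) := nhdsWithin_le_nhds
  have hy : Tendsto y (𝓝[S ∩ Ω] x₀) (𝓝 (y x₀)) :=
    (h.continuousAt hx₀.2).tendsto.mono_left nhdsWithin_le_nhds
  have hr := h.mem_range_pos_neg hx₀
  have hlim := (hJ.tendsto h.isOpen_range (h.range_subset hr.1)
      (hid.prodMk_nhds (hy.prodMk_nhds hA)) hn).sub
    (hJ.tendsto h.isOpen_range (h.range_subset hr.2) (hid.prodMk_nhds (hy.prodMk_nhds hB)) hn)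
  refine hlim.congr' ?_
  filter_upwards [hevS, hSm] with x h1 h2
  exact (normalJump_eq (h1.2.2.2 h2.1).1).symm

theorem exists_normalJump_bound (h : JumpSetting Ω S y ν Fp Fm U) (hJ : IsFlux U J) :
    ∃ C, ∀ x ∈ S ∩ Ω, |normalJump J y ν Fp Fm x| ≤ C := by
  obtain ⟨C, _, hC⟩ := h.exists_flux_bound hJ
  refine ⟨C + C, fun x hx => ?_⟩
  have hr := h.mem_range_pos_neg hx
  have h1 := hC _ hr.1 (innerSL ℝ (ν x))
  have h2 := hC _ hr.2 (innerSL ℝ (ν x))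
  rw [innerSL_apply_norm, h.norm_normal hx, mul_one] at h1 h2
  exact (abs_sub _ _).trans (add_le_add h1 h2)

theorem isFiniteMeasure_surface (h : JumpSetting Ω S y ν Fp Fm U) :
    IsFiniteMeasure (μHE[k].restrict (S ∩ Ω)) :=
  ⟨by rw [Measure.restrict_apply_univ]; exact (measure_mono inter_subset_left).trans_lt h.area⟩

theorem integrableOn_normalJump (h : JumpSetting Ω S y ν Fp Fm U) (hJ : IsFlux U J) :
    IntegrableOn (normalJump J y ν Fp Fm) (S ∩ Ω) μHE[k] := by
  obtain ⟨C, hC⟩ := h.exists_normalJump_bound hJ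
  have := h.isFiniteMeasure_surface
  exact ⟨(h.continuousOn_normalJump hJ).aestronglyMeasurable h.measurableSet_inter,
    HasFiniteIntegral.of_bounded (ae_restrict_of_forall_mem h.measurableSet_inter hC)⟩

end JumpSetting

end

end Clapeyron

namespace Clapeyron

noncomputable section

/-! ### The weak divergence of a flux across the surface -/

theorem Integrable.mul_continuous_compactSupport {n : ℕ} {μ : Measure (Euc n)} {f η : Euc n → ℝ}
    (hf : Integrable f μ) (hη : Continuous η) (hηc : HasCompactSupport η) :
    Integrable (fun z => f z * η z) μ := by
  obtain ⟨C, hC⟩ := hηc.exists_bound_of_continuous hη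
  exact hf.mul_bdd hη.aestronglyMeasurable (ae_of_all _ hC)

theorem IsBoundedField.integrableOn_fderiv {n : ℕ} {D : Set (Euc n)} {C : ℝ}
    {V : Euc n → StrongDual ℝ (Euc n) →L[ℝ] ℝ} (hV : IsBoundedField D C V) (hD : MeasurableSet D)
    (hfin : volume D < ⊤) {η : Euc n → ℝ} (hη : ContDiff ℝ ∞ η) (hηc : HasCompactSupport η) :
    IntegrableOn (fun z => V z (fderiv ℝ η z)) D := by
  have : Fact (volume D < ⊤) := ⟨hfin⟩
  obtain ⟨C', hC'⟩ := (hηc.fderiv (𝕜 := ℝ)).exists_bound_of_continuous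
    (hη.continuous_fderiv (by simp))
  refine ⟨hV.aestronglyMeasurable _ (measurable_fderiv ℝ η),
    HasFiniteIntegral.of_bounded (C := |C| * C') (ae_restrict_of_forall_mem hD fun z hz => ?_)⟩
  exact (hV.bound z hz _).trans (mul_le_mul (le_abs_self C) (hC' z) (norm_nonneg _) (abs_nonneg _))

theorem fderiv_eq_zero_of_notMem_tsupport {n : ℕ} {X : Type*} [NormedAddCommGroup X]
    [NormedSpace ℝ X] {η : Euc n → X} {z : Euc n} (hz : z ∉ tsupport η) : fderiv ℝ η z = 0 :=
  image_eq_zero_of_notMem_tsupport fun h => hz (tsupport_fderiv_subset ℝ h)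

theorem Frame.flip_axis {k : ℕ} (Φ : Frame k) : Φ.flip.axis = -Φ.axis := by
  rw [Frame.axis, Φ.flip_pt, Frame.axis, ← neg_one_smul ℝ (Φ.pt 0 1), ← Φ.pt_smul]; simp

variable {m k : ℕ} {Ω S : Set (Euc (k + 1))} {y : Euc (k + 1) → Euc m}
  {ν : Euc (k + 1) → Euc (k + 1)} {Fp Fm : Euc (k + 1) → Mat m (k + 1)}
  {U : Set (Phase m (k + 1))} {J : Phase m (k + 1) → StrongDual ℝ (Euc (k + 1)) →L[ℝ] ℝ}

namespace JumpSetting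

theorem tendsto_fluxField_ray (h : JumpSetting Ω S y ν Fp Fm U) (hJ : IsFlux U J) {Φ : Frame k}
    {G : Euc k → ℝ} {x w : Euc (k + 1)} (hx : x ∈ S ∩ Ω) (hG : DifferentiableAt ℝ G (Φ.base x))
    (hS : ∀ᶠ z in 𝓝 x, (z ∈ S ↔ Φ.above G z = 0)) (hw : Φ.conormal G (Φ.base x) w ≠ 0)
    {A : Mat m (k + 1)} (hA : Tendsto (fun t : ℝ => fderiv ℝ y (x + t • w)) (𝓝[>] 0) (𝓝 A))
    (ℓ : StrongDual ℝ (Euc (k + 1))) :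
    Tendsto (fun t : ℝ => fluxField J S y (x + t • w) ℓ) (𝓝[>] 0) (𝓝 (J (x, y x, A) ℓ)) := by
  have h1 := h.tendsto_jet_ray hx.2 hA
  have h2 := h.eventually_ray_mem hx hG hS hw
  have h3 := h.range_subset (h.mem_range_of_tendsto h2 h1)
  refine (hJ.tendsto h.isOpen_range h3 h1 (tendsto_const_nhds (x := ℓ))).congr' ?_
  filter_upwards [h2] with t ht
  rw [fluxField_of_notMem ht.2]

/-- The Gauss-Green formula on one side of the surface, inside the open set `O`. -/
theorem gauss_green_side (h : JumpSetting Ω S y ν Fp Fm U) (hJ : IsFlux U J)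
    {f : Euc (k + 1) → ℝ} (hf : IntegrableOn f Ω)
    (hweak : ∀ φ : Euc (k + 1) → ℝ, ContDiff ℝ ∞ φ → HasCompactSupport φ → tsupport φ ⊆ Ω \ S →
      ∫ z in Ω, fluxField J S y z (fderiv ℝ φ z) = ∫ z in Ω, f z * φ z)
    {Φ : Frame k} {G : Euc k → ℝ} {K : NNReal} (hG : LipschitzWith K G) {O : Set (Euc (k + 1))}
    (hO : IsOpen O) (hOΩ : O ⊆ Ω) (hOS : ∀ z ∈ O, z ∈ S → Φ.above G z = 0)
    {B : Euc (k + 1) → Mat m (k + 1)}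
    (hB : ∀ x, Φ.graph G x ∈ O → ∀ ℓ, Tendsto
      (fun t : ℝ => fluxField J S y (Φ.graph G x + t • (-Φ.axis)) ℓ) (𝓝[>] 0)
      (𝓝 (J (Φ.graph G x, y (Φ.graph G x), B (Φ.graph G x)) ℓ)))
    {η : Euc (k + 1) → ℝ} (hη : ContDiff ℝ ∞ η) (hηc : HasCompactSupport η) (hηO : tsupport η ⊆ O) :
    Integrable (fun x => η (Φ.graph G x) *
      J (Φ.graph G x, y (Φ.graph G x), B (Φ.graph G x)) (Φ.conormal G x)) ∧
    ∫ z in Φ.below G O, fluxField J S y z (fderiv ℝ η z) =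
      (∫ z in Φ.below G O, f z * η z) + ∫ x, η (Φ.graph G x) *
        J (Φ.graph G x, y (Φ.graph G x), B (Φ.graph G x)) (Φ.conormal G x) := by
  obtain ⟨C, hC⟩ := h.exists_isBoundedField hJ
  have hbΩ : Φ.below G O ⊆ Ω := inter_subset_right.trans hOΩ
  refine Φ.gauss_green_below (N := ∅) (Vb := fun x => J (Φ.graph G x, y (Φ.graph G x),
    B (Φ.graph G x))) hG hO ((measure_mono hbΩ).trans_lt h.volume_lt_top) (hC _ hbΩ)
    (hf.mono_set hbΩ) (fun φ hφ hφc hφs => ?_) measure_empty (ae_of_all _ fun x hx ℓ => ?_) hη hηc hηO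
  · have := hweak φ hφ hφc (hφs.trans fun z hz =>
      ⟨hbΩ hz, fun hzS => (show Φ.above G z < 0 from hz.1).ne (hOS z hz.2 hzS)⟩)
    rw [setIntegral_eq_of_subset_of_forall_sdiff_eq_zero h.isOpen.measurableSet hbΩ,
      setIntegral_eq_of_subset_of_forall_sdiff_eq_zero h.isOpen.measurableSet hbΩ] at this
    · exact this
    · intro z hz
      rw [image_eq_zero_of_notMem_tsupport fun hzφ => hz.2 (hφs hzφ), mul_zero]
    · intro z hz
      rw [fderiv_eq_zero_of_notMem_tsupport fun hzφ => hz.2 (hφs hzφ), map_zero]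
  · have h1 : Tendsto (fun s : ℝ => -s) (𝓝[{s | s < 0 ∧ Φ.flat G (x, s) ∉ (∅ : Set _)}] 0)
        (𝓝[>] 0) := by
      have : Tendsto (fun s : ℝ => -s) (𝓝[<] 0) (𝓝[>] 0) := by
        simpa using tendsto_neg_nhdsLT (a := (0 : ℝ))
      exact this.mono_left (nhdsWithin_mono _ fun s hs => hs.1)
    refine ((hB x hx ℓ).comp h1).congr fun s => ?_
    rw [Φ.flat_eq]; simp

/-- The weak divergence of a flux on `Ω` is its divergence off the surface plus the jump of its
normal component on the surface. -/
theorem weak_divergence_eq (h : JumpSetting Ω S y ν Fp Fm U) (hJ : IsFlux U J)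
    {f : Euc (k + 1) → ℝ} (hf : IntegrableOn f Ω)
    (hweak : ∀ φ : Euc (k + 1) → ℝ, ContDiff ℝ ∞ φ → HasCompactSupport φ → tsupport φ ⊆ Ω \ S →
      ∫ z in Ω, fluxField J S y z (fderiv ℝ φ z) = ∫ z in Ω, f z * φ z)
    {η : Euc (k + 1) → ℝ} (hη : ContDiff ℝ ∞ η) (hηc : HasCompactSupport η) (hηΩ : tsupport η ⊆ Ω) :
    ∫ z in Ω, fluxField J S y z (fderiv ℝ η z) =
      (∫ z in Ω, f z * η z) - ∫ z in S ∩ Ω, normalJump J y ν Fp Fm z * η z ∂μHE[k] := by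
  obtain ⟨C, hC⟩ := h.exists_isBoundedField hJ
  have hΩm := h.isOpen.measurableSet
  rw [← sub_eq_zero]
  refine eq_zero_of_locally_eq_zero (Q := Ω) (L := fun η =>
    (∫ z in Ω, fluxField J S y z (fderiv ℝ η z)) - ((∫ z in Ω, f z * η z) -
      ∫ z in S ∩ Ω, normalJump J y ν Fp Fm z * η z ∂μHE[k])) ?_ ?_ hη hηc hηΩ
  · intro φ₁ φ₂ h1 c1 h2 c2 _ _
    have e1 : ∀ z, fderiv ℝ (fun x => φ₁ x + φ₂ x) z = fderiv ℝ φ₁ z + fderiv ℝ φ₂ z := fun z =>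
      fderiv_fun_add (h1.differentiable (by simp) z) (h2.differentiable (by simp) z)
    simp only [e1, map_add, mul_add]
    rw [integral_add ((hC Ω Subset.rfl).integrableOn_fderiv hΩm h.volume_lt_top h1 c1)
        ((hC Ω Subset.rfl).integrableOn_fderiv hΩm h.volume_lt_top h2 c2),
      integral_add (Integrable.mul_continuous_compactSupport hf h1.continuous c1)
        (Integrable.mul_continuous_compactSupport hf h2.continuous c2),
      integral_add (Integrable.mul_continuous_compactSupport (h.integrableOn_normalJump hJ)
          h1.continuous c1)
        (Integrable.mul_continuous_compactSupport (h.integrableOn_normalJump hJ) h2.continuous c2)]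
    ring
  intro x₀ hx₀
  by_cases hx₀S : x₀ ∈ S
  swap
  · refine ⟨Ω \ S, h.isOpen_diff, ⟨hx₀, hx₀S⟩, fun φ hφ hφc hφs _ => ?_⟩
    have h0 : ∫ z in S ∩ Ω, normalJump J y ν Fp Fm z * φ z ∂μHE[k] = 0 := by
      refine setIntegral_eq_zero_of_forall_eq_zero fun z hz => ?_
      rw [image_eq_zero_of_notMem_tsupport fun hzφ => (hφs hzφ).2 hz.1, mul_zero]
    rw [hweak φ hφ hφc hφs, h0, sub_zero, sub_self]
  obtain ⟨Φ, G, A, B, hc, hev⟩ := h.exists_chart_limits ⟨hx₀S, hx₀⟩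
  obtain ⟨K, hK⟩ := hc.lipschitz
  obtain ⟨O, hOs, hO, hx₀O⟩ := _root_.eventually_nhds_iff.1 hev
  refine ⟨O, hO, hx₀O, fun φ hφ hφc hφs _ => ?_⟩
  have hOΩ : O ⊆ Ω := fun z hz => (hOs z hz).2.2.1
  have hOS : ∀ z ∈ O, (z ∈ S ↔ Φ.above G z = 0) := fun z hz => (hOs z hz).2.1.self_of_nhds
  have hgS : ∀ x, Φ.graph G x ∈ O → Φ.graph G x ∈ S ∩ Ω := fun x hx =>
    ⟨(hOS _ hx).2 (Φ.above_graph G x), hOΩ hx⟩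
  -- Gauss-Green is applied below the graph with limits `B` and, in the flipped frame, above it with
  -- limits `A`. The outward conormals are opposite, so the two boundary terms add up to minus the
  -- jump.
  have low := h.gauss_green_side hJ hf hweak hK hO hOΩ (fun z hz => (hOS z hz).1) (B := B)
    (fun x hx ℓ => h.tendsto_fluxField_ray hJ (hgS x hx) (hOs _ hx).1 (hOs _ hx).2.1 (by simp)
      ((hOs _ hx).2.2.2 (hgS x hx).1).2.2 ℓ) hφ hφc hφs
  have upp := h.gauss_green_side hJ hf hweak (Φ := Φ.flip) hK.neg hO hOΩ
    (fun z hz hzS => by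
      have := Φ.flip_above (G := G) z
      rw [(hOS z hz).1 hzS, neg_zero] at this
      exact this) (B := A)
    (fun x hx ℓ => by
      have e := Φ.flip_graph (G := G) x
      change Φ.flip.graph (fun x => -G x) x ∈ O at hx
      change Tendsto (fun t : ℝ => fluxField J S y (Φ.flip.graph (fun x => -G x) x +
        t • (-Φ.flip.axis)) ℓ) _ (𝓝 (J (Φ.flip.graph (fun x => -G x) x,
          y (Φ.flip.graph (fun x => -G x) x), A (Φ.flip.graph (fun x => -G x) x)) ℓ))
      rw [e] at hx ⊢
      rw [Φ.flip_axis, neg_neg]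
      exact h.tendsto_fluxField_ray hJ (hgS x hx) (hOs _ hx).1 (hOs _ hx).2.1 (by simp)
        ((hOs _ hx).2.2.2 (hgS x hx).1).2.1 ℓ) hφ hφc hφs
  have hneg : (-G) = fun x => -G x := rfl
  simp only [hneg, Φ.flip_graph, Φ.flip_conormal] at upp
  have hbm : MeasurableSet (Φ.below G O) := (Φ.isOpen_below hK.continuous hO).measurableSet
  have hbm' : MeasurableSet (Φ.flip.below (fun x => -G x) O) :=
    (Φ.flip.isOpen_below hK.neg.continuous hO).measurableSet
  have hdisj : Disjoint (Φ.below G O) (Φ.flip.below (fun x => -G x) O) := by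
    refine disjoint_left.2 fun z hz hz' => ?_
    have h1 : Φ.above G z < 0 := hz.1
    have h2 : Φ.flip.above (fun x => -G x) z < 0 := hz'.1
    rw [Φ.flip_above] at h2; linarith
  have hsub : Φ.below G O ∪ Φ.flip.below (fun x => -G x) O ⊆ Ω :=
    union_subset (inter_subset_right.trans hOΩ) (inter_subset_right.trans hOΩ)
  -- Within `O` the two sides miss only the surface itself, which has volume zero.
  have hsplit : ∀ F : Euc (k + 1) → ℝ, IntegrableOn F Ω → (∀ z, z ∉ tsupport φ → F z = 0) →
      ∫ z in Ω, F z = (∫ z in Φ.below G O, F z) + ∫ z in Φ.flip.below (fun x => -G x) O, F z := by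
    intro F hF hF0
    rw [← setIntegral_union hdisj hbm' (hF.mono_set (inter_subset_right.trans hOΩ))
      (hF.mono_set (inter_subset_right.trans hOΩ))]
    refine setIntegral_eq_of_subset_of_ae_sdiff_eq_zero hΩm.nullMeasurableSet hsub ?_
    filter_upwards [h.ae_notMem] with z hzS hz
    refine hF0 z fun hzφ => hz.2 ?_
    have hzO := hφs hzφ
    rcases lt_trichotomy (Φ.above G z) 0 with h0 | h0 | h0
    · exact Or.inl ⟨h0, hzO⟩
    · exact absurd ((hOS z hzO).2 h0) hzS
    · refine Or.inr ⟨?_, hzO⟩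
      change Φ.flip.above (fun x => -G x) z < 0
      rw [Φ.flip_above]; linarith
  have hsurf : ∫ z in S ∩ Ω, normalJump J y ν Fp Fm z * φ z ∂μHE[k] =
      -((∫ x, φ (Φ.graph G x) *
        J (Φ.graph G x, y (Φ.graph G x), B (Φ.graph G x)) (Φ.conormal G x)) +
      ∫ x, φ (Φ.graph G x) *
        J (Φ.graph G x, y (Φ.graph G x), A (Φ.graph G x)) (-Φ.conormal G x)) := by
    have e1 : range (Φ.graph G) ∩ O ⊆ S ∩ Ω := by
      rintro _ ⟨⟨x, rfl⟩, hx⟩; exact hgS x hx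
    rw [setIntegral_eq_of_subset_of_forall_sdiff_eq_zero h.measurableSet_inter e1,
      Φ.setIntegral_graph hK _ hO.measurableSet, setIntegral_eq_integral_of_forall_compl_eq_zero,
      ← integral_add low.1 upp.1, ← integral_neg]
    · refine integral_congr_ae (ae_of_all _ fun x => ?_)
      by_cases hx : Φ.graph G x ∈ O
      · have := normalJump_eq (y := y) (J := J) ((hOs _ hx).2.2.2 (hgS x hx).1).1
        simp only [this, Φ.conormal_eq_smul, Φ.base_graph, map_neg, map_smul, smul_eq_mul]
        ring
      · have h0 : φ (Φ.graph G x) = 0 := image_eq_zero_of_notMem_tsupport fun hz => hx (hφs hz)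
        simp [h0]
    · intro x hx
      rw [image_eq_zero_of_notMem_tsupport fun hz => hx (hφs hz), mul_zero, mul_zero]
    · intro z hz
      have : z ∉ tsupport φ := fun hzφ => hz.2 ⟨by
        rw [Φ.range_graph]; exact (hOS z (hφs hzφ)).1 hz.1.1, hφs hzφ⟩
      rw [image_eq_zero_of_notMem_tsupport this, mul_zero]
  rw [hsplit _ ((hC Ω Subset.rfl).integrableOn_fderiv hΩm h.volume_lt_top hφ hφc) fun z hz => by
      rw [fderiv_eq_zero_of_notMem_tsupport hz, map_zero],
    hsplit _ (Integrable.mul_continuous_compactSupport hf hφ.continuous hφc) fun z hz => by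
      rw [image_eq_zero_of_notMem_tsupport hz, mul_zero], low.2, upp.2, hsurf]
  ring

/-- Fundamental lemma of the calculus of variations on the surface. -/
theorem eq_zero_of_forall_setIntegral_mul_eq_zero (h : JumpSetting Ω S y ν Fp Fm U)
    {τ : Euc (k + 1) → ℝ} (hτ : ContinuousOn τ (S ∩ Ω)) (hτi : IntegrableOn τ (S ∩ Ω) μHE[k])
    (h0 : ∀ φ : Euc (k + 1) → ℝ, ContDiff ℝ ∞ φ → HasCompactSupport φ → tsupport φ ⊆ Ω →
      ∫ z in S ∩ Ω, τ z * φ z ∂μHE[k] = 0) : ∀ x ∈ S ∩ Ω, τ x = 0 := by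
  intro x₀ hx₀
  by_contra hne
  have := h.isFiniteMeasure_surface
  obtain ⟨Φ, G, A, B, hc, hev⟩ := h.exists_chart_limits hx₀
  obtain ⟨K, hK⟩ := hc.lipschitz
  -- Multiplication by `τ x₀` treats both signs at once: the product with a bump is nonnegative and
  -- has integral zero, so it vanishes almost everywhere on the surface.
  have hcont : ∀ᶠ z in 𝓝 x₀, z ∈ S ∩ Ω → τ x₀ ^ 2 / 2 < τ x₀ * τ z := by
    have h1 : Tendsto (fun z => τ x₀ * τ z) (𝓝[S ∩ Ω] x₀) (𝓝 (τ x₀ * τ x₀)) :=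
      tendsto_const_nhds.mul (hτ x₀ hx₀)
    have h2 : τ x₀ ^ 2 / 2 < τ x₀ * τ x₀ := by
      have : 0 < τ x₀ ^ 2 := by positivity
      nlinarith
    exact eventually_nhdsWithin_iff.1 (h1.eventually (lt_mem_nhds h2))
  obtain ⟨r, hr, hball⟩ := Metric.eventually_nhds_iff_ball.1 (hev.and hcont)
  set b : ContDiffBump x₀ := ⟨r / 4, r / 2, by positivity, by linarith⟩
  have hts : tsupport b ⊆ Metric.ball x₀ r := by
    rw [b.tsupport_eq]; exact Metric.closedBall_subset_ball (half_lt_self hr)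
  have hz := h0 b b.contDiff b.hasCompactSupport
    (hts.trans fun z hz => (hball z hz).1.2.2.1)
  have hnn : ∀ z ∈ S ∩ Ω, 0 ≤ τ x₀ * (τ z * b z) := fun z hz => by
    by_cases hzb : z ∈ Metric.ball x₀ r
    · rw [← mul_assoc]
      exact mul_nonneg ((by positivity : 0 ≤ τ x₀ ^ 2 / 2).trans ((hball z hzb).2 hz).le) b.nonneg
    · rw [image_eq_zero_of_notMem_tsupport fun h => hzb (hts h), mul_zero, mul_zero]
  have hint : ∫ z in S ∩ Ω, τ x₀ * (τ z * b z) ∂μHE[k] = 0 := by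
    rw [integral_const_mul, hz, mul_zero]
  rw [integral_eq_zero_iff_of_nonneg_ae (ae_restrict_of_forall_mem h.measurableSet_inter hnn)
    ((Integrable.mul_continuous_compactSupport hτi b.continuous b.hasCompactSupport).const_mul _)]
    at hint
  have hnull := (ae_restrict_iff' h.measurableSet_inter).1 hint
  set s : Set (Euc k) := Φ.graph G ⁻¹' Metric.ball x₀ (r / 4) with hs
  have hso : IsOpen s := Metric.isOpen_ball.preimage (Φ.continuous_graph hK.continuous)
  have hne' : s.Nonempty := ⟨Φ.base x₀, by
    rw [hs, mem_preimage, Φ.graph_base G (hc.above_eq_zero hx₀.1)]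
    exact Metric.mem_ball_self (by positivity)⟩
  have hzero : μHE[k] (Φ.graph G '' s) = 0 := by
    refine measure_mono_null ?_ (ae_iff.1 hnull)
    rintro _ ⟨x, hx, rfl⟩
    have hxr := Metric.ball_subset_ball (by linarith : r / 4 ≤ r) hx
    have hxS : Φ.graph G x ∈ S ∩ Ω :=
      ⟨(hball _ hxr).1.2.1.self_of_nhds.2 (Φ.above_graph G x), (hball _ hxr).1.2.2.1⟩
    refine fun hall => (?_ : (0 : ℝ) < τ x₀ * (τ (Φ.graph G x) * b (Φ.graph G x))).ne' (hall hxS)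
    rw [← mul_assoc]
    refine mul_pos ((by positivity : 0 ≤ τ x₀ ^ 2 / 2).trans_lt ((hball _ hxr).2 hxS))
      (b.pos_of_mem_ball (Metric.ball_subset_ball ?_ hx))
    change r / 4 ≤ r / 2
    linarith
  rw [Φ.euclideanHausdorffMeasure_graph_image hK hso.measurableSet] at hzero
  -- The area of a graph is at least the volume of its parameter set, so the patch on which the bump
  -- is positive cannot be null.
  have hle : volume s ≤ ∫⁻ x in s, ENNReal.ofReal (graphJac (fderiv ℝ G x)) := by
    rw [← setLIntegral_one]
    refine lintegral_mono fun x => ?_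
    rw [← ENNReal.ofReal_one]
    exact ENNReal.ofReal_le_ofReal (one_le_graphJac _)
  exact (hso.measure_pos volume hne').ne' (le_antisymm (hle.trans hzero.le) bot_le)

end JumpSetting

end

end Clapeyron

namespace Clapeyron

noncomputable section

/-! ### Lipschitz boundaries -/

variable {k : ℕ} {Ω : Set (Euc (k + 1))} {Φ : Frame k} {G : Euc k → ℝ} {K : NNReal}

theorem HasLipschitzBoundary.exists_chart (h : HasLipschitzBoundary Ω) {x : Euc (k + 1)}
    (hx : x ∈ frontier Ω) : ∃ (Φ : Frame k) (G : Euc k → ℝ) (K : NNReal) (O : Set (Euc (k + 1))),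
      LipschitzWith K G ∧ IsOpen O ∧ x ∈ O ∧ ∀ z ∈ O, (z ∈ Ω ↔ Φ.above G z < 0) := by
  obtain ⟨e, g, K, he, hg, hev⟩ := h x hx
  obtain ⟨Φ, rfl⟩ := Frame.exists_axis_eq he
  rw [Φ.heightAbove_eq_above] at hev
  obtain ⟨O, h1, h2, h3⟩ := _root_.eventually_nhds_iff.1 hev
  refine ⟨Φ, _, K, O, ?_, h2, h3, h1⟩
  refine LipschitzWith.of_dist_le_mul fun a b => (hg.dist_le_mul _ _).trans_eq ?_
  congr 1
  have h4 := Φ.norm_pt_sq (a - b) 0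
  have h5 : Φ.pt (a - b) 0 = Φ.pt a 0 - Φ.pt b 0 := by
    rw [eq_sub_iff_add_eq, ← Φ.pt_add]; simp
  rw [h5] at h4
  rw [dist_eq_norm, dist_eq_norm]
  refine (sq_eq_sq₀ (norm_nonneg _) (norm_nonneg _)).1 ?_
  simpa using h4

namespace Frame

theorem mem_frontier_iff (hG : LipschitzWith K G) (hΩ : IsOpen Ω) {O : Set (Euc (k + 1))}
    (hO : IsOpen O) (hOΩ : ∀ z ∈ O, (z ∈ Ω ↔ Φ.above G z < 0)) {z : Euc (k + 1)} (hz : z ∈ O) :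
    z ∈ frontier Ω ↔ Φ.above G z = 0 := by
  rw [hΩ.frontier_eq]
  constructor
  · rintro ⟨h1, h2⟩
    refine le_antisymm ?_ (not_lt.1 fun h => h2 ((hOΩ z hz).2 h))
    refine not_lt.1 fun hpos => ?_
    have hW : IsOpen (O ∩ {w | 0 < Φ.above G w}) :=
      hO.inter (isOpen_lt continuous_const (Φ.continuous_above hG.continuous))
    obtain ⟨w, hw, hwΩ⟩ := mem_closure_iff.1 h1 _ hW ⟨hz, hpos⟩
    exact lt_asymm hw.2 ((hOΩ w hw.1).1 hwΩ)
  · intro h0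
    refine ⟨?_, fun h => ((hOΩ z hz).1 h).ne h0⟩
    obtain ⟨x, rfl⟩ : z ∈ range (Φ.graph G) := by rw [range_graph]; exact h0
    have h1 := Φ.flat_mem_below hG.continuous hO hz
    have h2 : Tendsto (fun s => Φ.flat G (x, s)) (𝓝[<] 0) (𝓝 (Φ.graph G x)) := by
      have : Tendsto (fun s => Φ.flat G (x, s)) (𝓝 0) (𝓝 (Φ.flat G (x, 0))) :=
        ((Φ.continuous_flat hG.continuous).comp (by fun_prop :
          Continuous fun s : ℝ => (x, s))).tendsto 0
      rw [flat_zero] at this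
      exact this.mono_left nhdsWithin_le_nhds
    exact mem_closure_of_tendsto h2 (h1.mono fun s hs => (hOΩ _ hs.2).2 hs.1)

/-- Differentiability makes the height above the graph equal to `graphJac` times ⟨n, z - x⟩ up to an
error ε|z - x|. As `graphJac` is at least 1, the error cannot change the sign inside the cones of
the definition. -/
theorem isOutwardUnitNormal {O : Set (Euc (k + 1))}
    (hO : IsOpen O) (hOΩ : ∀ z ∈ O, (z ∈ Ω ↔ Φ.above G z < 0)) {x : Euc k}
    (hx : Φ.graph G x ∈ O) (hd : DifferentiableAt ℝ G x) :
    IsOutwardUnitNormal Ω (Φ.graph G x) (Φ.normal G x) := by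
  refine ⟨Φ.norm_normal G x, fun ε hε => ?_⟩
  have hd' : DifferentiableAt ℝ G (Φ.base (Φ.graph G x)) := by rwa [Φ.base_graph]
  have h1 := (Φ.hasFDerivAt_above hd').isLittleO
  rw [Φ.base_graph, Φ.above_graph] at h1
  have hJ := one_le_graphJac (fderiv ℝ G x)
  filter_upwards [h1.bound hε, hO.mem_nhds hx] with z hz hzO
  rw [Φ.conormal_eq_inner, sub_zero, Real.norm_eq_abs, abs_le] at hz
  set a := inner ℝ (Φ.normal G x) (z - Φ.graph G x)
  set d := ‖z - Φ.graph G x‖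
  have hd0 : 0 ≤ ε * d := mul_nonneg hε.le (norm_nonneg _)
  constructor
  · intro ha
    refine (hOΩ z hzO).2 ?_
    nlinarith [hz.2]
  · intro ha hzΩ
    have := (hOΩ z hzO).1 hzΩ
    nlinarith [hz.1]

theorem outwardNormal_graph {O : Set (Euc (k + 1))}
    (hO : IsOpen O) (hOΩ : ∀ z ∈ O, (z ∈ Ω ↔ Φ.above G z < 0)) {x : Euc k}
    (hx : Φ.graph G x ∈ O) (hd : DifferentiableAt ℝ G x) :
    outwardNormal Ω (Φ.graph G x) = Φ.normal G x := by
  have h := isOutwardUnitNormal hO hOΩ hx hd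
  have hex : ∃ n, IsOutwardUnitNormal Ω (Φ.graph G x) n := ⟨_, h⟩
  rw [outwardNormal, dif_pos hex]
  exact hex.choose_spec.unique h

/-- Below a point of a `K`-Lipschitz graph, the truncated open cone {height < -K|base|} lies in Ω.
It is convex with nonempty interior and has the point in its closure, which determines derivatives
there. -/
theorem uniqueDiffWithinAt_of_chart (hG : LipschitzWith K G) {O : Set (Euc (k + 1))}
    (hO : IsOpen O) (hOΩ : ∀ z ∈ O, (z ∈ Ω ↔ Φ.above G z < 0)) {z : Euc (k + 1)} (hz : z ∈ O)
    (h0 : Φ.above G z = 0) : UniqueDiffWithinAt ℝ Ω z := by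
  obtain ⟨r, hr, hrO⟩ := Metric.isOpen_iff.1 hO z hz
  set c : Euc (k + 1) → ℝ := fun w => Φ.height (w - z) + K * ‖Φ.base (w - z)‖ with hc
  have hcc : Continuous c := by fun_prop
  set C : Set (Euc (k + 1)) := {w | c w < 0} ∩ Metric.ball z r with hC
  have hCo : IsOpen C := (isOpen_lt hcc continuous_const).inter Metric.isOpen_ball
  have hconv : Convex ℝ C := by
    refine Convex.inter ?_ (convex_ball z r)
    intro a ha b hb s t hs ht hst
    have ha' : c a < 0 := ha
    have hb' : c b < 0 := hb
    have e : s • a + t • b - z = s • (a - z) + t • (b - z) := by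
      have : z = (s + t) • z := by rw [hst, one_smul]
      nth_rewrite 1 [this]
      module
    have e1 : c (s • a + t • b) ≤ s * c a + t * c b := by
      simp only [hc, e, map_add, map_smul, smul_eq_mul]
      have h1 := norm_add_le (s • Φ.base (a - z)) (t • Φ.base (b - z))
      rw [norm_smul, norm_smul, Real.norm_of_nonneg hs, Real.norm_of_nonneg ht] at h1
      have h2 := mul_le_mul_of_nonneg_left h1 K.2
      simp only [NNReal.val_eq_coe] at h2
      nlinarith
    have e2 : s * c a + t * c b < 0 := by
      rcases hs.eq_or_lt with hs0 | hs0
      · have ht1 : t = 1 := by linarith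
        rw [← hs0, ht1]; linarith
      · nlinarith [mul_neg_of_pos_of_neg hs0 ha', mul_nonpos_of_nonneg_of_nonpos ht hb'.le]
    exact e1.trans_lt e2
  have hray : Tendsto (fun t : ℝ => z + t • (-Φ.axis)) (𝓝[>] 0) (𝓝 z) := tendsto_ray z _
  have hmem : ∀ᶠ t : ℝ in 𝓝[>] 0, z + t • (-Φ.axis) ∈ C := by
    filter_upwards [hray.eventually (Metric.ball_mem_nhds z hr), self_mem_nhdsWithin]
      with t h1 (ht : 0 < t)
    refine ⟨?_, h1⟩
    simp [hc, ht]
  have hzC : z ∈ closure C := mem_closure_of_tendsto hray hmem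
  have hne : (interior C).Nonempty := by
    rw [hCo.interior_eq]
    exact ⟨_, hmem.exists.choose_spec⟩
  refine (uniqueDiffWithinAt_convex hconv hne hzC).mono fun w hw => ?_
  refine (hOΩ w (hrO hw.2)).2 ?_
  have h1 : c w < 0 := hw.1
  have h2 := hG.dist_le_mul (Φ.base w) (Φ.base z)
  rw [Real.dist_eq, dist_eq_norm, ← map_sub] at h2
  have h3 := (abs_le.1 h2).1
  simp only [hc, map_sub] at h1 h3
  simp only [above] at h0 ⊢
  linarith

theorem integrableOn_graph_iff (hG : LipschitzWith K G) (f : Euc (k + 1) → ℝ)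
    {A : Set (Euc (k + 1))} (hA : MeasurableSet A) :
    IntegrableOn f (range (Φ.graph G) ∩ A) μHE[k] ↔
      IntegrableOn (fun x => graphJac (fderiv ℝ G x) * f (Φ.graph G x)) (Φ.graph G ⁻¹' A) := by
  have hemb := Φ.measurableEmbedding_graph hG.continuous
  rw [IntegrableOn, inter_comm, ← Measure.restrict_restrict hA, ← Φ.map_graph_withDensity hG,
    ← IntegrableOn, hemb.integrableOn_map_iff, IntegrableOn,
    restrict_withDensity (hemb.measurable hA),
    integrable_withDensity_iff_integrable_smul' (measurable_graphJac_fderiv G)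
      (ae_of_all _ fun x => ENNReal.ofReal_lt_top), IntegrableOn]
  refine integrable_congr (ae_of_all _ fun x => ?_)
  simp only [smul_eq_mul, Function.comp_apply]
  rw [ENNReal.toReal_ofReal (zero_le_one.trans (one_le_graphJac _))]

/-- The Jacobian is at least 1, so parameters of an area-null part of the graph form a null set. -/
theorem ae_graph_notMem (hG : LipschitzWith K G) {N : Set (Euc (k + 1))} (hN : μHE[k] N = 0) :
    ∀ᵐ x, Φ.graph G x ∉ N := by
  have hemb := Φ.measurableEmbedding_graph hG.continuous
  set T := toMeasurable μHE[k] N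
  have hT : MeasurableSet (Φ.graph G ⁻¹' T) := hemb.measurable (measurableSet_toMeasurable _ _)
  have h0 : μHE[k] (Φ.graph G '' (Φ.graph G ⁻¹' T)) = 0 :=
    measure_mono_null (image_preimage_subset _ _) ((measure_toMeasurable N).trans hN)
  rw [Φ.euclideanHausdorffMeasure_graph_image hG hT] at h0
  have hle : volume (Φ.graph G ⁻¹' T) ≤
      ∫⁻ x in Φ.graph G ⁻¹' T, ENNReal.ofReal (graphJac (fderiv ℝ G x)) := by
    rw [← setLIntegral_one]
    refine lintegral_mono fun x => ?_
    rw [← ENNReal.ofReal_one]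
    exact ENNReal.ofReal_le_ofReal (one_le_graphJac _)
  have h1 : volume (Φ.graph G ⁻¹' T) = 0 := le_antisymm (hle.trans h0.le) bot_le
  filter_upwards [measure_eq_zero_iff_ae_notMem.1 h1] with x hx hxN
  exact hx (subset_toMeasurable _ _ hxN)

end Frame

/-! ### One-sided jets on the boundary -/

variable {m : ℕ} {S : Set (Euc (k + 1))} {y : Euc (k + 1) → Euc m}
  {ν : Euc (k + 1) → Euc (k + 1)} {Fp Fm : Euc (k + 1) → Mat m (k + 1)}
  {U : Set (Phase m (k + 1))} {J : Phase m (k + 1) → StrongDual ℝ (Euc (k + 1)) →L[ℝ] ℝ}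

/-- A configuration which is `C²` up to the Lipschitz boundary of the domain, off the surface. -/
structure BoundedJumpSetting (Ω S : Set (Euc (k + 1))) (y : Euc (k + 1) → Euc m)
    (ν : Euc (k + 1) → Euc (k + 1)) (Fp Fm : Euc (k + 1) → Mat m (k + 1))
    (U : Set (Phase m (k + 1))) : Prop extends JumpSetting Ω S y ν Fp Fm U where
  lipschitzBoundary : HasLipschitzBoundary Ω
  boundary_null : μHE[k] (S ∩ frontier Ω) = 0
  contDiffOn_closure : ContDiffOn ℝ 2 y (closure Ω \ S)

/-- The jet of `y` up to the boundary of `Ω`. -/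
def closedJet (Ω S : Set (Euc (k + 1))) (y : Euc (k + 1) → Euc m) (z : Euc (k + 1)) :
    Phase m (k + 1) := (z, y z, fderivWithin ℝ y (closure Ω \ S) z)

namespace BoundedJumpSetting

/-- A set of volume zero contains no nonempty open set, so removing it leaves a dense part of Ω. -/
theorem closure_subset_closure_diff (h : BoundedJumpSetting Ω S y ν Fp Fm U) :
    closure Ω ⊆ closure (Ω \ S) := by
  refine closure_minimal (fun z hz => ?_) isClosed_closure
  refine mem_closure_iff.2 fun O hO hzO => ?_
  by_contra hemp
  have hsub : O ∩ Ω ⊆ S := fun w hw => by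
    by_contra hwS
    exact hemp ⟨w, hw.1, hw.2, hwS⟩
  exact ((hO.inter h.isOpen).measure_pos volume ⟨z, hzO, hz⟩).ne'
    (measure_mono_null hsub h.volume_surface)

/-- Makes the derivative within the closure of Ω minus `S` well determined, hence continuous up to
the boundary. The surface does no harm: unique differentiability is insensitive to taking closures,
and Ω lies in the closure of Ω minus `S`. -/
theorem uniqueDiffOn (h : BoundedJumpSetting Ω S y ν Fp Fm U) :
    UniqueDiffOn ℝ (closure Ω \ S) := by
  intro z hz
  have h1 : UniqueDiffWithinAt ℝ Ω z := by
    by_cases hzΩ : z ∈ Ω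
    · exact h.isOpen.uniqueDiffWithinAt hzΩ
    · have hzf : z ∈ frontier Ω := by rw [h.isOpen.frontier_eq]; exact ⟨hz.1, hzΩ⟩
      obtain ⟨Φ, G, K, O, hG, hO, hzO, hOΩ⟩ := h.lipschitzBoundary.exists_chart hzf
      exact Frame.uniqueDiffWithinAt_of_chart hG hO hOΩ hzO
        ((Frame.mem_frontier_iff hG h.isOpen hO hOΩ hzO).1 hzf)
  have h2 : UniqueDiffWithinAt ℝ (closure (Ω \ S)) z :=
    h1.mono (subset_closure.trans h.closure_subset_closure_diff)
  exact (uniqueDiffWithinAt_closure.1 h2).mono (sdiff_subset_sdiff_left subset_closure)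

theorem continuousOn_closedJet (h : BoundedJumpSetting Ω S y ν Fp Fm U) :
    ContinuousOn (closedJet Ω S y) (closure Ω \ S) :=
  continuousOn_id.prodMk (h.contDiffOn_closure.continuousOn.prodMk
    (h.contDiffOn_closure.continuousOn_fderivWithin h.uniqueDiffOn one_le_two))

theorem closedJet_eq (h : BoundedJumpSetting Ω S y ν Fp Fm U) {z : Euc (k + 1)} (hz : z ∈ Ω \ S) :
    closedJet Ω S y z = jet y z := by
  have : closure Ω \ S ∈ 𝓝 z := mem_of_superset (h.isOpen_diff.mem_nhds hz)
    (sdiff_subset_sdiff_left subset_closure)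
  rw [closedJet, fderivWithin_of_mem_nhds this, jet]

theorem tendsto_jet (h : BoundedJumpSetting Ω S y ν Fp Fm U) {z : Euc (k + 1)}
    (hz : z ∈ closure Ω \ S) : Tendsto (jet y) (𝓝[Ω \ S] z) (𝓝 (closedJet Ω S y z)) := by
  refine Tendsto.congr' ?_ ((h.continuousOn_closedJet z hz).mono_left
    (nhdsWithin_mono z (sdiff_subset_sdiff_left subset_closure)))
  filter_upwards [self_mem_nhdsWithin] with w hw using h.closedJet_eq hw

theorem closedJet_mem (h : BoundedJumpSetting Ω S y ν Fp Fm U) {z : Euc (k + 1)}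
    (hz : z ∈ closure Ω \ S) : closedJet Ω S y z ∈ closure (jet y '' (Ω \ S)) := by
  have : (𝓝[Ω \ S] z).NeBot :=
    mem_closure_iff_nhdsWithin_neBot.1 (h.closure_subset_closure_diff hz.1)
  exact h.mem_range_of_tendsto (l := 𝓝[Ω \ S] z) (u := fun w => w) self_mem_nhdsWithin (h.tendsto_jet hz)

end BoundedJumpSetting

end

end Clapeyron

namespace Clapeyron

noncomputable section

/-! ### The Gauss-Green formula on the whole domain -/

variable {m k : ℕ} {Ω S : Set (Euc (k + 1))} {y : Euc (k + 1) → Euc m}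
  {ν : Euc (k + 1) → Euc (k + 1)} {Fp Fm : Euc (k + 1) → Mat m (k + 1)}
  {U : Set (Phase m (k + 1))} {J : Phase m (k + 1) → StrongDual ℝ (Euc (k + 1)) →L[ℝ] ℝ}
  {f : Euc (k + 1) → ℝ}

/-- The normal component of a flux on the boundary of the domain. -/
def boundaryFlux (J : Phase m (k + 1) → StrongDual ℝ (Euc (k + 1)) →L[ℝ] ℝ)
    (Ω S : Set (Euc (k + 1))) (y : Euc (k + 1) → Euc m) (z : Euc (k + 1)) : ℝ :=
  J (closedJet Ω S y z) (innerSL ℝ (outwardNormal Ω z))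

/-- Volume plus surface area. -/
def bulkSurfaceMeasure (Ω S : Set (Euc (k + 1))) : Measure (Euc (k + 1)) :=
  volume + μHE[k].restrict (S ∩ Ω)

open Classical in
/-- The density of the weak divergence of a flux with respect to `bulkSurfaceMeasure`. -/
def divergenceDensity (J : Phase m (k + 1) → StrongDual ℝ (Euc (k + 1)) →L[ℝ] ℝ)
    (S : Set (Euc (k + 1))) (y : Euc (k + 1) → Euc m) (ν : Euc (k + 1) → Euc (k + 1))
    (Fp Fm : Euc (k + 1) → Mat m (k + 1)) (f : Euc (k + 1) → ℝ) (z : Euc (k + 1)) : ℝ :=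
  if z ∈ S then -normalJump J y ν Fp Fm z else f z

namespace JumpSetting

theorem restrict_surface (h : JumpSetting Ω S y ν Fp Fm U) :
    (μHE[k].restrict (S ∩ Ω)).restrict Ω = μHE[k].restrict (S ∩ Ω) := by
  rw [Measure.restrict_restrict h.isOpen.measurableSet, inter_eq_right.2 inter_subset_right]

theorem divergenceDensity_ae_bulk (h : JumpSetting Ω S y ν Fp Fm U) (f : Euc (k + 1) → ℝ) :
    ∀ᵐ z ∂volume.restrict Ω, divergenceDensity J S y ν Fp Fm f z = f z := by
  filter_upwards [ae_restrict_of_ae h.ae_notMem] with z hz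
  exact if_neg hz

theorem divergenceDensity_ae_surface (h : JumpSetting Ω S y ν Fp Fm U) (f : Euc (k + 1) → ℝ) :
    ∀ᵐ z ∂μHE[k].restrict (S ∩ Ω),
      divergenceDensity J S y ν Fp Fm f z = -normalJump J y ν Fp Fm z :=
  ae_restrict_of_forall_mem h.measurableSet_inter fun _ hz => if_pos hz.1

theorem integrableOn_divergenceDensity (h : JumpSetting Ω S y ν Fp Fm U) (hJ : IsFlux U J)
    (hf : IntegrableOn f Ω) :
    IntegrableOn (divergenceDensity J S y ν Fp Fm f) Ω (bulkSurfaceMeasure Ω S) := by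
  rw [bulkSurfaceMeasure, IntegrableOn, Measure.restrict_add, h.restrict_surface,
    integrable_add_measure]
  exact ⟨(integrable_congr (h.divergenceDensity_ae_bulk f)).2 hf,
    (integrable_congr (h.divergenceDensity_ae_surface f)).2 (h.integrableOn_normalJump hJ).neg⟩

theorem setIntegral_divergenceDensity (h : JumpSetting Ω S y ν Fp Fm U) (hJ : IsFlux U J)
    (hf : IntegrableOn f Ω) {φ : Euc (k + 1) → ℝ} (hφ : Continuous φ) (hφc : HasCompactSupport φ) :
    ∫ z in Ω, divergenceDensity J S y ν Fp Fm f z * φ z ∂bulkSurfaceMeasure Ω S =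
      (∫ z in Ω, f z * φ z) - ∫ z in S ∩ Ω, normalJump J y ν Fp Fm z * φ z ∂μHE[k] := by
  have hi := Integrable.mul_continuous_compactSupport (h.integrableOn_divergenceDensity hJ hf) hφ hφc
  rw [bulkSurfaceMeasure, Measure.restrict_add, h.restrict_surface, integrable_add_measure] at hi
  rw [bulkSurfaceMeasure, Measure.restrict_add, h.restrict_surface, integral_add_measure hi.1 hi.2,
    sub_eq_add_neg, ← integral_neg]
  congr 1
  · exact integral_congr_ae ((h.divergenceDensity_ae_bulk (J := J) f).mono fun z hz => by simp only [hz])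
  · exact integral_congr_ae ((h.divergenceDensity_ae_surface (J := J) f).mono fun z hz => by
      simp only [hz, neg_mul])

end JumpSetting

namespace BoundedJumpSetting

variable {Φ : Frame k} {G : Euc k → ℝ} {K : NNReal} {O : Set (Euc (k + 1))}

/-- Only almost everywhere, because the outward normal is identified with the graph normal where `G`
is differentiable. -/
theorem flux_conormal_eq (hG : LipschitzWith K G) (hO : IsOpen O)
    (hOΩ : ∀ z ∈ O, (z ∈ Ω ↔ Φ.above G z < 0)) :
    ∀ᵐ x, Φ.graph G x ∈ O → J (closedJet Ω S y (Φ.graph G x)) (Φ.conormal G x) =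
      graphJac (fderiv ℝ G x) * boundaryFlux J Ω S y (Φ.graph G x) := by
  filter_upwards [hG.ae_differentiableAt (μ := volume)] with x hx hxO
  rw [boundaryFlux, Frame.outwardNormal_graph hO hOΩ hxO hx, Φ.conormal_eq_smul, map_smul,
    smul_eq_mul]

/-- The Gauss-Green formula near a boundary point. -/
theorem gauss_green_chart (h : BoundedJumpSetting Ω S y ν Fp Fm U) (hJ : IsFlux U J)
    (hf : IntegrableOn f Ω)
    (hweak : ∀ φ : Euc (k + 1) → ℝ, ContDiff ℝ ∞ φ → HasCompactSupport φ → tsupport φ ⊆ Ω \ S →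
      ∫ z in Ω, fluxField J S y z (fderiv ℝ φ z) = ∫ z in Ω, f z * φ z)
    (hG : LipschitzWith K G) (hO : IsOpen O) (hOΩ : ∀ z ∈ O, (z ∈ Ω ↔ Φ.above G z < 0))
    {φ : Euc (k + 1) → ℝ} (hφ : ContDiff ℝ ∞ φ) (hφc : HasCompactSupport φ) (hφO : tsupport φ ⊆ O) :
    Integrable (fun x => φ (Φ.graph G x) * J (closedJet Ω S y (Φ.graph G x)) (Φ.conormal G x)) ∧
    ∫ z in Ω, fluxField J S y z (fderiv ℝ φ z) =
      (∫ z in Ω, divergenceDensity J S y ν Fp Fm f z * φ z ∂bulkSurfaceMeasure Ω S) +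
        ∫ x, φ (Φ.graph G x) * J (closedJet Ω S y (Φ.graph G x)) (Φ.conormal G x) := by
  obtain ⟨C, hC⟩ := h.exists_isBoundedField hJ
  have hbΩ : Φ.below G O ⊆ Ω := fun z hz => (hOΩ z hz.2).2 hz.1
  have hΩm := h.isOpen.measurableSet
  have hbulk : ∀ ψ : Euc (k + 1) → ℝ, tsupport ψ ∩ Ω ⊆ Φ.below G O →
      ∫ z in Ω, fluxField J S y z (fderiv ℝ ψ z) =
        ∫ z in Φ.below G O, fluxField J S y z (fderiv ℝ ψ z) := fun ψ hψ =>
    setIntegral_eq_of_subset_of_forall_sdiff_eq_zero hΩm hbΩ fun z hz => by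
      rw [fderiv_eq_zero_of_notMem_tsupport fun hzψ => hz.2 (hψ ⟨hzψ, hz.1⟩), map_zero]
  have hsource : ∀ ψ : Euc (k + 1) → ℝ, tsupport ψ ∩ Ω ⊆ Φ.below G O →
      ∫ z in Ω, divergenceDensity J S y ν Fp Fm f z * ψ z ∂bulkSurfaceMeasure Ω S =
        ∫ z in Φ.below G O, divergenceDensity J S y ν Fp Fm f z * ψ z ∂bulkSurfaceMeasure Ω S :=
    fun ψ hψ => setIntegral_eq_of_subset_of_forall_sdiff_eq_zero hΩm hbΩ fun z hz => by
      rw [image_eq_zero_of_notMem_tsupport fun hzψ => hz.2 (hψ ⟨hzψ, hz.1⟩), mul_zero]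
  have hφb : tsupport φ ∩ Ω ⊆ Φ.below G O := fun z hz => ⟨(hOΩ z (hφO hz.1)).1 hz.2, hφO hz.1⟩
  rw [hbulk φ hφb, hsource φ hφb]
  -- The surface is closed only relative to Ω, so it may accumulate at a boundary point that it does
  -- not contain. The limits along the axis are therefore taken off `S`, where the jet extends
  -- continuously to the boundary. Points of `S` on the boundary have zero area.
  refine Φ.gauss_green_below (N := S) (Vb := fun x => J (closedJet Ω S y (Φ.graph G x))) hG hO
    ((measure_mono hbΩ).trans_lt h.volume_lt_top) (hC _ hbΩ)
    ((h.integrableOn_divergenceDensity hJ hf).mono_set hbΩ) (fun ψ hψ hψc hψs => ?_)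
    h.volume_surface ?_ hφ hφc hφO
  · rw [← hbulk ψ (inter_subset_left.trans hψs), ← hsource ψ (inter_subset_left.trans hψs),
      h.setIntegral_divergenceDensity hJ hf hψ.continuous hψc,
      h.weak_divergence_eq hJ hf hweak hψ hψc (hψs.trans hbΩ)]
  · filter_upwards [Frame.ae_graph_notMem (Φ := Φ) hG h.boundary_null] with x hx hxO ℓ
    have hxf := (Frame.mem_frontier_iff hG h.isOpen hO hOΩ hxO).2 (Φ.above_graph G x)
    have hxS : Φ.graph G x ∈ closure Ω \ S := ⟨frontier_subset_closure hxf, fun hS => hx ⟨hS, hxf⟩⟩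
    have hmem : ∀ᶠ s in 𝓝[{s | s < 0 ∧ Φ.flat G (x, s) ∉ S}] (0 : ℝ), Φ.flat G (x, s) ∈ Ω \ S := by
      filter_upwards [nhdsWithin_mono 0 (fun s (hs : s < 0 ∧ Φ.flat G (x, s) ∉ S) => hs.1)
        (Φ.flat_mem_below hG.continuous hO hxO), self_mem_nhdsWithin] with s h1 h2
      exact ⟨hbΩ h1, h2.2⟩
    have hto : Tendsto (fun s => Φ.flat G (x, s)) (𝓝[{s | s < 0 ∧ Φ.flat G (x, s) ∉ S}] 0)
        (𝓝[Ω \ S] (Φ.graph G x)) := by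
      refine tendsto_nhdsWithin_iff.2 ⟨?_, hmem⟩
      have : Tendsto (fun s => Φ.flat G (x, s)) (𝓝 0) (𝓝 (Φ.flat G (x, 0))) :=
        ((Φ.continuous_flat hG.continuous).comp (by fun_prop :
          Continuous fun s : ℝ => (x, s))).tendsto 0
      rw [Φ.flat_zero] at this
      exact this.mono_left nhdsWithin_le_nhds
    refine (hJ.tendsto h.isOpen_range (h.range_subset (h.closedJet_mem hxS))
      ((h.tendsto_jet hxS).comp hto) (tendsto_const_nhds (x := ℓ))).congr' ?_
    filter_upwards [hmem] with s hs
    rw [fluxField_of_notMem hs.2]; rfl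

theorem frontier_inter_eq (h : BoundedJumpSetting Ω S y ν Fp Fm U) (hG : LipschitzWith K G)
    (hO : IsOpen O) (hOΩ : ∀ z ∈ O, (z ∈ Ω ↔ Φ.above G z < 0)) {A : Set (Euc (k + 1))}
    (hA : A ⊆ O) : frontier Ω ∩ A = range (Φ.graph G) ∩ A := by
  ext z
  refine and_congr_left fun hz => ?_
  rw [Frame.mem_frontier_iff hG h.isOpen hO hOΩ (hA hz), Φ.range_graph]; rfl

/-- Measurability comes out of Gauss-Green, whose boundary density is an almost everywhere limit of
measurable functions. With a bump equal to 1 near a boundary point this gives local integrability,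
and the boundary is compact. -/
theorem integrableOn_boundaryFlux (h : BoundedJumpSetting Ω S y ν Fp Fm U) (hJ : IsFlux U J)
    (hf : IntegrableOn f Ω)
    (hweak : ∀ φ : Euc (k + 1) → ℝ, ContDiff ℝ ∞ φ → HasCompactSupport φ → tsupport φ ⊆ Ω \ S →
      ∫ z in Ω, fluxField J S y z (fderiv ℝ φ z) = ∫ z in Ω, f z * φ z) :
    IntegrableOn (boundaryFlux J Ω S y) (frontier Ω) μHE[k] := by
  have hcpt : IsCompact (frontier Ω) :=
    h.bounded.isCompact_closure.of_isClosed_subset isClosed_frontier frontier_subset_closure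
  refine hcpt.induction_on (p := fun A => IntegrableOn (boundaryFlux J Ω S y) A μHE[k])
    integrableOn_empty (fun _ _ hst ht => ht.mono_set hst) (fun _ _ => IntegrableOn.union)
    fun z hz => ?_
  obtain ⟨Φ, G, K, O, hG, hO, hzO, hOΩ⟩ := h.lipschitzBoundary.exists_chart hz
  obtain ⟨r, hr, hrO⟩ := Metric.isOpen_iff.1 hO z hzO
  set b : ContDiffBump z := ⟨r / 4, r / 2, by positivity, by linarith⟩
  have hts : tsupport b ⊆ O := by
    rw [b.tsupport_eq]; exact (Metric.closedBall_subset_ball (half_lt_self hr)).trans hrO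
  have hi := (h.gauss_green_chart hJ hf hweak hG hO hOΩ b.contDiff b.hasCompactSupport hts).1
  have hball : Metric.ball z (r / 4) ⊆ O := (Metric.ball_subset_ball (by linarith)).trans hrO
  refine ⟨frontier Ω ∩ Metric.ball z (r / 4),
    inter_mem_nhdsWithin _ (Metric.ball_mem_nhds z (by positivity)), ?_⟩
  have hbm : MeasurableSet (Φ.graph G ⁻¹' Metric.ball z (r / 4)) :=
    (Φ.continuous_graph hG.continuous).measurable Metric.isOpen_ball.measurableSet
  rw [h.frontier_inter_eq hG hO hOΩ hball, Φ.integrableOn_graph_iff hG _ Metric.isOpen_ball.measurableSet]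
  refine hi.integrableOn.congr_fun_ae ?_
  filter_upwards [ae_restrict_of_ae (flux_conormal_eq (J := J) (S := S) (y := y) hG hO hOΩ),
    ae_restrict_mem hbm] with x h1 h2
  rw [h1 (hball h2), b.one_of_mem_closedBall (Metric.ball_subset_closedBall h2), one_mul]

/-- **Gauss-Green formula** for a flux: the boundary contribution is the normal component of the
flux, and the surface contribution is the jump of its normal component. -/
theorem gauss_green (h : BoundedJumpSetting Ω S y ν Fp Fm U) (hJ : IsFlux U J)
    (hf : IntegrableOn f Ω)
    (hweak : ∀ φ : Euc (k + 1) → ℝ, ContDiff ℝ ∞ φ → HasCompactSupport φ → tsupport φ ⊆ Ω \ S →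
      ∫ z in Ω, fluxField J S y z (fderiv ℝ φ z) = ∫ z in Ω, f z * φ z)
    {η : Euc (k + 1) → ℝ} (hη : ContDiff ℝ ∞ η) (hηc : HasCompactSupport η) :
    ∫ z in Ω, fluxField J S y z (fderiv ℝ η z) =
      ((∫ z in Ω, f z * η z) - ∫ z in S ∩ Ω, normalJump J y ν Fp Fm z * η z ∂μHE[k]) +
        ∫ z in frontier Ω, boundaryFlux J Ω S y z * η z ∂μHE[k] := by
  obtain ⟨C, hC⟩ := h.exists_isBoundedField hJ
  have hΩm := h.isOpen.measurableSet
  have hT := h.integrableOn_boundaryFlux hJ hf hweak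
  have hg := h.integrableOn_divergenceDensity hJ hf
  rw [← h.setIntegral_divergenceDensity hJ hf hη.continuous hηc, ← sub_eq_zero]
  refine eq_zero_of_locally_eq_zero (Q := univ) (L := fun η =>
    (∫ z in Ω, fluxField J S y z (fderiv ℝ η z)) -
      ((∫ z in Ω, divergenceDensity J S y ν Fp Fm f z * η z ∂bulkSurfaceMeasure Ω S) +
        ∫ z in frontier Ω, boundaryFlux J Ω S y z * η z ∂μHE[k])) ?_ ?_ hη hηc (subset_univ _)
  · intro φ₁ φ₂ h1 c1 h2 c2 _ _
    have e1 : ∀ z, fderiv ℝ (fun x => φ₁ x + φ₂ x) z = fderiv ℝ φ₁ z + fderiv ℝ φ₂ z := fun z =>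
      fderiv_fun_add (h1.differentiable (by simp) z) (h2.differentiable (by simp) z)
    simp only [e1, map_add, mul_add]
    rw [integral_add ((hC Ω Subset.rfl).integrableOn_fderiv hΩm h.volume_lt_top h1 c1)
        ((hC Ω Subset.rfl).integrableOn_fderiv hΩm h.volume_lt_top h2 c2),
      integral_add (Integrable.mul_continuous_compactSupport hg h1.continuous c1)
        (Integrable.mul_continuous_compactSupport hg h2.continuous c2),
      integral_add (Integrable.mul_continuous_compactSupport hT h1.continuous c1)
        (Integrable.mul_continuous_compactSupport hT h2.continuous c2)]
    ring
  intro z _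
  have hfr : ∀ φ : Euc (k + 1) → ℝ, (∀ w ∈ frontier Ω, w ∉ tsupport φ) →
      ∫ z in frontier Ω, boundaryFlux J Ω S y z * φ z ∂μHE[k] = 0 := fun φ hφ =>
    setIntegral_eq_zero_of_forall_eq_zero fun w hw => by
      rw [image_eq_zero_of_notMem_tsupport (hφ w hw), mul_zero]
  -- Near an interior point only the weak divergence acts, near an exterior point all terms vanish,
  -- and near a boundary point the chart formula applies.
  by_cases hzΩ : z ∈ Ω
  · refine ⟨Ω, h.isOpen, hzΩ, fun φ hφ hφc hφs _ => ?_⟩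
    rw [hfr φ fun w hw hwφ => (h.isOpen.frontier_eq ▸ hw).2 (hφs hwφ),
      h.setIntegral_divergenceDensity hJ hf hφ.continuous hφc,
      h.weak_divergence_eq hJ hf hweak hφ hφc hφs, add_zero, sub_self]
  by_cases hzc : z ∈ closure Ω
  swap
  · refine ⟨(closure Ω)ᶜ, isClosed_closure.isOpen_compl, hzc, fun φ hφ hφc hφs _ => ?_⟩
    have h0 : ∀ w ∈ Ω, w ∉ tsupport φ := fun w hw hwφ => hφs hwφ (subset_closure hw)
    rw [hfr φ fun w hw hwφ => hφs hwφ (frontier_subset_closure hw),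
      setIntegral_eq_zero_of_forall_eq_zero, setIntegral_eq_zero_of_forall_eq_zero]
    · ring
    · intro w hw
      rw [image_eq_zero_of_notMem_tsupport (h0 w hw), mul_zero]
    · intro w hw
      rw [fderiv_eq_zero_of_notMem_tsupport (h0 w hw), map_zero]
  have hzf : z ∈ frontier Ω := by rw [h.isOpen.frontier_eq]; exact ⟨hzc, hzΩ⟩
  obtain ⟨Φ, G, K, O, hG, hO, hzO, hOΩ⟩ := h.lipschitzBoundary.exists_chart hzf
  refine ⟨O, hO, hzO, fun φ hφ hφc hφs _ => ?_⟩
  have hsurf : ∫ z in frontier Ω, boundaryFlux J Ω S y z * φ z ∂μHE[k] =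
      ∫ x, φ (Φ.graph G x) * J (closedJet Ω S y (Φ.graph G x)) (Φ.conormal G x) := by
    rw [setIntegral_eq_of_subset_of_forall_sdiff_eq_zero isClosed_frontier.measurableSet
        (inter_subset_left (s := frontier Ω) (t := O)),
      h.frontier_inter_eq hG hO hOΩ Subset.rfl,
      Φ.setIntegral_graph hG _ hO.measurableSet, setIntegral_eq_integral_of_forall_compl_eq_zero]
    · refine integral_congr_ae ?_
      filter_upwards [flux_conormal_eq (J := J) (S := S) (y := y) hG hO hOΩ] with x hx
      by_cases hxO : Φ.graph G x ∈ O
      · rw [hx hxO]; ring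
      · rw [image_eq_zero_of_notMem_tsupport fun hxφ => hxO (hφs hxφ)]; ring
    · intro x hx
      rw [image_eq_zero_of_notMem_tsupport fun hxφ => hx (hφs hxφ), mul_zero, mul_zero]
    · intro w hw
      rw [image_eq_zero_of_notMem_tsupport fun hwφ => hw.2 ⟨hw.1, hφs hwφ⟩, mul_zero]
  rw [hsurf, (h.gauss_green_chart hJ hf hweak hG hO hOΩ hφ hφc hφs).2, sub_self]

end BoundedJumpSetting

end

end Clapeyron

namespace Clapeyron

noncomputable section

/-! ### Tensors and the derivative of the energy density -/

variable {m n : ℕ}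

theorem matUnit_apply (i : Fin m) (α : Fin n) (u : Euc n) :
    matUnit i α u = u α • EuclideanSpace.single i (1 : ℝ) := by
  simp [matUnit, EuclideanSpace.inner_single_left]

theorem eq_sum_single (u : Euc n) : u = ∑ α, u α • EuclideanSpace.single α (1 : ℝ) := by
  ext i
  simp [Finset.sum_apply, Pi.single_apply]

theorem map_eq_sum_single {X : Type*} [NormedAddCommGroup X] [NormedSpace ℝ X] (A : Euc n →L[ℝ] X)
    (u : Euc n) : A u = ∑ α, u α • A (EuclideanSpace.single α 1) := by
  conv_lhs => rw [eq_sum_single u, map_sum]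
  simp only [map_smul]

theorem eq_sum_matUnit (B : Mat m n) :
    B = ∑ i, ∑ α, (B (EuclideanSpace.single α 1)) i • matUnit i α := by
  ext1 u
  rw [map_eq_sum_single B u]
  simp only [sum_apply, smul_apply, matUnit_apply]
  rw [Finset.sum_comm]
  refine Finset.sum_congr rfl fun α _ => ?_
  conv_lhs => rw [eq_sum_single (B (EuclideanSpace.single α 1)), Finset.smul_sum]
  exact Finset.sum_congr rfl fun i _ => smul_comm _ _ _

theorem frob_matUnit (i : Fin m) (α : Fin n) (B : Mat m n) :
    frob (matUnit i α) B = (B (EuclideanSpace.single α 1)) i := by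
  rw [frob, Finset.sum_eq_single α]
  · simp [matUnit_apply, EuclideanSpace.inner_single_left]
  · intro β _ hβ
    simp [matUnit_apply, hβ.symm]
  · simp

theorem frob_sum_left {ι : Type*} (s : Finset ι) (A : ι → Mat m n) (B : Mat m n) :
    frob (∑ i ∈ s, A i) B = ∑ i ∈ s, frob (A i) B := by
  simp only [frob, sum_apply, sum_inner]
  exact Finset.sum_comm

theorem frob_smul_left (c : ℝ) (A B : Mat m n) : frob (c • A) B = c * frob A B := by
  simp only [frob, smul_apply, real_inner_smul_left, Finset.mul_sum]

theorem frob_sub_left (A A' B : Mat m n) : frob (A - A') B = frob A B - frob A' B := by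
  simp only [frob, sub_apply, inner_sub_left, Finset.sum_sub_distrib]

theorem frob_smulRight (A : Mat m n) (u : Euc n) (a : Euc m) :
    frob A ((innerSL ℝ u).smulRight a) = inner ℝ (A u) a := by
  rw [map_eq_sum_single A u, sum_inner, frob]
  refine Finset.sum_congr rfl fun α _ => ?_
  rw [ContinuousLinearMap.smulRight_apply, innerSL_apply_apply, real_inner_smul_right, real_inner_smul_left,
    EuclideanSpace.inner_single_right]
  simp

variable (W : Euc n → Euc m → Mat m n → ℝ) (x : Euc n) (v : Euc m) (F : Mat m n)

theorem frob_piola (B : Mat m n) : frob (piola W x v F) B = fderiv ℝ (W x v) F B := by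
  conv_rhs => rw [eq_sum_matUnit B]
  simp only [piola, frob_sum_left, frob_smul_left, frob_matUnit, map_sum, map_smul, smul_eq_mul]
  exact Finset.sum_congr rfl fun i _ => Finset.sum_congr rfl fun α _ => mul_comm _ _

theorem inner_piola (u : Euc n) (a : Euc m) :
    inner ℝ (piola W x v F u) a = fderiv ℝ (W x v) F ((innerSL ℝ u).smulRight a) := by
  rw [← frob_piola, frob_smulRight]

/-- The trace of a square matrix. -/
def matTrace (n : ℕ) : Mat n n →L[ℝ] ℝ :=
  ∑ α : Fin n, (innerSL ℝ (EuclideanSpace.single α (1 : ℝ) : Euc n)).comp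
    (ContinuousLinearMap.apply ℝ (Euc n) (EuclideanSpace.single α (1 : ℝ)))

theorem matTrace_apply (B : Mat n n) : matTrace n B = frob (ContinuousLinearMap.id ℝ (Euc n)) B := by
  simp [matTrace, frob]

theorem matTrace_smulRight (l : StrongDual ℝ (Euc n)) (u : Euc n) :
    matTrace n (l.smulRight u) = l u := by
  rw [map_eq_sum_single l u]
  simp [matTrace, EuclideanSpace.inner_single_left, mul_comm]

theorem matTrace_id : matTrace n (ContinuousLinearMap.id ℝ (Euc n)) = n := by
  simp [matTrace]

/-- Moving Fᵀ to the other side, ⟨FᵀP, B⟩ = ⟨P, FB⟩. -/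
theorem frob_eshelby (B : Mat n n) : frob (eshelby W x v F) B =
    W x v F * matTrace n B - fderiv ℝ (W x v) F (F.comp B) := by
  rw [eshelby, frob_sub_left, frob_smul_left, ← matTrace_apply, ← frob_piola]
  congr 1
  refine Finset.sum_congr rfl fun α _ => ?_
  rw [ContinuousLinearMap.comp_apply, ContinuousLinearMap.adjoint_inner_left]; rfl

theorem inner_eshelby (u w : Euc n) : inner ℝ (eshelby W x v F u) w =
    W x v F * inner ℝ u w - fderiv ℝ (W x v) F ((innerSL ℝ u).smulRight (F w)) := by
  rw [← inner_piola, eshelby, sub_apply, inner_sub_left,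
    ContinuousLinearMap.comp_apply, ContinuousLinearMap.adjoint_inner_left]
  simp [real_inner_smul_left]

/-- The energy density as a function on the phase space. -/
def density (p : Phase m n) : ℝ := W p.1 p.2.1 p.2.2

variable {W x v F}

/-- This and the next two lemmas express the partial derivatives through one derivative on the phase
space, whose linearity then does the bookkeeping of the Noether computation. -/
theorem fderiv_density_gradient (h : DifferentiableAt ℝ (density W) (x, v, F)) (B : Mat m n) :
    fderiv ℝ (W x v) F B = fderiv ℝ (density W) (x, v, F) (0, 0, B) := by
  have h1 : HasFDerivAt (fun F' : Mat m n => (x, v, F')) (ContinuousLinearMap.prod 0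
      (ContinuousLinearMap.prod 0 (ContinuousLinearMap.id ℝ _))) F :=
    (hasFDerivAt_const x F).prodMk ((hasFDerivAt_const v F).prodMk (hasFDerivAt_id F))
  have h2 : HasFDerivAt (W x v) _ F := HasFDerivAt.comp F (g := density W) h.hasFDerivAt h1
  rw [h2.fderiv]; rfl

theorem fderiv_density_value (h : DifferentiableAt ℝ (density W) (x, v, F)) (a : Euc m) :
    fderiv ℝ (fun v' => W x v' F) v a = fderiv ℝ (density W) (x, v, F) (0, a, 0) := by
  have h1 : HasFDerivAt (fun v' : Euc m => (x, v', F)) (ContinuousLinearMap.prod 0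
      (ContinuousLinearMap.prod (ContinuousLinearMap.id ℝ _) 0)) v :=
    (hasFDerivAt_const x v).prodMk ((hasFDerivAt_id v).prodMk (hasFDerivAt_const F v))
  have h2 : HasFDerivAt (fun v' => W x v' F) _ v :=
    HasFDerivAt.comp v (g := density W) h.hasFDerivAt h1
  rw [h2.fderiv]; rfl

theorem fderiv_density_point (h : DifferentiableAt ℝ (density W) (x, v, F)) (u : Euc n) :
    fderiv ℝ (fun x' => W x' v F) x u = fderiv ℝ (density W) (x, v, F) (u, 0, 0) := by
  have h1 : HasFDerivAt (fun x' : Euc n => (x', v, F)) (ContinuousLinearMap.prod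
      (ContinuousLinearMap.id ℝ _) (ContinuousLinearMap.prod 0 0)) x :=
    (hasFDerivAt_id x).prodMk ((hasFDerivAt_const v x).prodMk (hasFDerivAt_const F x))
  have h2 : HasFDerivAt (fun x' => W x' v F) _ x :=
    HasFDerivAt.comp x (g := density W) h.hasFDerivAt h1
  rw [h2.fderiv]; rfl

/-- Euler's identity for a scale-free energy density. -/
theorem ScaleFree.fderiv_density (hW : ScaleFree W)
    (h : DifferentiableAt ℝ (density W) (x, v, F)) :
    fderiv ℝ (density W) (x, v, F) (x, v, 0) = 0 := by
  have h1 : HasDerivAt (fun t : ℝ => ((t • x, t • v, F) : Phase m n)) (x, v, 0) 1 := by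
    have hx : HasDerivAt (fun t : ℝ => t • x) x 1 := by
      simpa using (hasDerivAt_id (1 : ℝ)).smul_const x
    have hv : HasDerivAt (fun t : ℝ => t • v) v 1 := by
      simpa using (hasDerivAt_id (1 : ℝ)).smul_const v
    exact hx.prodMk (hv.prodMk (hasDerivAt_const 1 F))
  have h2 : HasDerivAt (fun t : ℝ => density W (t • x, t • v, F))
      (fderiv ℝ (density W) (x, v, F) (x, v, 0)) 1 := by
    refine HasFDerivAt.comp_hasDerivAt (1 : ℝ) (l := density W) ?_ h1
    simpa using h.hasFDerivAt
  have h3 : HasDerivAt (fun t : ℝ => density W (t • x, t • v, F)) 0 1 := by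
    refine (hasDerivAt_const 1 (density W (x, v, F))).congr_of_eventuallyEq ?_
    filter_upwards [lt_mem_nhds one_pos] with t ht using hW t ht x v F
  exact h2.unique h3

/-! ### Noether fluxes -/

/-- The linear map `l ↦ (0, 0, a ⊗ l)`. -/
def rankOne (a : Euc m) : StrongDual ℝ (Euc n) →L[ℝ] Phase m n :=
  (ContinuousLinearMap.inr ℝ (Euc n) (Euc m × Mat m n)).comp
    ((ContinuousLinearMap.inr ℝ (Euc m) (Mat m n)).comp
      ((ContinuousLinearMap.smulRightL ℝ (Euc n) (Euc m)).flip a))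

variable (W)

/-- The component of the Piola tensor along a fixed vector, as a flux. -/
def piolaFlux (a : Euc m) (p : Phase m n) : StrongDual ℝ (Euc n) →L[ℝ] ℝ :=
  (fderiv ℝ (density W) p).comp (rankOne a)

/-- The flux associated with the infinitesimal variation `δx = ψ(x)`, `δy = c y`. -/
def noetherFlux (ψ : Euc n → Euc n) (c : ℝ) (p : Phase m n) : StrongDual ℝ (Euc n) →L[ℝ] ℝ :=
  density W p • ContinuousLinearMap.apply ℝ ℝ (ψ p.1) +
    (fderiv ℝ (density W) p).comp (rankOne (c • p.2.1 - p.2.2 (ψ p.1)))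

/-- The variation of the energy density under `δx = ψ(x)`, `δy = c y`. -/
def noetherSource (ψ : Euc n → Euc n) (c : ℝ) (p : Phase m n) : ℝ :=
  density W p * matTrace n (fderiv ℝ ψ p.1) +
    fderiv ℝ (density W) p (ψ p.1, c • p.2.1, c • p.2.2 - p.2.2.comp (fderiv ℝ ψ p.1))

variable {W}

@[simp] theorem piolaFlux_apply (a : Euc m) (p : Phase m n) (l : StrongDual ℝ (Euc n)) :
    piolaFlux W a p l = fderiv ℝ (density W) p (0, 0, l.smulRight a) := rfl

theorem noetherFlux_apply (ψ : Euc n → Euc n) (c : ℝ) (p : Phase m n) (l : StrongDual ℝ (Euc n)) :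
    noetherFlux W ψ c p l = density W p * l (ψ p.1) +
      fderiv ℝ (density W) p (0, 0, l.smulRight (c • p.2.1 - p.2.2 (ψ p.1))) := rfl

/-- The Noether identity, before integration: the divergence of the Noether flux, tested with `η`,
is the source up to an Euler-Lagrange term and a divergence. -/
theorem noether_identity {y : Euc n → Euc m} {z : Euc n} (hy : ContDiffAt ℝ 2 y z)
    (hW : DifferentiableAt ℝ (density W) (jet y z)) {ψ : Euc n → Euc n} (c : ℝ)
    (hψ : DifferentiableAt ℝ ψ z) {η : Euc n → ℝ} (hη : DifferentiableAt ℝ η z) :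
    noetherFlux W ψ c (jet y z) (fderiv ℝ η z) + noetherSource W ψ c (jet y z) * η z =
      fderiv ℝ (density W) (jet y z) (0, η z • (c • y z - fderiv ℝ y z (ψ z)),
        fderiv ℝ (fun z => η z • (c • y z - fderiv ℝ y z (ψ z))) z) +
      matTrace n (fderiv ℝ (fun z => (η z * density W (jet y z)) • ψ z) z) := by
  have hy1 : HasFDerivAt y (fderiv ℝ y z) z := (hy.differentiableAt two_ne_zero).hasFDerivAt
  have hy2 : HasFDerivAt (fderiv ℝ y) (fderiv ℝ (fderiv ℝ y) z) z :=
    ((hy.fderiv_right (m := 1) (by norm_num)).differentiableAt one_ne_zero).hasFDerivAt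
  have hsym := hy.isSymmSndFDerivAt (by simp)
  have hjet : HasFDerivAt (jet y) ((ContinuousLinearMap.id ℝ (Euc n)).prod
      ((fderiv ℝ y z).prod (fderiv ℝ (fderiv ℝ y) z))) z :=
    (hasFDerivAt_id z).prodMk (hy1.prodMk hy2)
  have hw : HasFDerivAt (fun z => density W (jet y z)) _ z := hW.hasFDerivAt.comp z hjet
  have hφ := hη.hasFDerivAt.smul ((hy1.const_smul c).sub (hy2.clm_apply hψ.hasFDerivAt))
  have hX := (hη.hasFDerivAt.mul hw).smul hψ.hasFDerivAt
  have e1 : fderiv ℝ (fun z => η z • (c • y z - fderiv ℝ y z (ψ z))) z = _ := hφ.fderiv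
  have e2 : fderiv ℝ (fun z => (η z * density W (jet y z)) • ψ z) z = _ := hX.fderiv
  -- Symmetry of the second derivative: differentiating ∇y ψ produces D²y(·, ψ), which must be
  -- recognised as the derivative of ∇y along ψ.
  have hflip : (fderiv ℝ (fderiv ℝ y) z).flip (ψ z) = fderiv ℝ (fderiv ℝ y) z (ψ z) := by
    ext1 u
    exact hsym u (ψ z)
  rw [e1, e2, hflip, noetherFlux_apply, noetherSource]
  set L := fderiv ℝ (density W) (jet y z)
  set a := c • y z - fderiv ℝ y z (ψ z) with ha
  set R := (fderiv ℝ η z).smulRight a with hR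
  -- The jet of the test map is η times (variation at fixed parametrization minus the derivative of
  -- the jet along ψ) plus a rank-one term from ∇η. Applied to the middle part, DW gives the
  -- derivative of W(x, y, ∇y) along ψ, which belongs to the divergence term.
  have hdec : ((0, η z • a, η z • (c • fderiv ℝ y z - ((fderiv ℝ y z).comp (fderiv ℝ ψ z) +
      fderiv ℝ (fderiv ℝ y) z (ψ z))) + R) : Phase m n) =
      η z • ((ψ z, c • y z, c • fderiv ℝ y z - (fderiv ℝ y z).comp (fderiv ℝ ψ z)) -
        (ψ z, fderiv ℝ y z (ψ z), fderiv ℝ (fderiv ℝ y) z (ψ z))) + (0, 0, R) := by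
    refine Prod.ext ?_ (Prod.ext ?_ ?_)
    · simp
    · simp [ha]
    · simp only [Prod.smul_snd, Prod.snd_add, Prod.snd_sub]; module
  have hL := congrArg L hdec
  simp only [map_add, map_smul, map_sub, smul_eq_mul] at hL
  simp only [map_add, map_smul, matTrace_smulRight, smul_eq_mul]
  change density W (jet y z) * fderiv ℝ η z (ψ z) + L (0, 0, R) +
    (density W (jet y z) * matTrace n (fderiv ℝ ψ z) +
      L (ψ z, c • y z, c • fderiv ℝ y z - (fderiv ℝ y z).comp (fderiv ℝ ψ z))) * η z =
    L (0, η z • a, η z • (c • fderiv ℝ y z - ((fderiv ℝ y z).comp (fderiv ℝ ψ z) +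
      fderiv ℝ (fderiv ℝ y) z (ψ z))) + R) +
    (η z * density W (jet y z) * matTrace n (fderiv ℝ ψ z) +
      (η z * L (ψ z, fderiv ℝ y z (ψ z), fderiv ℝ (fderiv ℝ y) z (ψ z)) +
        density W (jet y z) * fderiv ℝ η z (ψ z)))
  rw [hL]
  ring

end

end Clapeyron

namespace Clapeyron

noncomputable section

/-! ### Noether's theorem off the surface and the jumps of the Noether fluxes -/

theorem contDiff_of_forall_mem_tsupport {E X : Type*} [NormedAddCommGroup E] [NormedSpace ℝ E]
    [NormedAddCommGroup X] [NormedSpace ℝ X] {f : E → X} {r : WithTop ℕ∞}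
    (hf : ∀ x ∈ tsupport f, ContDiffAt ℝ r f x) : ContDiff ℝ r f := by
  refine contDiff_iff_contDiffAt.2 fun x => ?_
  by_cases hx : x ∈ tsupport f
  · exact hf x hx
  · exact contDiffAt_const.congr_of_eventuallyEq (notMem_tsupport_iff_eventuallyEq.1 hx)

theorem integral_matTrace_fderiv_eq_zero {n : ℕ} {X : Euc n → Euc n} (hX : ContDiff ℝ 1 X)
    (hXc : HasCompactSupport X) : ∫ x, matTrace n (fderiv ℝ X x) = 0 := by
  have hint : ∀ v, Integrable fun x => fderiv ℝ X x v := fun v =>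
    Continuous.integrable_of_hasCompactSupport
      ((hX.continuous_fderiv one_ne_zero).clm_apply continuous_const)
      (hXc.fderiv_apply (𝕜 := ℝ) v)
  have h0 : ∀ v, ∫ x, fderiv ℝ X x v = 0 := fun v => by
    have := integral_smul_fderiv_eq_neg_fderiv_smul_of_integrable (μ := volume) (𝕜 := ℝ)
      (f := fun _ : Euc n => (1 : ℝ)) (g := X) (v := v) (by simp) (by simpa using hint v)
      (by simpa using hX.continuous.integrable_of_hasCompactSupport hXc)
      (fun x _ => differentiableAt_const _) (fun x _ => hX.differentiable one_ne_zero x)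
    simpa using this
  have e : ∀ x, matTrace n (fderiv ℝ X x) = ∑ α : Fin n,
      innerSL ℝ (EuclideanSpace.single α (1 : ℝ) : Euc n)
        (fderiv ℝ X x (EuclideanSpace.single α 1)) := fun x => by
    simp only [matTrace, sum_apply]; rfl
  simp only [e]
  rw [integral_finsetSum _ fun α _ => ContinuousLinearMap.integrable_comp _ (hint _)]
  refine Finset.sum_eq_zero fun α _ => ?_
  rw [ContinuousLinearMap.integral_comp_comm _ (hint _), h0, map_zero]

variable {m k : ℕ} {Ω S : Set (Euc (k + 1))} {y : Euc (k + 1) → Euc m}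
  {ν : Euc (k + 1) → Euc (k + 1)} {Fp Fm : Euc (k + 1) → Mat m (k + 1)}
  {U : Set (Phase m (k + 1))} {W : Euc (k + 1) → Euc m → Mat m (k + 1) → ℝ}
  {ψ : Euc (k + 1) → Euc (k + 1)}

theorem isFlux_piolaFlux (hU : IsOpen U) (hW : ContDiffOn ℝ 1 (density W) U) (a : Euc m) :
    IsFlux U (piolaFlux W a) := fun _ =>
  (hW.continuousOn_fderiv_of_isOpen hU le_rfl).clm_apply continuousOn_const

theorem isFlux_noetherFlux (hU : IsOpen U) (hW : ContDiffOn ℝ 1 (density W) U)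
    (hψ : Continuous ψ) (c : ℝ) : IsFlux U (noetherFlux W ψ c) := fun l => by
  have h1 : Continuous fun p : Phase m (k + 1) => l (ψ p.1) := by fun_prop
  have h2 : Continuous fun p : Phase m (k + 1) =>
      ((0, 0, l.smulRight (c • p.2.1 - p.2.2 (ψ p.1))) : Phase m (k + 1)) := by
    have h3 : Continuous fun p : Phase m (k + 1) => c • p.2.1 - p.2.2 (ψ p.1) :=
      (continuous_snd.fst.const_smul c).sub (continuous_snd.snd.clm_apply (hψ.comp continuous_fst))
    exact continuous_const.prodMk (continuous_const.prodMk
      ((ContinuousLinearMap.smulRightL ℝ (Euc (k + 1)) (Euc m) l).continuous.comp h3))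
  exact (hW.continuousOn.mul h1.continuousOn).add
    ((hW.continuousOn_fderiv_of_isOpen hU le_rfl).clm_apply h2.continuousOn)

theorem continuousOn_noetherSource (hU : IsOpen U) (hW : ContDiffOn ℝ 1 (density W) U)
    (hψ : ContDiff ℝ ∞ ψ) (c : ℝ) : ContinuousOn (noetherSource W ψ c) U := by
  have h0 : Continuous fun p : Phase m (k + 1) => fderiv ℝ ψ p.1 :=
    (hψ.continuous_fderiv (by simp)).comp continuous_fst
  have h1 : Continuous fun p : Phase m (k + 1) => matTrace (k + 1) (fderiv ℝ ψ p.1) :=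
    (matTrace (k + 1)).continuous.comp h0
  have h2 : Continuous fun p : Phase m (k + 1) =>
      ((ψ p.1, c • p.2.1, c • p.2.2 - p.2.2.comp (fderiv ℝ ψ p.1)) : Phase m (k + 1)) :=
    (hψ.continuous.comp continuous_fst).prodMk ((continuous_snd.fst.const_smul c).prodMk
      ((continuous_snd.snd.const_smul c).sub (continuous_snd.snd.clm_comp h0)))
  exact (hW.continuousOn.mul h1.continuousOn).add
    ((hW.continuousOn_fderiv_of_isOpen hU le_rfl).clm_apply h2.continuousOn)

namespace JumpSetting

theorem restrict_diff (h : JumpSetting Ω S y ν Fp Fm U) :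
    volume.restrict (Ω \ S) = volume.restrict Ω :=
  Measure.restrict_congr_set (sdiff_null_ae_eq_self h.volume_surface)

theorem ae_mem_diff (h : JumpSetting Ω S y ν Fp Fm U) : ∀ᵐ z ∂volume.restrict Ω, z ∈ Ω \ S := by
  rw [← h.restrict_diff]
  exact ae_restrict_mem h.isOpen_diff.measurableSet

theorem integrableOn_comp_jet (h : JumpSetting Ω S y ν Fp Fm U) {X : Type*} [NormedAddCommGroup X]
    {Q : Phase m (k + 1) → X} (hQ : ContinuousOn Q U) : IntegrableOn (fun z => Q (jet y z)) Ω := by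
  have : Fact (volume Ω < ⊤) := ⟨h.volume_lt_top⟩
  obtain ⟨C, hC⟩ := h.isCompact_range.exists_bound_of_continuousOn (hQ.mono h.range_subset)
  refine ⟨?_, HasFiniteIntegral.of_bounded (C := C) ?_⟩
  · rw [← h.restrict_diff]
    exact (hQ.comp h.continuousOn_jet fun z hz => h.range_subset (jet_mem hz)).aestronglyMeasurable
      h.isOpen_diff.measurableSet
  · filter_upwards [h.ae_mem_diff] with z hz using hC _ (jet_mem hz)

theorem integrableOn_fderiv_density (h : JumpSetting Ω S y ν Fp Fm U)
    (hW : ContDiffOn ℝ 1 (density W) U) {g : Euc (k + 1) → Phase m (k + 1)} (hg : Continuous g) :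
    IntegrableOn (fun z => fderiv ℝ (density W) (jet y z) (g z)) Ω :=
  h.integrableOn_comp_jet (Q := fun p => fderiv ℝ (density W) p (g p.1))
    ((hW.continuousOn_fderiv_of_isOpen h.isOpen_range le_rfl).clm_apply
      (hg.comp continuous_fst).continuousOn)

theorem differentiableAt_density (h : JumpSetting Ω S y ν Fp Fm U)
    (hW : ContDiffOn ℝ 1 (density W) U) {p : Phase m (k + 1)}
    (hp : p ∈ closure (jet y '' (Ω \ S))) : DifferentiableAt ℝ (density W) p :=
  (hW.contDiffAt (h.isOpen_range.mem_nhds (h.range_subset hp))).differentiableAt one_ne_zero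

theorem setIntegral_fderiv_density_split (h : JumpSetting Ω S y ν Fp Fm U)
    (hW : ContDiffOn ℝ 1 (density W) U) {φ : Euc (k + 1) → Euc m} (hφ : ContDiff ℝ 1 φ) :
    ∫ z in Ω, fderiv ℝ (density W) (jet y z) (0, φ z, fderiv ℝ φ z) =
      (∫ z in Ω, fderiv ℝ (density W) (jet y z) (0, 0, fderiv ℝ φ z)) +
        ∫ z in Ω, fderiv ℝ (density W) (jet y z) (0, φ z, 0) := by
  have hd := hφ.continuous_fderiv one_ne_zero
  rw [← integral_add
    (h.integrableOn_fderiv_density hW (continuous_const.prodMk (continuous_const.prodMk hd)))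
    (h.integrableOn_fderiv_density hW (continuous_const.prodMk (hφ.continuous.prodMk
      continuous_const)))]
  refine integral_congr_ae (ae_of_all _ fun z => ?_)
  simp only [← map_add]
  simp

/-- The Euler-Lagrange equation in terms of the derivative of the energy density. -/
theorem euler_lagrange (h : JumpSetting Ω S y ν Fp Fm U) (hW : ContDiffOn ℝ 1 (density W) U)
    (hext : IsExtremal W Ω y) {φ : Euc (k + 1) → Euc m} (hφ : IsTestMap Ω φ) :
    ∫ z in Ω, fderiv ℝ (density W) (jet y z) (0, φ z, fderiv ℝ φ z) = 0 := by
  rw [← hext φ hφ]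
  refine integral_congr_ae ?_
  filter_upwards [h.ae_mem_diff] with z hz
  have hd := h.differentiableAt_density hW (jet_mem hz)
  rw [frob_piola, fderiv_density_gradient hd, fderiv_density_value hd, ← map_add]
  simp [jet]

theorem piolaFlux_weak (h : JumpSetting Ω S y ν Fp Fm U) (hW : ContDiffOn ℝ 1 (density W) U)
    (hext : IsExtremal W Ω y) (a : Euc m) {η : Euc (k + 1) → ℝ} (hη : ContDiff ℝ ∞ η)
    (hηc : HasCompactSupport η) (hηΩ : tsupport η ⊆ Ω) :
    ∫ z in Ω, fluxField (piolaFlux W a) S y z (fderiv ℝ η z) =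
      ∫ z in Ω, -fderiv ℝ (density W) (jet y z) (0, a, 0) * η z := by
  have hφ : IsTestMap Ω fun z => η z • a :=
    ⟨hη.smul contDiff_const, hηc.smul_right, (tsupport_smul_subset_left _ _).trans hηΩ⟩
  have hfd : ∀ z, fderiv ℝ (fun z => η z • a) z = (fderiv ℝ η z).smulRight a := fun z =>
    (((hη.differentiable (by simp) z).hasFDerivAt).smul_const a).fderiv
  have h0 := h.euler_lagrange hW hext hφ
  rw [h.setIntegral_fderiv_density_split hW (hφ.1.of_le (by simp)), add_eq_zero_iff_eq_neg,
    ← integral_neg] at h0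
  simp only [hfd] at h0
  refine Eq.trans (integral_congr_ae ?_) (h0.trans (integral_congr_ae (ae_of_all _ fun z => ?_)))
  · filter_upwards [h.ae_mem_diff] with z hz
    rw [fluxField_of_notMem hz.2, piolaFlux_apply]
  · have := ((fderiv ℝ (density W) (jet y z)).comp ((ContinuousLinearMap.inr ℝ (Euc (k + 1)) _).comp
      (ContinuousLinearMap.inl ℝ (Euc m) (Mat m (k + 1))))).map_smul (η z) a
    have e : fderiv ℝ (density W) (jet y z) (0, η z • a, 0) =
      η z * fderiv ℝ (density W) (jet y z) (0, a, 0) := this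
    beta_reduce
    rw [e]
    ring

/-- The traction is continuous across the surface. -/
theorem traction_continuous (h : JumpSetting Ω S y ν Fp Fm U) (hW : ContDiffOn ℝ 1 (density W) U)
    (hext : IsExtremal W Ω y) (a : Euc m) {x : Euc (k + 1)} (hx : x ∈ S ∩ Ω) :
    piolaFlux W a (x, y x, Fp x) (innerSL ℝ (ν x)) =
      piolaFlux W a (x, y x, Fm x) (innerSL ℝ (ν x)) := by
  have hJ := isFlux_piolaFlux h.isOpen_range hW a
  have hf : IntegrableOn (fun z => -fderiv ℝ (density W) (jet y z) (0, a, 0)) Ω :=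
    (h.integrableOn_fderiv_density hW continuous_const).neg
  refine sub_eq_zero.1 (h.eq_zero_of_forall_setIntegral_mul_eq_zero (h.continuousOn_normalJump hJ)
    (h.integrableOn_normalJump hJ) (fun φ hφ hφc hφΩ => ?_) x hx)
  -- The Euler-Lagrange equation allows test functions crossing the surface and shows no surface
  -- term, whereas the general formula contains the normal jump. Hence the jump integrates to zero
  -- against every test function.
  have h1 := h.weak_divergence_eq hJ hf (fun φ hφ hφc hφs =>
    h.piolaFlux_weak hW hext a hφ hφc (hφs.trans sdiff_subset)) hφ hφc hφΩ
  rw [h.piolaFlux_weak hW hext a hφ hφc hφΩ] at h1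
  linarith

/-- The Euler-Lagrange equation off the surface, tested with `C¹` maps. -/
theorem euler_lagrange_diff (h : JumpSetting Ω S y ν Fp Fm U) (hW : ContDiffOn ℝ 1 (density W) U)
    (hext : IsExtremal W Ω y) {φ : Euc (k + 1) → Euc m} (hφ : ContDiff ℝ 1 φ)
    (hφc : HasCompactSupport φ) (hφs : tsupport φ ⊆ Ω \ S) :
    ∫ z in Ω, fderiv ℝ (density W) (jet y z) (0, φ z, fderiv ℝ φ z) = 0 := by
  have hDW := hW.continuousOn_fderiv_of_isOpen h.isOpen_range le_rfl
  obtain ⟨C, hC⟩ := h.isCompact_range.exists_bound_of_continuousOn (hDW.mono h.range_subset)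
  set ι₂ : Euc m →L[ℝ] Phase m (k + 1) := (ContinuousLinearMap.inr ℝ (Euc (k + 1)) _).comp
    (ContinuousLinearMap.inl ℝ (Euc m) (Mat m (k + 1)))
  set ι₃ : Mat m (k + 1) →L[ℝ] Phase m (k + 1) := (ContinuousLinearMap.inr ℝ (Euc (k + 1)) _).comp
    (ContinuousLinearMap.inr ℝ (Euc m) (Mat m (k + 1)))
  have hV : IsBoundedField (Ω \ S) (C * ‖ι₃‖) fun z => (fderiv ℝ (density W) (jet y z)).comp ι₃ := by
    refine ⟨fun M hM => aestronglyMeasurable_apply_of_forall (fun B => ?_) hM, fun z hz B => ?_⟩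
    · rw [h.restrict_diff]
      exact (h.integrableOn_fderiv_density hW (g := fun _ => ι₃ B)
        continuous_const).aestronglyMeasurable
    · refine (((fderiv ℝ (density W) (jet y z)).comp ι₃).le_opNorm B).trans ?_
      refine mul_le_mul_of_nonneg_right ?_ (norm_nonneg _)
      exact (ContinuousLinearMap.opNorm_comp_le _ _).trans
        (mul_le_mul_of_nonneg_right (hC _ (jet_mem hz)) (norm_nonneg _))
  have hA : IntegrableOn (fun z => -(fderiv ℝ (density W) (jet y z)).comp ι₂) (Ω \ S) := by
    rw [IntegrableOn, h.restrict_diff]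
    exact h.integrableOn_comp_jet (Q := fun p => -(fderiv ℝ (density W) p).comp ι₂)
      (hDW.clm_comp continuousOn_const).neg
  obtain ⟨K, hK⟩ := hφ.lipschitzWith_of_hasCompactSupport hφc one_ne_zero
  have key := weak_equation_of_lipschitz h.isOpen_diff
    ((measure_mono sdiff_subset).trans_lt h.volume_lt_top) hV hA (fun χ hχ hχc hχs => by
      have h0 := h.euler_lagrange hW hext (φ := χ) ⟨hχ, hχc, hχs.trans sdiff_subset⟩
      rw [h.setIntegral_fderiv_density_split hW (hχ.of_le (by simp)), add_eq_zero_iff_eq_neg,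
        ← integral_neg] at h0
      rw [h.restrict_diff]
      exact h0) hK hφc hφs
  rw [h.restrict_diff] at key
  rw [h.setIntegral_fderiv_density_split hW hφ, add_eq_zero_iff_eq_neg, ← integral_neg]
  exact key

/-- **Noether's theorem** off the surface. -/
theorem noetherFlux_weak (h : JumpSetting Ω S y ν Fp Fm U) (hW : ContDiffOn ℝ 1 (density W) U)
    (hext : IsExtremal W Ω y) (hψ : ContDiff ℝ ∞ ψ) (c : ℝ) {η : Euc (k + 1) → ℝ}
    (hη : ContDiff ℝ ∞ η) (hηc : HasCompactSupport η) (hηs : tsupport η ⊆ Ω \ S) :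
    ∫ z in Ω, fluxField (noetherFlux W ψ c) S y z (fderiv ℝ η z) =
      ∫ z in Ω, -noetherSource W ψ c (jet y z) * η z := by
  have hΩm := h.isOpen.measurableSet
  -- `φ` is the variation of `y` at fixed points that the symmetry induces, localized by `η`. It is
  -- C¹ because `y` is C² off the surface. `X` carries the divergence part of the Noether identity,
  -- which integrates to zero.
  set φ : Euc (k + 1) → Euc m := fun z => η z • (c • y z - fderiv ℝ y z (ψ z)) with hφdef
  set X : Euc (k + 1) → Euc (k + 1) := fun z => (η z * density W (jet y z)) • ψ z with hXdef
  have hφt : tsupport φ ⊆ tsupport η := tsupport_smul_subset_left _ _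
  have hXt : tsupport X ⊆ tsupport η :=
    (tsupport_smul_subset_left _ _).trans tsupport_mul_subset_left
  have hη1 : ContDiff ℝ 1 η := hη.of_le (by simp)
  have hψ1 : ContDiff ℝ 1 ψ := hψ.of_le (by simp)
  have hy1 : ∀ z ∈ Ω \ S, ContDiffAt ℝ 1 (fderiv ℝ y) z := fun z hz =>
    (h.contDiffAt hz).fderiv_right (by norm_num)
  have hφ : ContDiff ℝ 1 φ := contDiff_of_forall_mem_tsupport fun z hz => by
    have hzs := hηs (hφt hz)
    exact hη1.contDiffAt.smul ((((h.contDiffAt hzs).of_le one_le_two).const_smul c).sub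
      ((hy1 z hzs).clm_apply hψ1.contDiffAt))
  have hX : ContDiff ℝ 1 X := contDiff_of_forall_mem_tsupport fun z hz => by
    have hzs := hηs (hXt hz)
    have hjet : ContDiffAt ℝ 1 (jet y) z :=
      contDiffAt_id.prodMk (((h.contDiffAt hzs).of_le one_le_two).prodMk (hy1 z hzs))
    exact (hη1.contDiffAt.mul ((hW.contDiffAt (h.isOpen_range.mem_nhds
      (h.range_subset (jet_mem hzs)))).comp z hjet)).smul hψ1.contDiffAt
  have hφc : HasCompactSupport φ := hηc.smul_right
  have hXc : HasCompactSupport X := hηc.mul_right.smul_right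
  obtain ⟨C, hC⟩ := h.exists_isBoundedField (isFlux_noetherFlux h.isOpen_range hW hψ.continuous c)
  have hi1 := (hC Ω Subset.rfl).integrableOn_fderiv hΩm h.volume_lt_top hη hηc
  have hi2 : IntegrableOn (fun z => noetherSource W ψ c (jet y z) * η z) Ω :=
    Integrable.mul_continuous_compactSupport
      (h.integrableOn_comp_jet (continuousOn_noetherSource h.isOpen_range hW hψ c)) hη.continuous hηc
  have hi3 := h.integrableOn_fderiv_density hW (g := fun z => (0, φ z, fderiv ℝ φ z))
    (continuous_const.prodMk (hφ.continuous.prodMk (hφ.continuous_fderiv one_ne_zero)))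
  have hi4 : IntegrableOn (fun z => matTrace (k + 1) (fderiv ℝ X z)) Ω := by
    refine (Continuous.integrable_of_hasCompactSupport
      ((matTrace (k + 1)).continuous.comp (hX.continuous_fderiv one_ne_zero)) ?_).integrableOn
    exact (hXc.fderiv (𝕜 := ℝ)).comp_left (map_zero _)
  have hsum : (∫ z in Ω, fluxField (noetherFlux W ψ c) S y z (fderiv ℝ η z)) +
      ∫ z in Ω, noetherSource W ψ c (jet y z) * η z = 0 := by
    rw [← integral_add hi1 hi2]
    have e : ∫ z in Ω, (fluxField (noetherFlux W ψ c) S y z (fderiv ℝ η z) +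
        noetherSource W ψ c (jet y z) * η z) =
        ∫ z in Ω, (fderiv ℝ (density W) (jet y z) (0, φ z, fderiv ℝ φ z) +
          matTrace (k + 1) (fderiv ℝ X z)) := by
      refine integral_congr_ae ?_
      filter_upwards [h.ae_mem_diff] with z hz
      rw [fluxField_of_notMem hz.2]
      exact noether_identity (h.contDiffAt hz) (h.differentiableAt_density hW (jet_mem hz)) c
        (hψ1.differentiable one_ne_zero z) (hη1.differentiable one_ne_zero z)
    rw [e, integral_add hi3 hi4, h.euler_lagrange_diff hW hext hφ hφc (hφt.trans hηs), zero_add,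
      setIntegral_eq_integral_of_forall_compl_eq_zero, integral_matTrace_fderiv_eq_zero hX hXc]
    intro z hz
    rw [fderiv_eq_zero_of_notMem_tsupport fun hzX => hz (hηs (hXt hzX)).1, map_zero]
  simp only [neg_mul, integral_neg]
  linarith

/-- The jump of the gradient is the tensor product of an amplitude and the normal. -/
theorem gradient_jump_eq (h : JumpSetting Ω S y ν Fp Fm U) {x : Euc (k + 1)} (hx : x ∈ S ∩ Ω)
    (w : Euc (k + 1)) : (Fp x - Fm x) w = (inner ℝ (ν x) w : ℝ) • (Fp x - Fm x) (ν x) := by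
  have h0 : inner ℝ (ν x) (w - (inner ℝ (ν x) w : ℝ) • ν x) = 0 := by
    rw [inner_sub_right, real_inner_smul_right, real_inner_self_eq_norm_sq, h.norm_normal hx]; ring
  have h1 := h.gradient_jump_tangent hx h0
  have h2 : (Fp x - Fm x) (w - (inner ℝ (ν x) w : ℝ) • ν x) = 0 := sub_eq_zero.2 h1
  rw [map_sub, map_smul, sub_eq_zero] at h2
  exact h2

/-- The jump of the normal component of a Noether flux. -/
theorem normalJump_noetherFlux (h : JumpSetting Ω S y ν Fp Fm U)
    (hW : ContDiffOn ℝ 1 (density W) U) (hext : IsExtremal W Ω y) (ψ : Euc (k + 1) → Euc (k + 1))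
    (c : ℝ) {x : Euc (k + 1)} (hx : x ∈ S ∩ Ω) :
    normalJump (noetherFlux W ψ c) y ν Fp Fm x =
      pStar W x (y x) (Fp x) (Fm x) * inner ℝ (ν x) (ψ x) := by
  -- Continuity of the traction, paired with the vector on the minus side, replaces the stress there
  -- by the one on the plus side.
  have ht := h.traction_continuous hW hext (c • y x - Fm x (ψ x)) hx
  simp only [piolaFlux_apply] at ht
  have hd := h.differentiableAt_density hW (h.mem_range_pos_neg hx).1
  rw [pStar, frob_piola, fderiv_density_gradient hd, normalJump, noetherFlux_apply,
    noetherFlux_apply]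
  change W x (y x) (Fp x) * inner ℝ (ν x) (ψ x) + fderiv ℝ (density W) (x, y x, Fp x)
      (0, 0, (innerSL ℝ (ν x)).smulRight (c • y x - Fp x (ψ x))) -
    (W x (y x) (Fm x) * inner ℝ (ν x) (ψ x) + fderiv ℝ (density W) (x, y x, Fm x)
      (0, 0, (innerSL ℝ (ν x)).smulRight (c • y x - Fm x (ψ x)))) = _
  rw [← ht]
  -- By Hadamard's condition ⟦F⟧ψ = (ν · ψ) a and ⟦F⟧ = a ⊗ ν. So a ν · ψ tensored with ν is (ν · ψ)
  -- ⟦F⟧, which produces the term ⟨P₊, ⟦F⟧⟩ of p*.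
  have e : ((0, 0, (innerSL ℝ (ν x)).smulRight (c • y x - Fp x (ψ x))) : Phase m (k + 1)) =
      (0, 0, (innerSL ℝ (ν x)).smulRight (c • y x - Fm x (ψ x))) -
        (inner ℝ (ν x) (ψ x) : ℝ) • (0, 0, Fp x - Fm x) := by
    refine Prod.ext (by simp) (Prod.ext (by simp) ?_)
    ext1 u
    have h1 := h.gradient_jump_eq hx u
    have h2 := h.gradient_jump_eq hx (ψ x)
    have h3 : Fp x (ψ x) = Fm x (ψ x) + (inner ℝ (ν x) (ψ x) : ℝ) • (Fp x - Fm x) (ν x) := by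
      rw [← h2, sub_apply]; abel
    simp only [Prod.snd_sub, Prod.smul_snd, sub_apply, smul_apply,
      ContinuousLinearMap.smulRight_apply, innerSL_apply_apply]
    rw [sub_apply] at h1
    rw [h1, h3, sub_apply]
    module
  rw [e, map_sub, map_smul, smul_eq_mul]
  ring

end JumpSetting

end

end Clapeyron

namespace Clapeyron

noncomputable section

/-! ### The energy identity and the stationarity condition -/

variable {m k : ℕ} {Ω S : Set (Euc (k + 1))} {y : Euc (k + 1) → Euc m}
  {ν : Euc (k + 1) → Euc (k + 1)} {Fp Fm : Euc (k + 1) → Mat m (k + 1)}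
  {U : Set (Phase m (k + 1))} {W : Euc (k + 1) → Euc m → Mat m (k + 1) → ℝ}
  {ψ : Euc (k + 1) → Euc (k + 1)}

/-- Testing Gauss-Green with such a function removes the gradient term and leaves unweighted
integrals. -/
theorem exists_cutoff {n : ℕ} {Ω : Set (Euc n)} (hΩ : Bornology.IsBounded Ω) :
    ∃ η : Euc n → ℝ, ContDiff ℝ ∞ η ∧ HasCompactSupport η ∧ ∀ x ∈ closure Ω, η =ᶠ[𝓝 x] 1 := by
  obtain ⟨R, hR0, hR⟩ := hΩ.closure.subset_ball_lt 0 (0 : Euc n)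
  let b : ContDiffBump (0 : Euc n) := ⟨R, R + 1, hR0, by linarith⟩
  exact ⟨b, b.contDiff, b.hasCompactSupport, fun x hx => b.eventuallyEq_one_of_mem_ball (hR hx)⟩

namespace BoundedJumpSetting

/-- The integrated form of Noether's theorem on the whole domain. -/
theorem setIntegral_noetherSource (h : BoundedJumpSetting Ω S y ν Fp Fm U)
    (hW : ContDiffOn ℝ 1 (density W) U) (hext : IsExtremal W Ω y) (hψ : ContDiff ℝ ∞ ψ) (c : ℝ) :
    ∫ z in Ω, noetherSource W ψ c (jet y z) =
      (∫ z in frontier Ω, boundaryFlux (noetherFlux W ψ c) Ω S y z ∂μHE[k]) -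
        ∫ z in S ∩ Ω, pStar W z (y z) (Fp z) (Fm z) * inner ℝ (ν z) (ψ z) ∂μHE[k] := by
  obtain ⟨η, hη, hηc, hη1⟩ := exists_cutoff h.bounded
  have hJ := isFlux_noetherFlux h.isOpen_range hW hψ.continuous c
  have hf : IntegrableOn (fun z => -noetherSource W ψ c (jet y z)) Ω :=
    (h.integrableOn_comp_jet (continuousOn_noetherSource h.isOpen_range hW hψ c)).neg
  have key := h.gauss_green hJ hf (fun φ hφ hφc hφs =>
    h.noetherFlux_weak hW hext hψ c hφ hφc hφs) hη hηc
  have hη1' : ∀ z ∈ closure Ω, η z = 1 := fun z hz => (hη1 z hz).self_of_nhds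
  have e1 : ∫ z in Ω, fluxField (noetherFlux W ψ c) S y z (fderiv ℝ η z) = 0 :=
    setIntegral_eq_zero_of_forall_eq_zero fun z hz => by
      have : fderiv ℝ η z = 0 := by
        rw [(hη1 z (subset_closure hz)).fderiv_eq]
        exact fderiv_const_apply (1 : ℝ)
      rw [this, map_zero]
  have e2 : ∫ z in Ω, -noetherSource W ψ c (jet y z) * η z =
      -∫ z in Ω, noetherSource W ψ c (jet y z) := by
    rw [← integral_neg]
    refine setIntegral_congr_fun h.isOpen.measurableSet fun z hz => ?_
    rw [hη1' z (subset_closure hz), mul_one]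
  have e3 : ∫ z in S ∩ Ω, normalJump (noetherFlux W ψ c) y ν Fp Fm z * η z ∂μHE[k] =
      ∫ z in S ∩ Ω, pStar W z (y z) (Fp z) (Fm z) * inner ℝ (ν z) (ψ z) ∂μHE[k] :=
    setIntegral_congr_fun h.measurableSet_inter fun z hz => by
      rw [hη1' z (subset_closure hz.2), mul_one, h.normalJump_noetherFlux hW hext ψ c hz]
  have e4 : ∫ z in frontier Ω, boundaryFlux (noetherFlux W ψ c) Ω S y z * η z ∂μHE[k] =
      ∫ z in frontier Ω, boundaryFlux (noetherFlux W ψ c) Ω S y z ∂μHE[k] :=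
    setIntegral_congr_fun isClosed_frontier.measurableSet fun z hz => by
      rw [hη1' z (frontier_subset_closure hz), mul_one]
  rw [e1, e2, e3, e4] at key
  linarith

theorem ae_frontier_notMem (h : BoundedJumpSetting Ω S y ν Fp Fm U) :
    ∀ᵐ z ∂μHE[k].restrict (frontier Ω), z ∈ closure Ω \ S := by
  rw [ae_restrict_iff' isClosed_frontier.measurableSet]
  filter_upwards [measure_eq_zero_iff_ae_notMem.1 h.boundary_null] with z hz hzf
  exact ⟨frontier_subset_closure hzf, fun hzS => hz ⟨hzS, hzf⟩⟩

/-- W n · x + P n · (y - Fx) regroups as P n · y + (W I - FᵀP) n · x. -/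
theorem boundaryFlux_noetherFlux (h : BoundedJumpSetting Ω S y ν Fp Fm U)
    (hW : ContDiffOn ℝ 1 (density W) U) {z : Euc (k + 1)} (hz : z ∈ closure Ω \ S) :
    boundaryFlux (noetherFlux W id 1) Ω S y z = tractionWork W z (outwardNormal Ω z) (y z)
      (fderivWithin ℝ y (closure Ω \ S) z) := by
  have hd := h.differentiableAt_density hW (h.closedJet_mem hz)
  rw [boundaryFlux, noetherFlux_apply, tractionWork, inner_piola, inner_eshelby]
  rw [closedJet] at hd ⊢
  rw [fderiv_density_gradient hd, fderiv_density_gradient hd]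
  set F := fderivWithin ℝ y (closure Ω \ S) z
  set u := outwardNormal Ω z
  have e : ((0, 0, (innerSL ℝ u).smulRight ((1 : ℝ) • y z - F z)) : Phase m (k + 1)) =
      (0, 0, (innerSL ℝ u).smulRight (y z)) - (0, 0, (innerSL ℝ u).smulRight (F z)) := by
    refine Prod.ext (by simp) (Prod.ext (by simp) ?_)
    ext1 w
    simp only [Prod.snd_sub, sub_apply, ContinuousLinearMap.smulRight_apply]
    module
  change W z (y z) F * inner ℝ u z + fderiv ℝ (density W) (z, y z, F)
    (0, 0, (innerSL ℝ u).smulRight ((1 : ℝ) • y z - F z)) = _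
  rw [e, map_sub]
  ring

/-- Scaling leaves the gradient unchanged, so DW is evaluated on (x, y, 0), where it vanishes by
Euler's identity. Only W times the trace of the identity remains. -/
theorem noetherSource_id (h : BoundedJumpSetting Ω S y ν Fp Fm U)
    (hW : ContDiffOn ℝ 1 (density W) U) (hWs : ScaleFree W) {z : Euc (k + 1)} (hz : z ∈ Ω \ S) :
    noetherSource W id 1 (jet y z) = ((k + 1 : ℕ) : ℝ) * W z (y z) (fderiv ℝ y z) := by
  have hd := h.differentiableAt_density hW (JumpSetting.jet_mem hz)
  have e : (((1 : ℝ) • fderiv ℝ y z - (fderiv ℝ y z).comp (ContinuousLinearMap.id ℝ _)) :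
      Mat m (k + 1)) = 0 := by
    ext1 w; simp
  rw [noetherSource]
  change W z (y z) (fderiv ℝ y z) * matTrace (k + 1) (fderiv ℝ id z) + fderiv ℝ (density W) (jet y z)
    (z, (1 : ℝ) • y z, (1 : ℝ) • fderiv ℝ y z - (fderiv ℝ y z).comp (fderiv ℝ id z)) = _
  rw [fderiv_id, matTrace_id, e, one_smul, jet, hWs.fderiv_density hd]
  ring

theorem noetherSource_eq (h : BoundedJumpSetting Ω S y ν Fp Fm U)
    (hW : ContDiffOn ℝ 1 (density W) U) (ψ : Euc (k + 1) → Euc (k + 1)) {z : Euc (k + 1)}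
    (hz : z ∈ Ω \ S) :
    noetherSource W ψ 0 (jet y z) =
      fderiv ℝ (fun x => W x (y z) (fderiv ℝ y z)) z (ψ z) +
        frob (eshelby W z (y z) (fderiv ℝ y z)) (fderiv ℝ ψ z) := by
  have hd := h.differentiableAt_density hW (JumpSetting.jet_mem hz)
  rw [jet] at hd
  rw [frob_eshelby, fderiv_density_gradient hd, fderiv_density_point hd, noetherSource]
  set F := fderiv ℝ y z
  have e : ((ψ z, (0 : ℝ) • y z, (0 : ℝ) • F - F.comp (fderiv ℝ ψ z)) : Phase m (k + 1)) =
      (ψ z, 0, 0) - (0, 0, F.comp (fderiv ℝ ψ z)) := by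
    refine Prod.ext (by simp) (Prod.ext (by simp) ?_)
    ext1 w
    simp
  change W z (y z) F * matTrace (k + 1) (fderiv ℝ ψ z) + fderiv ℝ (density W) (z, y z, F)
    (ψ z, (0 : ℝ) • y z, (0 : ℝ) • F - F.comp (fderiv ℝ ψ z)) = _
  rw [e, map_sub]
  ring

/-- The weak form of the configurational balance is the virtual work of `p*` on the surface. -/
theorem setIntegral_eshelby (h : BoundedJumpSetting Ω S y ν Fp Fm U)
    (hW : ContDiffOn ℝ 1 (density W) U) (hext : IsExtremal W Ω y) (hψ : IsTestMap Ω ψ) :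
    ∫ x in Ω, (fderiv ℝ (fun z => W z (y x) (fderiv ℝ y x)) x (ψ x)
        + frob (eshelby W x (y x) (fderiv ℝ y x)) (fderiv ℝ ψ x)) =
      -∫ z in S ∩ Ω, pStar W z (y z) (Fp z) (Fm z) * inner ℝ (ν z) (ψ z) ∂μHE[k] := by
  -- With c = 0 the flux is linear in ψ(z), and ψ vanishes on the boundary.
  have e1 : ∫ z in frontier Ω, boundaryFlux (noetherFlux W ψ 0) Ω S y z ∂μHE[k] = 0 := by
    refine setIntegral_eq_zero_of_forall_eq_zero fun z hz => ?_
    have h0 : ψ z = 0 := image_eq_zero_of_notMem_tsupport fun hzψ =>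
      (h.isOpen.frontier_eq ▸ hz).2 (hψ.2.2 hzψ)
    have h1 : (closedJet Ω S y z).1 = z := rfl
    have h2 : ∀ l : StrongDual ℝ (Euc (k + 1)), ((0, 0, l.smulRight 0) : Phase m (k + 1)) = 0 :=
      fun l => Prod.ext rfl (Prod.ext rfl (by ext1 w; simp))
    rw [boundaryFlux, noetherFlux_apply, h1, h0, map_zero, map_zero, zero_smul, sub_zero, mul_zero,
      zero_add, h2, map_zero]
  have key := h.setIntegral_noetherSource hW hext hψ.1 0
  rw [e1, zero_sub] at key
  rw [← key]
  refine integral_congr_ae ?_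
  filter_upwards [h.ae_mem_diff] with z hz using (h.noetherSource_eq hW ψ hz).symm

/-- An extremal is stationary exactly when `p*` vanishes on the surface. -/
theorem isStationaryConfig_iff (h : BoundedJumpSetting Ω S y ν Fp Fm U)
    (hW : ContDiffOn ℝ 1 (density W) U) (hext : IsExtremal W Ω y) :
    IsStationaryConfig W Ω y ↔ ∀ x ∈ S ∩ Ω, pStar W x (y x) (Fp x) (Fm x) = 0 := by
  constructor
  · rintro ⟨-, hst⟩ x hx
    -- The fundamental lemma is applied to each component of p* ν, with ψ = φ e_α. The scalar p*
    -- itself depends on the labelling of the sides, but this component is a normal flux jump and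
    -- hence continuous on the surface. A unit normal has some nonzero component.
    have hα : ∀ α : Fin (k + 1), pStar W x (y x) (Fp x) (Fm x) *
        inner ℝ (ν x) (EuclideanSpace.single α (1 : ℝ)) = 0 := by
      intro α
      set a : Euc (k + 1) := EuclideanSpace.single α (1 : ℝ)
      have hJ := isFlux_noetherFlux h.isOpen_range hW (ψ := fun _ => a) continuous_const 0
      have hz := h.eq_zero_of_forall_setIntegral_mul_eq_zero (h.continuousOn_normalJump hJ)
        (h.integrableOn_normalJump hJ) (fun φ hφ hφc hφΩ => ?_) x hx
      · rwa [h.normalJump_noetherFlux hW hext _ 0 hx] at hz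
      · have hψ : IsTestMap Ω fun z => φ z • a :=
          ⟨hφ.smul contDiff_const, hφc.smul_right, (tsupport_smul_subset_left _ _).trans hφΩ⟩
        have h1 := h.setIntegral_eshelby hW hext hψ
        rw [hst _ hψ, zero_eq_neg] at h1
        refine Eq.trans (setIntegral_congr_fun h.measurableSet_inter fun z hz => ?_) h1
        beta_reduce
        rw [h.normalJump_noetherFlux hW hext _ 0 hz, real_inner_smul_right]
        ring
    by_contra hne
    have h0 : ν x = 0 := by
      ext α
      have := (mul_eq_zero.1 (hα α)).resolve_left hne
      rw [EuclideanSpace.inner_single_right] at this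
      simpa using this
    have := h.norm_normal hx
    rw [h0, norm_zero] at this
    exact zero_ne_one this
  · intro hp
    refine ⟨hext, fun ψ hψ => ?_⟩
    rw [h.setIntegral_eshelby hW hext hψ, setIntegral_eq_zero_of_forall_eq_zero, neg_zero]
    intro z hz
    rw [hp z hz, zero_mul]

end BoundedJumpSetting

end

end Clapeyron

/-- Generalized Clapeyron theorem. -/
theorem mainTheorem1 {m n : ℕ} (hn : 0 < n)
    -- the domain
    (Ω : Set (Euc n)) (hΩo : IsOpen Ω) (hΩb : Bornology.IsBounded Ω)
    (hΩL : HasLipschitzBoundary Ω)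
    -- the surface, relatively closed in `Ω`, of finite area, which may reach the boundary of `Ω`
    (S : Set (Euc n)) (hS : S ⊆ closure Ω) (hSc : closure S ∩ Ω ⊆ S)
    (hSfin : μHE[n - 1] S < ⊤) (hSbd : μHE[n - 1] (S ∩ frontier Ω) = 0)
    -- the configuration, with its one-sided gradients on the surface
    (y : Euc n → Euc m) (hyL : ∃ K : NNReal, LipschitzOnWith K y Ω)
    (hyC : ContDiffOn ℝ 2 y (closure Ω \ S))
    (ν : Euc n → Euc n) (Fp Fm : Euc n → Mat m n)
    (hjump : ∀ x ∈ S ∩ Ω, HasGradientJump S y x (ν x) (Fp x) (Fm x))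
    -- the energy density, `C¹` around the closure of the range of `(x, y, ∇y)`
    (W : Euc n → Euc m → Mat m n → ℝ)
    (U : Set (Euc n × Euc m × Mat m n)) (hU : IsOpen U)
    (hrange : closure ((fun x => (x, y x, fderiv ℝ y x)) '' (Ω \ S)) ⊆ U)
    (hW : ContDiffOn ℝ 1 (fun q : Euc n × Euc m × Mat m n => W q.1 q.2.1 q.2.2) U)
    (hWscale : ScaleFree W)
    (hext : IsExtremal W Ω y) :
    IntegrableOn (fun x => W x (y x) (fderiv ℝ y x)) Ω ∧
    IntegrableOn (fun x => tractionWork W x (outwardNormal Ω x) (y x)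
      (fderivWithin ℝ y (closure Ω \ S) x)) (frontier Ω) μHE[n - 1] ∧
    IntegrableOn (fun x => pStar W x (y x) (Fp x) (Fm x) * inner ℝ (ν x) x) S μHE[n - 1] ∧
    (n : ℝ) * energy W Ω y =
      (∫ x in frontier Ω, tractionWork W x (outwardNormal Ω x) (y x)
        (fderivWithin ℝ y (closure Ω \ S) x) ∂μHE[n - 1])
      - (∫ x in S, pStar W x (y x) (Fp x) (Fm x) * inner ℝ (ν x) x ∂μHE[n - 1]) ∧
    (IsStationaryConfig W Ω y ↔ ∀ x ∈ S ∩ Ω, pStar W x (y x) (Fp x) (Fm x) = 0) ∧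
    (IsStationaryConfig W Ω y →
      energy W Ω y = 1 / (n : ℝ) *
        ∫ x in frontier Ω, tractionWork W x (outwardNormal Ω x) (y x)
          (fderivWithin ℝ y (closure Ω \ S) x) ∂μHE[n - 1]) := by
  obtain ⟨k, rfl⟩ : ∃ k, n = k + 1 := ⟨n - 1, by omega⟩
  simp only [Nat.add_sub_cancel] at hSfin hSbd ⊢
  have h : BoundedJumpSetting Ω S y ν Fp Fm U :=
    { isOpen := hΩo
      bounded := hΩb
      closed := hSc
      area := hSfin
      lipschitz := hyL
      contDiffOn := hyC.mono (sdiff_subset_sdiff_left subset_closure)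
      jump := hjump
      isOpen_range := hU
      range_subset := hrange
      lipschitzBoundary := hΩL
      boundary_null := hSbd
      contDiffOn_closure := hyC }
  replace hW : ContDiffOn ℝ 1 (density W) U := hW
  have hJ := isFlux_noetherFlux hU hW (ψ := id) continuous_id 1
  have hf : IntegrableOn (fun z => -noetherSource W id 1 (jet y z)) Ω :=
    (h.integrableOn_comp_jet (continuousOn_noetherSource hU hW contDiff_id 1)).neg
  -- The part of `S` outside Ω lies on the boundary and has zero area, so integrals over `S` and
  -- over its part in Ω agree.
  have hsurf : μHE[k].restrict S = μHE[k].restrict (S ∩ Ω) := by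
    have hnull : ∀ᵐ z ∂μHE[k], z ∉ S ∩ frontier Ω := measure_eq_zero_iff_ae_notMem.1 hSbd
    refine Measure.restrict_congr_set ?_
    filter_upwards [hnull] with z hz
    refine propext ⟨fun hzS => ⟨hzS, ?_⟩, fun hzS => hzS.1⟩
    by_contra hzΩ
    exact hz ⟨hzS, by rw [hΩo.frontier_eq]; exact ⟨hS hzS, hzΩ⟩⟩
  have hbd : ∀ᵐ z ∂μHE[k].restrict (frontier Ω), boundaryFlux (noetherFlux W id 1) Ω S y z =
      tractionWork W z (outwardNormal Ω z) (y z) (fderivWithin ℝ y (closure Ω \ S) z) :=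
    h.ae_frontier_notMem.mono fun z hz => h.boundaryFlux_noetherFlux hW hz
  have henergy : ((k + 1 : ℕ) : ℝ) * energy W Ω y =
      (∫ x in frontier Ω, tractionWork W x (outwardNormal Ω x) (y x)
        (fderivWithin ℝ y (closure Ω \ S) x) ∂μHE[k])
      - (∫ x in S, pStar W x (y x) (Fp x) (Fm x) * inner ℝ (ν x) x ∂μHE[k]) := by
    have key := h.setIntegral_noetherSource hW hext contDiff_id 1
    rw [integral_congr_ae hbd] at key
    rw [hsurf, energy, ← integral_const_mul]
    refine Eq.trans (integral_congr_ae ?_) key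
    filter_upwards [h.ae_mem_diff] with z hz using (h.noetherSource_id hW hWscale hz).symm
  have hiff := h.isStationaryConfig_iff hW hext
  refine ⟨h.integrableOn_comp_jet hW.continuousOn, ?_, ?_, henergy, hiff, fun hst => ?_⟩
  · exact (integrable_congr hbd).1 (h.integrableOn_boundaryFlux hJ hf fun φ hφ hφc hφs =>
      h.noetherFlux_weak hW hext contDiff_id 1 hφ hφc hφs)
  · rw [IntegrableOn, hsurf]
    exact (h.integrableOn_normalJump hJ).congr_fun
      (fun z hz => h.normalJump_noetherFlux hW hext id 1 hz) h.measurableSet_inter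
  · have h0 : ∫ x in S, pStar W x (y x) (Fp x) (Fm x) * inner ℝ (ν x) x ∂μHE[k] = 0 := by
      rw [hsurf]
      exact setIntegral_eq_zero_of_forall_eq_zero fun z hz => by rw [hiff.1 hst z hz, zero_mul]
    rw [h0, sub_zero] at henergy
    rw [← henergy]
    have : ((k + 1 : ℕ) : ℝ) ≠ 0 := by positivity
    field_simp
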